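/- Let $k$ be a field; all sheaves are sheaves of $k$-vector spaces. For $\theta\in S^1=\mathbb R/2\pi\mathbb Z$ and $\lambda\in\mathbb R$ put $\mathcal H_{\theta,\lambda}=\{x\in\mathbb C:\operatorname{Re}(xe^{-i\theta})>\lambda\}$, with closure $\overline{\mathcal H}_{\theta,\lambda}$, and for $z=e^{\lambda}e^{i\theta}\in\mathbb C^*$ put $\mathcal H_z=\mathcal H_{\theta,\lambda}$. For $\xi\in\mathbb C$ let $S_\xi=\{\rho e^{i\theta}\in\mathbb C^*:\rho=\exp(\operatorname{Re}(\xi e^{-i\theta}))\}$; write $S_\xi<z$ if $z=\rho e^{i\theta}$ with $\rho>\exp(\operatorname{Re}(\xi e^{-i\theta}))$, and $\xi_1<_\theta\xi_2$ if $\operatorname{Re}(\xi_1e^{-i\theta})<\operatorname{Re}(\xi_2e^{-i\theta})$. Let $\pi\colon\mathbb C^*\to S^1$, $\rho e^{i\theta}\mapsto\theta$. *Constructible sheaves.* $\mathrm{Constr}_0$ is the category of sheaves $\mathcal F$ on $\mathbb C$ with finite-dimensional stalks that are locally constant outside a finite set (whose points are the singularities) and satisfy $H^n(\mathbb C,\mathcal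 F)=0$ for all $n\ge 0$. *Co-Stokes structures.* A co-Stokes structure of exponential type with exponents $c_1,\dots,c_n\in\mathbb C$ is a local system $\mathcal L$ of finite-dimensional vector spaces on $S^1$ with subsheaves $\mathcal L_{<\xi}\subset\mathcal L$ ($\xi\in\mathbb C$) such that $\xi_1<_\theta\xi_2$ implies $\mathcal L_{<\xi_1,\theta}\subset\mathcal L_{<\xi_2,\theta}$, and such that there are local systems $\operatorname{gr}_{c_i}$ on $S^1$ and, locally on $S^1$, isomorphisms $\mathcal L\simeq\bigoplus_i\operatorname{gr}_{c_i}$ carrying, for every $\xi$, the stalk $\mathcal L_{<\xi,\theta}$ to $\bigoplus_{c_i<_\theta\xi}\operatorname{gr}_{c_i,\theta}$. *Co-Stokes sheaves.* A co-Stokes sheaf with exponents $c_1,\dots,c_n$ is a pair $(\mathcal L,\mathcal G)$ of a local system $\mathcal L$ of finite-dimensional vector spaces on $\mathbb C^*$ and a subsheaf $\mathcal G$ such that every point has an open neighbourhood $U$ on which $\mathcal L|_U=\bigoplus_i\operatorname{gr}_{c_i}$ with constant sheaves $\operatorname{gr}_{c_i}$ and $\mathcal G_{z}=\bigoplus_{S_{c_i}<z}\operatorname{gr}_{c_i}$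 for all $z\in U$. Morphisms are morphisms of local systems that carry subsheaf to subsheaf. *The functor $\Psi$.* For $\mathcal F\in\mathrm{Constr}_0$ let $\Psi(\mathcal F)=(\mathcal L,\mathcal L_<)$ with $\mathcal L=\operatorname{colim}_{\lambda\to+\infty}R^0q_{\lambda*}p_\lambda^*\mathcal F$ and $\mathcal L_{<\xi}=R^0q_{\xi*}p_\xi^*\mathcal F$, where $p_\lambda,q_\lambda$ and $p_\xi,q_\xi$ are the projections to $\mathbb C$ and $S^1$ of $\bigcup_{\theta}\mathcal H_{\theta,\lambda}\times\{\theta\}$ and of $\bigcup_\theta\overline{\mathcal H}_{\theta,\operatorname{Re}(\xi e^{-i\theta})}\times\{\theta\}$, respectively; $\mathcal L_{<\xi}\to\mathcal L$ is given by restriction of sections. *The functor $\sigma$.* For a co-Stokes structure $(\mathcal L,\mathcal L_<)$ let $\sigma(\mathcal L,\mathcal L_<)=(\pi^*\mathcal L,\mathcal G)$, where $\mathcal G\subset\pi^*\mathcal L$ is the subsheaf with $\mathcal G_z=\mathcal L_{<\xi,\theta}$ whenever $z\in S_\xi$ has argument $\theta$. **Theorem.** Let $p_1,q_1$ be the projections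 of $\bigcup_{z\in\mathbb C^*}\mathcal H_z\times\{z\}\subset\mathbb C\times\mathbb C^*$ to $\mathbb C$ and $\mathbb C^*$, and for $r\in\mathbb R$ let $m_r,n_r$ be those of $\bigcup_{z=|z|e^{i\theta}\in\mathbb C^*}\mathcal H_{\theta,r}\times\{z\}$. There is a unique natural transformation $$R^0q_{1*}p_1^*\longrightarrow \operatorname{colim}_{r\to+\infty}R^0n_{r*}m_r^*$$ given by restriction of sections: for every $r$, its composite with the restriction map from $X_r=\bigcup_z(\mathcal H_z\cup\mathcal H_{\theta,r})\times\{z\}$ to $\bigcup_z\mathcal H_z\times\{z\}$ is the restriction from $X_r$ to $\bigcup_z\mathcal H_{\theta,r}\times\{z\}$ followed by the map to the colimit. For every $\mathcal F\in\mathrm{Constr}_0$ with singularities in a finite set $S$, $\Psi(\mathcal F)$ is a co-Stokes structure with exponents $S$, the sheaf $\mathcal G$ in $\sigma\Psi(\mathcal F)$ has the stalks prescribed above, and both $\sigma\Psi(\mathcal F)$ and $\big(\operatorname{colim}_{r\to+\infty}R^0n_{r*}m_r^*\mathcal F,\ R^0q_{1*}p_1^*\mathcal F\big)$ are co-Stokes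 sheaves with exponents $S$. There is an isomorphism of co-Stokes sheaves, natural in $\mathcal F\in\mathrm{Constr}_0$, $$\sigma\Psi(\mathcal F)\;\simeq\;\big(\operatorname{colim}_{r\to+\infty}R^0n_{r*}m_r^*\mathcal F,\ R^0q_{1*}p_1^*\mathcal F\big).$$ -/

import Mathlib

open CategoryTheory TopologicalSpace Opposite

noncomputable section

namespace TopLaplace

/-! ### Sheaves of `k`-vector spaces and sheaf operations along incidence spaces -/

/-- Sheaves of `k`-vector spaces on a topological space. -/
abbrev Sh (k : Type) [Field k] (X : Type) [TopologicalSpace X] :=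
  TopCat.Sheaf (ModuleCat.{0} k) (TopCat.of X)

section Correspondences

variable {k : Type} [Field k] {X Y : Type} [TopologicalSpace X] [TopologicalSpace Y]

/-- The first projection of a subspace `Z` of `X × Y`. -/
def projFst (Z : Set (X × Y)) : TopCat.of Z ⟶ TopCat.of X :=
  TopCat.ofHom ⟨fun w => w.1.1, continuous_fst.comp continuous_subtype_val⟩

/-- The second projection of a subspace `Z` of `X × Y`. -/
def projSnd (Z : Set (X × Y)) : TopCat.of Z ⟶ TopCat.of Y :=
  TopCat.ofHom ⟨fun w => w.1.2, continuous_snd.comp continuous_subtype_val⟩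

/-- The inclusion of one subspace of `X × Y` in another. -/
def inclMap {Z' Z : Set (X × Y)} (h : Z' ⊆ Z) : TopCat.of Z' ⟶ TopCat.of Z :=
  TopCat.ofHom ⟨Set.inclusion h, continuous_inclusion h⟩

variable (k) in
/-- The functor `R⁰q_* p^*` for the two projections `p : Z ⟶ X`, `q : Z ⟶ Y` of a subspace
`Z` of `X × Y`. -/
def pullPush (Z : Set (X × Y)) : Sh k X ⥤ Sh k Y :=
  TopCat.Sheaf.pullback (ModuleCat.{0} k) (projFst Z) ⋙
    TopCat.Sheaf.pushforward (ModuleCat.{0} k) (projSnd Z)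

variable (k) in
/-- The adjunction `p^* ⊣ p_*` for the first projection. -/
abbrev adjFst (Z : Set (X × Y)) :=
  TopCat.Sheaf.pullbackPushforwardAdjunction (ModuleCat.{0} k) (projFst Z)

/-- For the inclusion `i : Z' ⟶ Z` and the first projections `p`, `p' = p ∘ i`, the natural map
`p^* F ⟶ i_* p'^* F` (that is, `p^* F ⟶ i_* i^* p^* F`): under `p^* ⊣ p_*` it corresponds to the
unit `F ⟶ p'_* p'^* F`, where `p'_* = p_* i_*`. -/
def baseRes {Z' Z : Set (X × Y)} (h : Z' ⊆ Z) (F : Sh k X) :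
    (TopCat.Sheaf.pullback (ModuleCat.{0} k) (projFst Z)).obj F ⟶
      (TopCat.Sheaf.pushforward (ModuleCat.{0} k) (inclMap h)).obj
        ((TopCat.Sheaf.pullback (ModuleCat.{0} k) (projFst Z')).obj F) :=
  ((adjFst k Z).homEquiv F _).symm
    (show F ⟶ (TopCat.Sheaf.pushforward (ModuleCat.{0} k) (projFst Z)).obj
      ((TopCat.Sheaf.pushforward (ModuleCat.{0} k) (inclMap h)).obj
        ((TopCat.Sheaf.pullback (ModuleCat.{0} k) (projFst Z')).obj F)) from
      (adjFst k Z').unit.app F)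

theorem unit_baseRes {Z' Z : Set (X × Y)} (h : Z' ⊆ Z) (F : Sh k X) :
    (adjFst k Z).unit.app F ≫
      (TopCat.Sheaf.pushforward (ModuleCat.{0} k) (projFst Z)).map (baseRes h F) =
    (adjFst k Z').unit.app F := by
  have := ((adjFst k Z).homEquiv F _).apply_symm_apply
    (show F ⟶ (TopCat.Sheaf.pushforward (ModuleCat.{0} k) (projFst Z)).obj
      ((TopCat.Sheaf.pushforward (ModuleCat.{0} k) (inclMap h)).obj
        ((TopCat.Sheaf.pullback (ModuleCat.{0} k) (projFst Z')).obj F)) from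
      (adjFst k Z').unit.app F)
  rw [Adjunction.homEquiv_unit] at this
  exact this

theorem pull_hom_ext {Z : Set (X × Y)} {F : Sh k X} {B : Sh k Z}
    {f g : (TopCat.Sheaf.pullback (ModuleCat.{0} k) (projFst Z)).obj F ⟶ B}
    (h : (adjFst k Z).unit.app F ≫ (TopCat.Sheaf.pushforward _ (projFst Z)).map f =
      (adjFst k Z).unit.app F ≫ (TopCat.Sheaf.pushforward _ (projFst Z)).map g) : f = g := by
  apply ((adjFst k Z).homEquiv F _).injective
  rw [Adjunction.homEquiv_unit, Adjunction.homEquiv_unit]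
  exact h

/-- The restriction map `R⁰q_* p^* ⟶ R⁰q'_* p'^*` along an inclusion `Z' ⊆ Z`, induced by
`id ⟶ i_* i^*`. -/
def pullPushRes {Z' Z : Set (X × Y)} (h : Z' ⊆ Z) : pullPush k Z ⟶ pullPush k Z' where
  app F := (TopCat.Sheaf.pushforward (ModuleCat.{0} k) (projSnd Z)).map (baseRes h F)
  naturality F F' f := by
    have key : (TopCat.Sheaf.pullback (ModuleCat.{0} k) (projFst Z)).map f ≫ baseRes h F' =
        baseRes h F ≫ (TopCat.Sheaf.pushforward (ModuleCat.{0} k) (inclMap h)).map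
          ((TopCat.Sheaf.pullback (ModuleCat.{0} k) (projFst Z')).map f) := by
      apply pull_hom_ext
      have e1 := (adjFst k Z).unit.naturality f
      have e2 := (adjFst k Z').unit.naturality f
      simp only [Functor.id_map, Functor.comp_map] at e1 e2
      rw [Functor.map_comp, Functor.map_comp, ← Category.assoc, ← Category.assoc,
        unit_baseRes, ← e1, Category.assoc, unit_baseRes]
      exact e2
    exact ((TopCat.Sheaf.pushforward (ModuleCat.{0} k) (projSnd Z)).map_comp _ _).symm.trans
      ((congrArg (TopCat.Sheaf.pushforward (ModuleCat.{0} k) (projSnd Z)).map key).trans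
        ((TopCat.Sheaf.pushforward (ModuleCat.{0} k) (projSnd Z)).map_comp _ _))

theorem pullPushRes_self (Z : Set (X × Y)) :
    pullPushRes (k := k) (subset_refl Z) = 𝟙 _ := by
  ext1
  funext F
  have : baseRes (subset_refl Z) F = 𝟙 _ := by
    apply pull_hom_ext
    rw [unit_baseRes]
    exact (((congrArg ((adjFst k Z).unit.app F ≫ ·)
      ((TopCat.Sheaf.pushforward (ModuleCat.{0} k) (projFst Z)).map_id _))).trans
        (Category.comp_id _)).symm
  exact (congrArg (TopCat.Sheaf.pushforward (ModuleCat.{0} k) (projSnd Z)).map this).trans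
    ((TopCat.Sheaf.pushforward (ModuleCat.{0} k) (projSnd Z)).map_id _)

theorem pullPushRes_comp {Z'' Z' Z : Set (X × Y)} (h : Z' ⊆ Z) (h' : Z'' ⊆ Z') :
    pullPushRes (k := k) h ≫ pullPushRes h' = pullPushRes (h'.trans h) := by
  ext1
  funext F
  have : baseRes h F ≫
      (TopCat.Sheaf.pushforward (ModuleCat.{0} k) (inclMap h)).map (baseRes h' F) =
      baseRes (h'.trans h) F := by
    apply pull_hom_ext
    rw [Functor.map_comp, ← Category.assoc, unit_baseRes]
    exact (unit_baseRes h' F).trans (unit_baseRes (h'.trans h) F).symm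
  exact ((TopCat.Sheaf.pushforward (ModuleCat.{0} k) (projSnd Z)).map_comp _ _).symm.trans
    (congrArg (TopCat.Sheaf.pushforward (ModuleCat.{0} k) (projSnd Z)).map this)

variable (k) in
/-- The direct system `r ↦ R⁰q_{r*} p_r^*` of a decreasing family of subspaces `Z r`. -/
def pullPushDiagram (Z : ℝ → Set (X × Y)) (hZ : Antitone Z) : ℝ ⥤ Sh k X ⥤ Sh k Y where
  obj r := pullPush k (Z r)
  map f := pullPushRes (hZ f.le)
  map_id _ := pullPushRes_self _
  map_comp _ _ := (pullPushRes_comp _ _).symm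

variable (k) in
/-- The functor `F ↦ colim_{r → +∞} R⁰q_{r*} p_r^* F`. -/
def colimPullPush (Z : ℝ → Set (X × Y)) (hZ : Antitone Z) : Sh k X ⥤ Sh k Y :=
  (pullPushDiagram k Z hZ).flip ⋙ Limits.colim

variable (k) in
/-- The map `R⁰q_{r*} p_r^* ⟶ colim_r R⁰q_{r*} p_r^*`. -/
def toColim (Z : ℝ → Set (X × Y)) (hZ : Antitone Z) (r : ℝ) :
    pullPush k (Z r) ⟶ colimPullPush k Z hZ where
  app F := Limits.colimit.ι ((pullPushDiagram k Z hZ).flip.obj F) r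
  naturality _ _ f :=
    (Limits.ι_colimMap ((pullPushDiagram k Z hZ).flip.map f) r).symm

end Correspondences

section Stalks

variable {k : Type} [Field k] {Y : Type} [TopologicalSpace Y]

/-- The stalk `A_y`. -/
abbrev stk (A : Sh k Y) (y : Y) : ModuleCat.{0} k := A.presheaf.stalk (X := TopCat.of Y) y

/-- The space of sections `A(U)`. -/
abbrev sec (A : Sh k Y) (U : Opens Y) : ModuleCat.{0} k :=
  A.presheaf.obj (op (U : Opens (TopCat.of Y)))

/-- The germ map `A(U) → A_y`. -/
def germ (A : Sh k Y) (U : Opens Y) (y : Y) (hy : y ∈ U) : sec A U →ₗ[k] stk A y :=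
  (A.presheaf.germ (X := TopCat.of Y) U y hy).hom

/-- The map on stalks induced by a morphism of sheaves. -/
def stalkMap {A B : Sh k Y} (f : A ⟶ B) (y : Y) : stk A y →ₗ[k] stk B y :=
  ((TopCat.Presheaf.stalkFunctor (X := TopCat.of Y) (ModuleCat.{0} k) y).map f.hom).hom

/-- The image of `A_y` in `B_y`. -/
def stalkRange {A B : Sh k Y} (f : A ⟶ B) (y : Y) : Submodule k (stk B y) :=
  LinearMap.range (stalkMap f y)

/-- Sections all of whose germs lie in prescribed subspaces of the stalks. -/
def secIn (A : Sh k Y) (P : ∀ y, Submodule k (stk A y)) (U : Opens Y) : Submodule k (sec A U) :=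
  ⨅ y : U, (P y).comap (germ A U y y.2)

theorem mem_secIn {A : Sh k Y} {P : ∀ y, Submodule k (stk A y)} {U : Opens Y} {s : sec A U} :
    s ∈ secIn A P U ↔ ∀ (y : Y) (hy : y ∈ U), germ A U y hy s ∈ P y := by
  simp [secIn]

theorem germ_map {A : Sh k Y} {U V : Opens Y} (i : V ⟶ U) (y : Y) (hy : y ∈ V) (s : sec A U) :
    germ A V y hy ((A.presheaf.map (Quiver.Hom.op (V := Opens (TopCat.of Y)) i)).hom s) =
      germ A U y (i.le hy) s :=
  TopCat.Presheaf.germ_res_apply A.presheaf i y hy s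

theorem stalkMap_germ {A B : Sh k Y} (f : A ⟶ B) (U : Opens Y) (y : Y) (hy : y ∈ U)
    (s : sec A U) :
    stalkMap f y (germ A U y hy s) = germ B U y hy ((f.hom.app (op U)).hom s) :=
  TopCat.Presheaf.stalkFunctor_map_germ_apply (X := TopCat.of Y) U y hy f.hom s

theorem stalkMap_comp {A B C : Sh k Y} (f : A ⟶ B) (g : B ⟶ C) (y : Y) (x : stk A y) :
    stalkMap (f ≫ g) y x = stalkMap g y (stalkMap f y x) :=
  congrArg (fun φ => φ.hom x)
    ((TopCat.Presheaf.stalkFunctor (X := TopCat.of Y) (ModuleCat.{0} k) y).map_comp f.hom g.hom)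

/-- The presheaf of sections whose germs lie in `P`. -/
def subPresheaf (A : Sh k Y) (P : ∀ y, Submodule k (stk A y)) :
    TopCat.Presheaf (ModuleCat.{0} k) (TopCat.of Y) where
  obj U := ModuleCat.of k (secIn A P U.unop)
  map {U V} i := ModuleCat.ofHom ((A.presheaf.map i).hom.restrict (p := secIn A P U.unop)
    (q := secIn A P V.unop) (fun s hs => mem_secIn.2 fun y hy => by
      have := germ_map (A := A) i.unop y hy s
      rw [show i = i.unop.op from rfl, this]
      exact mem_secIn.1 hs y _))
  map_id U := by
    refine ModuleCat.hom_ext (LinearMap.ext fun s => Subtype.ext ?_)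
    exact congrArg (fun φ => φ.hom s.1) (A.presheaf.map_id U)
  map_comp f g := by
    refine ModuleCat.hom_ext (LinearMap.ext fun s => Subtype.ext ?_)
    exact congrArg (fun φ => φ.hom s.1) (A.presheaf.map_comp f g)

theorem subPresheaf_isSheaf (A : Sh k Y) (P : ∀ y, Submodule k (stk A y)) :
    (subPresheaf A P).IsSheaf := by
  rw [TopCat.Presheaf.isSheaf_iff_isSheaf_comp (forget (ModuleCat.{0} k))]
  refine TopCat.Presheaf.isSheaf_of_isSheafUniqueGluing_types _ fun {ι} U sf hsf => ?_
  obtain ⟨s, hs, huniq⟩ := TopCat.Sheaf.existsUnique_gluing A U (fun i => (sf i).1)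
    (fun i j => congrArg Subtype.val (hsf i j))
  refine ⟨⟨s, mem_secIn.2 fun y hy => ?_⟩, fun i => Subtype.ext (hs i), fun t ht =>
    Subtype.ext (huniq t.1 fun i => congrArg Subtype.val (ht i))⟩
  obtain ⟨i, hi⟩ := Opens.mem_iSup.1 hy
  rw [← germ_map (A := A) (Opens.leSupr U i) y hi s]
  have h1 : germ A (U i) y hi (sf i).1 ∈ P y := mem_secIn.1 (sf i).2 y hi
  have h2 : (A.presheaf.map (Opens.leSupr U i).op).hom s = (sf i).1 := hs i
  rw [h2]
  exact h1

/-- The subsheaf of `A` of sections whose germ at each `y` lies in the subspace `P y` of `A_y`.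
If the union of the `P y` is open in the étale space of `A`, it is the unique subsheaf of `A` with
stalks `P y`. -/
def subSheaf (A : Sh k Y) (P : ∀ y, Submodule k (stk A y)) : Sh k Y :=
  ⟨subPresheaf A P, subPresheaf_isSheaf A P⟩

/-- The inclusion of the subsheaf. -/
def subSheafIncl (A : Sh k Y) (P : ∀ y, Submodule k (stk A y)) : subSheaf A P ⟶ A :=
  ⟨{ app := fun U => ModuleCat.ofHom (secIn A P U.unop).subtype
     naturality := fun _ _ _ => rfl }⟩

/-- A morphism that respects the prescribed subspaces of the stalks restricts to the
subsheaves. -/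
theorem exists_subSheaf_map {A B : Sh k Y} (f : A ⟶ B) (P : ∀ y, Submodule k (stk A y))
    (Q : ∀ y, Submodule k (stk B y)) (h : ∀ y, (P y).map (stalkMap f y) ≤ Q y) :
    ∃ g : subSheaf A P ⟶ subSheaf B Q, g ≫ subSheafIncl B Q = subSheafIncl A P ≫ f := by
  refine ⟨⟨{ app := fun U => ModuleCat.ofHom ((f.hom.app U).hom.restrict
    (p := secIn A P U.unop) (q := secIn B Q U.unop) (fun s hs => mem_secIn.2 fun y hy => ?_))
             naturality := fun U V i => ?_ }⟩, ?_⟩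
  · rw [← stalkMap_germ f U.unop y hy s]
    exact h y (Submodule.mem_map_of_mem (mem_secIn.1 hs y hy))
  · ext s
    exact Subtype.ext (congrArg (fun φ => φ.hom s.1) (f.hom.naturality i))
  · rfl

/-- `A` is constant on `U` with a finite-dimensional fibre `V`: there is an isomorphism from the
constant sheaf with fibre `V` on `U` to `A|_U`. Such a morphism is a linear map `V → A(U)`, and
it is an isomorphism if and only if it induces bijections `V → A_y` for all `y ∈ U`. -/
def IsConstantOn (A : Sh k Y) (U : Opens Y) : Prop :=
  ∃ V : ModuleCat.{0} k, Module.Finite k V ∧ ∃ t : V →ₗ[k] sec A U,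
    ∀ (y : Y) (hy : y ∈ U), Function.Bijective (germ A U y hy ∘ₗ t)

/-- Local systems of finite-dimensional vector spaces. -/
def IsLocalSystem (A : Sh k Y) : Prop :=
  ∀ y : Y, ∃ U : Opens Y, y ∈ U ∧ IsConstantOn A U

end Stalks

/-! ### Constructible sheaves with vanishing cohomology -/

/-- `F` is a constructible sheaf of finite-dimensional vector spaces on `ℂ` whose singularities
are contained in the finite set `S`. -/
def IsConstructible {k : Type} [Field k] (S : Finset ℂ) (F : Sh k ℂ) : Prop :=
  (∀ x : ℂ, x ∉ S → ∃ U : Opens ℂ, x ∈ U ∧ IsConstantOn F U) ∧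
    ∀ x : ℂ, Module.Finite k (stk F x)

/-- The sheaf cohomology of `F` vanishes in all degrees. -/
def IsAcyclic {k : Type} [Field k] (F : Sh k ℂ) : Prop :=
  ∀ n : ℕ, Subsingleton (Sheaf.H.{0}
    ((sheafCompose _ (forget₂ (ModuleCat.{0} k) AddCommGrpCat.{0})).obj F) n)

/-- The full subcategory `Constr₀` of constructible sheaves with vanishing cohomology. -/
def Constr₀ (k : Type) [Field k] : ObjectProperty (Sh k ℂ) :=
  fun F => (∃ S : Finset ℂ, IsConstructible S F) ∧ IsAcyclic F

/-! ### Circles and half-planes -/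

/-- `Re (x e^{-iθ})` for `u = e^{iθ}`. -/
def reDir (u : Circle) (x : ℂ) : ℝ := (x * (starRingEnd ℂ) (u : ℂ)).re

theorem reDir_le_norm (u : Circle) (x : ℂ) : reDir u x ≤ ‖x‖ := by
  refine (Complex.re_le_norm _).trans (le_of_eq ?_)
  rw [norm_mul, RCLike.norm_conj, Circle.norm_coe, mul_one]

/-- The punctured plane `ℂ*`. -/
abbrev Cstar : Type := {z : ℂ // z ≠ 0}

/-- The projection `π : ℂ* → S¹`, `r e^{iθ} ↦ e^{iθ}`. -/
def dir (z : Cstar) : Circle :=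
  ⟨(z : ℂ) / (‖(z : ℂ)‖ : ℂ), by
    have : ‖(z : ℂ)‖ ≠ 0 := norm_ne_zero_iff.2 z.2
    simp [Submonoid.unitSphere, this]⟩

theorem continuous_dir : Continuous dir := by
  refine Continuous.subtype_mk ?_ _
  refine continuous_subtype_val.div
    (Complex.continuous_ofReal.comp (continuous_norm.comp continuous_subtype_val)) ?_
  intro z
  simpa using z.2

/-- `π` as a morphism of topological spaces. -/
def dirMap : TopCat.of Cstar ⟶ TopCat.of Circle := TopCat.ofHom ⟨dir, continuous_dir⟩

/-- The circle `S_ξ = {ρ e^{iθ} : ρ = exp (Re (ξ e^{-iθ}))}`. -/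
def circ (ξ : ℂ) : Set Cstar := {z | ‖(z : ℂ)‖ = Real.exp (reDir (dir z) ξ)}

/-- The region of the points `z` with `S_ξ < z`, i.e. of the points outside `S_ξ`. -/
def outside (ξ : ℂ) : Set Cstar := {z | Real.exp (reDir (dir z) ξ) < ‖(z : ℂ)‖}

/-- The open half-plane `𝓗_{θ,r} = {x : Re (x e^{-iθ}) > r}`, `u = e^{iθ}`. -/
def halfPlane (u : Circle) (r : ℝ) : Set ℂ := {x | r < reDir u x}

/-- The closed half-plane `{x : Re (x e^{-iθ}) ≥ r}`, `u = e^{iθ}`. -/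
def closedHalfPlane (u : Circle) (r : ℝ) : Set ℂ := {x | r ≤ reDir u x}

/-- `⋃_θ 𝓗_{θ,r} × {θ} ⊆ ℂ × S¹`. -/
def incS (r : ℝ) : Set (ℂ × Circle) := {w | w.1 ∈ halfPlane w.2 r}

/-- `⋃_θ cl(𝓗_{θ,Re(ξ e^{-iθ})}) × {θ} ⊆ ℂ × S¹`: the closed half-planes with `ξ` on the
boundary. -/
def incSAt (ξ : ℂ) : Set (ℂ × Circle) := {w | w.1 ∈ closedHalfPlane w.2 (reDir w.2 ξ)}

/-- `⋃_z 𝓗_{θ,r} × {z} ⊆ ℂ × ℂ*`, where `θ = arg z`. -/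
def incC (r : ℝ) : Set (ℂ × Cstar) := {w | w.1 ∈ halfPlane (dir w.2) r}

/-- `⋃_z 𝓗_z × {z} ⊆ ℂ × ℂ*`, where `𝓗_z = 𝓗_{θ,λ}` for `z = e^λ e^{iθ}`. -/
def incH : Set (ℂ × Cstar) := {w | w.1 ∈ halfPlane (dir w.2) (Real.log ‖(w.2 : ℂ)‖)}

theorem antitone_incS : Antitone incS := fun _ _ h _ hw => lt_of_le_of_lt h hw

theorem antitone_incC : Antitone incC := fun _ _ h _ hw => lt_of_le_of_lt h hw

theorem incS_subset (ξ : ℂ) : incS ‖ξ‖ ⊆ incSAt ξ :=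
  fun w hw => (reDir_le_norm w.2 ξ).trans (le_of_lt hw)

/-! ### Co-Stokes structures -/

/-- A sheaf `L` on `S¹` with a family of sheaves `L_{<ξ}` over it, indexed by `ξ ∈ ℂ`. -/
structure FilteredSheaf (k : Type) [Field k] where
  /-- the sheaf `L` -/
  L : Sh k Circle
  /-- the sheaves `L_{<ξ}` -/
  Lt : ℂ → Sh k Circle
  /-- the maps `L_{<ξ} ⟶ L` -/
  incl : ∀ ξ, Lt ξ ⟶ L

/-- A morphism is a morphism `L ⟶ L'` that carries `L_{<ξ}` to `L'_{<ξ}` for all `ξ`. -/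
@[ext]
structure FilteredSheaf.Hom {k : Type} [Field k] (A B : FilteredSheaf k) where
  /-- the morphism `L ⟶ L'` -/
  hom : A.L ⟶ B.L
  preserves : ∀ ξ, ∃ g : A.Lt ξ ⟶ B.Lt ξ, g ≫ B.incl ξ = A.incl ξ ≫ hom

instance (k : Type) [Field k] : Category (FilteredSheaf k) where
  Hom := FilteredSheaf.Hom
  id A := ⟨𝟙 _, fun ξ => ⟨𝟙 _, by simp⟩⟩
  comp f g := ⟨f.hom ≫ g.hom, fun ξ => by
    obtain ⟨a, ha⟩ := f.preserves ξ
    obtain ⟨b, hb⟩ := g.preserves ξ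
    exact ⟨a ≫ b, by rw [Category.assoc, hb, ← Category.assoc, ha, Category.assoc]⟩⟩
  id_comp f := FilteredSheaf.Hom.ext (Category.id_comp _)
  comp_id f := FilteredSheaf.Hom.ext (Category.comp_id _)
  assoc f g h := FilteredSheaf.Hom.ext (Category.assoc _ _ _)

/-- `A` is a co-Stokes structure of exponential type with exponents in `S`: `L` is a local system,
the `L_{<ξ}` are subsheaves, increasing for `<_θ` at each `θ`, and there are local systems `gr_c`
on `S¹` such that locally on `S¹` there is an isomorphism `e` from `⨁_c gr_c` to `L` that carries
`⨁_c j_! j^* gr_c`, with `j` the inclusion of `{θ | c <_θ ξ}`, to `L_{<ξ}` for all `ξ`. The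
isomorphism over `U` is given by its maps on stalks, which have to carry sections to sections. -/
def IsCoStokesStructure {k : Type} [Field k] (S : Finset ℂ) (A : FilteredSheaf k) : Prop :=
  IsLocalSystem A.L ∧ (∀ ξ, Mono (A.incl ξ)) ∧
  (∀ (u : Circle) (ξ₁ ξ₂ : ℂ), reDir u ξ₁ < reDir u ξ₂ →
    stalkRange (A.incl ξ₁) u ≤ stalkRange (A.incl ξ₂) u) ∧
  ∃ gr : S → Sh k Circle, (∀ c, IsLocalSystem (gr c)) ∧
    ∀ u₀ : Circle, ∃ U : Opens Circle, u₀ ∈ U ∧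
      ∃ e : ∀ u : Circle, (∀ c : S, stk (gr c) u) →ₗ[k] stk A.L u,
        (∀ u ∈ U, Function.Bijective (e u)) ∧
        (∀ (W : Opens Circle), W ≤ U → ∀ s : ∀ c : S, sec (gr c) W, ∃ t : sec A.L W,
          ∀ (u : Circle) (hu : u ∈ W),
            germ A.L W u hu t = e u (fun c => germ (gr c) W u hu (s c))) ∧
        ∀ u ∈ U, ∀ (ξ : ℂ) (x : ∀ c : S, stk (gr c) u),
          e u x ∈ stalkRange (A.incl ξ) u ↔
            ∀ c : S, ¬ reDir u (c : ℂ) < reDir u ξ → x c = 0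

/-! ### Co-Stokes sheaves -/

/-- A sheaf `L` on `ℂ*` with a sheaf `G` over it. -/
structure SheafPair (k : Type) [Field k] where
  /-- the sheaf `L` -/
  L : Sh k Cstar
  /-- the sheaf `G` -/
  G : Sh k Cstar
  /-- the map `G ⟶ L` -/
  incl : G ⟶ L

/-- A morphism is a morphism `L ⟶ L'` that carries `G` to `G'`. -/
@[ext]
structure SheafPair.Hom {k : Type} [Field k] (A B : SheafPair k) where
  /-- the morphism `L ⟶ L'` -/
  hom : A.L ⟶ B.L
  preserves : ∃ g : A.G ⟶ B.G, g ≫ B.incl = A.incl ≫ hom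

instance (k : Type) [Field k] : Category (SheafPair k) where
  Hom := SheafPair.Hom
  id A := ⟨𝟙 _, 𝟙 _, by simp⟩
  comp f g := ⟨f.hom ≫ g.hom, by
    obtain ⟨a, ha⟩ := f.preserves
    obtain ⟨b, hb⟩ := g.preserves
    exact ⟨a ≫ b, by rw [Category.assoc, hb, ← Category.assoc, ha, Category.assoc]⟩⟩
  id_comp f := SheafPair.Hom.ext (Category.id_comp _)
  comp_id f := SheafPair.Hom.ext (Category.comp_id _)
  assoc f g h := SheafPair.Hom.ext (Category.assoc _ _ _)

/-- `(L, G)` is a co-Stokes sheaf with exponents in `S`: `G` is a subsheaf of `L`, and each point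
has a neighbourhood `U` with an isomorphism `t` from the constant sheaf with fibre `⨁_c gr_c` to
`L|_U` (see `IsConstantOn`) such that `G_z` is the sum of the `gr_c` with `S_c < z`, for all
`z ∈ U`. -/
def IsCoStokesSheaf {k : Type} [Field k] (S : Finset ℂ) (A : SheafPair k) : Prop :=
  Mono A.incl ∧ ∀ z₀ : Cstar, ∃ U : Opens Cstar, z₀ ∈ U ∧
    ∃ gr : S → ModuleCat.{0} k, (∀ c, Module.Finite k (gr c)) ∧
      ∃ t : (∀ c : S, gr c) →ₗ[k] sec A.L U, ∀ (z : Cstar) (hz : z ∈ U),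
        Function.Bijective (germ A.L U z hz ∘ₗ t) ∧
        ∀ x : ∀ c : S, gr c, germ A.L U z hz (t x) ∈ stalkRange A.incl z ↔
          ∀ c : S, z ∉ outside (c : ℂ) → x c = 0

/-! ### The functors `Ψ` and `σ` -/

/-- The functor `Ψ`, with `L = colim_λ R⁰q_{λ*} p_λ^* F` and `L_{<ξ} = R⁰q_{ξ*} p_ξ^* F`; the map
`L_{<ξ} ⟶ L` restricts sections to the half-planes `𝓗_{θ,λ}` with `λ = |ξ|`. -/
def Psi (k : Type) [Field k] : Sh k ℂ ⥤ FilteredSheaf k where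
  obj F :=
    { L := (colimPullPush k incS antitone_incS).obj F
      Lt := fun ξ => (pullPush k (incSAt ξ)).obj F
      incl := fun ξ =>
        (pullPushRes (incS_subset ξ) ≫ toColim k incS antitone_incS ‖ξ‖).app F }
  map f := ⟨(colimPullPush k incS antitone_incS).map f, fun ξ =>
    ⟨(pullPush k (incSAt ξ)).map f,
      (pullPushRes (incS_subset ξ) ≫ toColim k incS antitone_incS ‖ξ‖).naturality f⟩⟩
  map_id F := FilteredSheaf.Hom.ext ((colimPullPush k incS antitone_incS).map_id F)
  map_comp f g := FilteredSheaf.Hom.ext ((colimPullPush k incS antitone_incS).map_comp f g)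

/-- The pull-back `π^*` from `S¹` to `ℂ*`. -/
abbrev piPull (k : Type) [Field k] : Sh k Circle ⥤ Sh k Cstar :=
  TopCat.Sheaf.pullback (ModuleCat.{0} k) dirMap

/-- The subspace of the stalk of `π^* L` at `z` that is prescribed for `G`: the elements of
`L_{<ξ,θ}`, `θ = arg z`, for the `ξ` with `z ∈ S_ξ`. (In a co-Stokes structure `L_{<ξ,θ}` is the
same for all these `ξ`.) -/
def prescribed {k : Type} [Field k] (A : FilteredSheaf k) (z : Cstar) :
    Submodule k (stk ((piPull k).obj A.L) z) :=
  ⨅ (ξ : ℂ) (_ : z ∈ circ ξ), stalkRange ((piPull k).map (A.incl ξ)) z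

/-- The functor `σ : (L, L_<) ↦ (π^* L, G)`. -/
def sigma (k : Type) [Field k] : FilteredSheaf k ⥤ SheafPair k where
  obj A :=
    { L := (piPull k).obj A.L
      G := subSheaf ((piPull k).obj A.L) (prescribed A)
      incl := subSheafIncl _ _ }
  map {A B} f := ⟨(piPull k).map f.hom, by
    refine exists_subSheaf_map _ _ _ fun z => ?_
    rintro _ ⟨x, hx, rfl⟩
    simp only [prescribed, Submodule.mem_iInf, SetLike.mem_coe] at hx ⊢
    intro ξ hξ
    obtain ⟨y, rfl⟩ := hx ξ hξ
    obtain ⟨g, hg⟩ := f.preserves ξ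
    refine ⟨stalkMap ((piPull k).map g) z y, ?_⟩
    rw [← stalkMap_comp, ← stalkMap_comp, ← Functor.map_comp, ← Functor.map_comp, hg]⟩
  map_id A := SheafPair.Hom.ext ((piPull k).map_id A.L)
  map_comp f g := SheafPair.Hom.ext ((piPull k).map_comp f.hom g.hom)

/-- `σ(A) = (π^* L, G)` has the defining property of `σ`: `G_z = L_{<ξ,θ}` in the stalk of
`π^* L` at `z`, whenever `z ∈ S_ξ`. -/
def HasPrescribedStalks {k : Type} [Field k] (A : FilteredSheaf k) : Prop :=
  ∀ (z : Cstar) (ξ : ℂ), z ∈ circ ξ →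
    stalkRange ((sigma k).obj A).incl z = stalkRange ((piPull k).map (A.incl ξ)) z

/-! ### The direct description -/

/-- The functor `F ↦ colim_{r → +∞} R⁰n_{r*} m_r^* F`. -/
abbrev directL (k : Type) [Field k] : Sh k ℂ ⥤ Sh k Cstar := colimPullPush k incC antitone_incC

/-- The functor `F ↦ R⁰q_{1*} p_1^* F`. -/
abbrev directG (k : Type) [Field k] : Sh k ℂ ⥤ Sh k Cstar := pullPush k incH

/-- The natural map `R⁰q_{1*} p_1^* ⟶ colim_r R⁰n_{r*} m_r^*` is characterized as the one given
by restriction of sections: on a section over `X_r = ⋃_z (𝓗_z ∪ 𝓗_{θ,r}) × {z}`, restricting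
to `⋃_z 𝓗_z × {z}` and applying the map is the same as restricting to `⋃_z 𝓗_{θ,r} × {z}` and
passing to the colimit. (Over `{|z| ≤ e^r}` the space `X_r` agrees with `⋃_z 𝓗_z × {z}`.) -/
def IsRestriction {k : Type} [Field k] (ι : directG k ⟶ directL k) : Prop :=
  ∀ r : ℝ,
    pullPushRes (Set.subset_union_left : incH ⊆ incH ∪ incC r) ≫ ι =
      pullPushRes (Set.subset_union_right : incC r ⊆ incH ∪ incC r) ≫
        toColim k incC antitone_incC r

/-- The functor to pairs given by a natural transformation `G ⟶ L`. -/
def pairFunctor {k : Type} [Field k] {L G : Sh k ℂ ⥤ Sh k Cstar} (ι : G ⟶ L) :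
    Sh k ℂ ⥤ SheafPair k where
  obj F := { L := L.obj F, G := G.obj F, incl := ι.app F }
  map f := ⟨L.map f, G.map f, ι.naturality f⟩
  map_id F := SheafPair.Hom.ext (L.map_id F)
  map_comp f g := SheafPair.Hom.ext (L.map_comp f g)

end TopLaplace

end

open TopLaplace

open CategoryTheory TopologicalSpace Opposite

noncomputable section

namespace TopLaplace

open Filter Topology

/-! ### Germs, gluing and morphisms -/

section Germs

variable {k : Type} [Field k] {Y : Type} [TopologicalSpace Y]

/-! Everything is reduced to linear algebra on one vector space V, the sections of F on a cut plane.
Fix a direction φ for which the lines through the singularities parallel to φ are distinct, and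
remove from ℂ the rays c - tφ, t ≥ 0, for c in S. The remaining set K is contractible and contains
no singularity. The étale space of F over K is a covering, so V = F(K) maps isomorphically to every
stalk of F on K (`gat_cutCompl_bijective`). This rests on the identity principle
(`identityPrinciple`): a section supported at a point would extend by zero to a nonzero global
section, against H⁰ = 0.

For θ with Re(φ e^{-iθ}) > 0, every half-plane in the direction θ beyond all singularities lies in
K. Hence the colimit over far half-planes is the constant sheaf V on this chart, over S¹ and over ℂ*
alike (`farSec_bijective`); the map d from the base to directions allows one treatment of both
cases. A section over a half-plane is determined by its restriction to far half-planes, because the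
half-plane minus the cuts is connected. An element v of V arises near the base point from such a
section if and only if v extends across the cut at c for each c in S with Re(c e^{-iθ}) at least the
threshold (`IsThreshold.mem_stalkRange_iff`). With E_c ⊂ V the sections that extend across the cut
at c, the stalk of the subsheaf is thus the intersection of the E_c over these c.

The vanishing of cohomology splits this family of subspaces. H⁰ = 0 says that the intersection of
all E_c is 0 (`eq_zero_of_mem_extendable`); H¹ = 0, by Mayer–Vietoris for K and the disjoint strips
around the cuts, says that V → ⨁ V/E_c is onto (`exists_sub_mem_extendable`). So V ≅ ⨁ V/E_c, and
the subsheaf consists of the sum of those V/E_c with Re(c e^{-iθ}) below the threshold, which is the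
co-Stokes condition. The quotients V/E_c for different φ are the charts of one local system on S¹:
germs of F on a small circle around c modulo sections of F on a disc around c (`grSheaf`). What
links the two descriptions is that a section on K which continues over a disc around c continues
over the whole cut (`mem_extendable_of_ball`).

For the comparison, base change along π gives a map from π^* of the colimit on S¹ to the colimit on
ℂ*. In the charts it is the identity of V (`comparison_farSec`), hence an isomorphism. If z lies on
S_ξ, then log |z| = Re(ξ e^{-iθ}), so the thresholds of L_{<ξ} at θ and of the direct subsheaf at z
coincide, and so do the criteria for membership (`mem_stalkRange_piPull_iff_comparison`). Finally,
the map ι exists and is unique because over |z| < e^r the space X_r has the same fibres as the union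
of the half-planes H_z; restriction from X_r is therefore bijective on stalks and can be inverted
(`resH_bijective`). -/

open Classical in
/-- The germ at `y` of a section over `U`, extended by zero to all `y`. -/
def gat (A : Sh k Y) (U : Opens Y) (y : Y) : sec A U →ₗ[k] stk A y :=
  if h : y ∈ U then germ A U y h else 0

theorem gat_of_mem {A : Sh k Y} {U : Opens Y} {y : Y} (h : y ∈ U) : gat A U y = germ A U y h :=
  dif_pos h

/-- Restriction of sections. -/
def resL (A : Sh k Y) {V U : Opens Y} (h : V ≤ U) : sec A U →ₗ[k] sec A V :=
  (A.presheaf.map (Quiver.Hom.op (V := Opens (TopCat.of Y)) (homOfLE h))).hom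

@[simp]
theorem gat_resL {A : Sh k Y} {V U : Opens Y} (h : V ≤ U) {y : Y} (hy : y ∈ V) (s : sec A U) :
    gat A V y (resL A h s) = gat A U y s := by
  rw [gat_of_mem hy, gat_of_mem (h hy)]
  exact germ_map (homOfLE h) y hy s

theorem sec_ext {A : Sh k Y} {U : Opens Y} {s t : sec A U}
    (h : ∀ y ∈ U, gat A U y s = gat A U y t) : s = t := by
  refine TopCat.Presheaf.section_ext A U s t fun y hy => ?_
  have := h y hy
  rw [gat_of_mem hy] at this
  exact this

theorem exists_gat_eq (A : Sh k Y) {y : Y} (x : stk A y) :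
    ∃ U : Opens Y, y ∈ U ∧ ∃ s : sec A U, gat A U y s = x := by
  obtain ⟨U, hU, s, hs⟩ := TopCat.Presheaf.exists_germ_eq A.presheaf x
  exact ⟨U, hU, s, by rw [gat_of_mem hU]; exact hs⟩

theorem eventually_mem_opens {U : Opens Y} {y : Y} (h : y ∈ U) : ∀ᶠ y' in 𝓝 y, y' ∈ U :=
  U.isOpen.mem_nhds h

theorem eventually_gat_eq {A : Sh k Y} {U V : Opens Y} {y : Y} (hU : y ∈ U) (hV : y ∈ V)
    {s : sec A U} {t : sec A V} (h : gat A U y s = gat A V y t) :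
    ∀ᶠ y' in 𝓝 y, gat A U y' s = gat A V y' t := by
  rw [gat_of_mem hU, gat_of_mem hV] at h
  obtain ⟨W, hW, iU, iV, e⟩ := TopCat.Presheaf.germ_eq A.presheaf y hU hV s t h
  filter_upwards [eventually_mem_opens hW] with y' hy'
  rw [gat_of_mem (iU.le hy'), gat_of_mem (iV.le hy')]
  have e1 := germ_map (A := A) iU y' hy' s
  have e2 := germ_map (A := A) iV y' hy' t
  rw [← e1, ← e2]
  exact congrArg _ e

theorem eventually_gat_eq_zero {A : Sh k Y} {U : Opens Y} {y : Y} (hU : y ∈ U)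
    {s : sec A U} (h : gat A U y s = 0) : ∀ᶠ y' in 𝓝 y, gat A U y' s = 0 := by
  have := eventually_gat_eq (s := s) (t := 0) hU hU (by simpa using h)
  simpa using this

/-- A family of germs that is locally given by sections is given by a section. -/
theorem exists_sec_of_germs (A : Sh k Y) (U : Opens Y) (g : ∀ y, stk A y)
    (h : ∀ y ∈ U, ∃ V : Opens Y, y ∈ V ∧ ∃ t : sec A V, ∀ᶠ y' in 𝓝 y, gat A V y' t = g y') :
    ∃ s : sec A U, ∀ y ∈ U, gat A U y s = g y := by
  have h' : ∀ y : U, ∃ V : Opens Y, y.1 ∈ V ∧ V ≤ U ∧ ∃ t : sec A V, ∀ y' ∈ V,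
      gat A V y' t = g y' := by
    rintro ⟨y, hy⟩
    obtain ⟨V, hV, t, ht⟩ := h y hy
    obtain ⟨W, hW, hWo, hyW⟩ := eventually_nhds_iff.1 ht
    refine ⟨V ⊓ U ⊓ ⟨W, hWo⟩, ⟨⟨hV, hy⟩, hyW⟩, fun z hz => hz.1.2,
      resL A (inf_le_left.trans inf_le_left) t, fun y' hy' => ?_⟩
    rw [gat_resL _ hy']
    exact hW y' hy'.2
  choose V hV hVU t ht using h'
  have hcov : U ≤ iSup V := fun y hy => Opens.mem_iSup.2 ⟨⟨y, hy⟩, hV ⟨y, hy⟩⟩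
  obtain ⟨s, hs, -⟩ := TopCat.Sheaf.existsUnique_gluing' A V U (fun i => homOfLE (hVU i)) hcov t
    (fun i j => by
      refine sec_ext (A := A) fun y hy => ?_
      have e1 := gat_resL (A := A) (inf_le_left : V i ⊓ V j ≤ V i) hy (t i)
      have e2 := gat_resL (A := A) (inf_le_right : V i ⊓ V j ≤ V j) hy (t j)
      refine e1.trans (Eq.trans ?_ e2.symm)
      rw [ht i y hy.1, ht j y hy.2])
  refine ⟨s, fun y hy => ?_⟩
  have e := gat_resL (A := A) (hVU ⟨y, hy⟩) (hV ⟨y, hy⟩) s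
  have e2 : resL A (hVU ⟨y, hy⟩) s = t ⟨y, hy⟩ := hs ⟨y, hy⟩
  rw [← e, e2]
  exact ht _ _ (hV _)

/-- The map on sections over `U`. -/
def secMap {A B : Sh k Y} (f : A ⟶ B) (U : Opens Y) : sec A U →ₗ[k] sec B U :=
  (f.hom.app (op U)).hom

theorem stalkMap_gat {A B : Sh k Y} (f : A ⟶ B) (U : Opens Y) (y : Y) (s : sec A U) :
    stalkMap f y (gat A U y s) = gat B U y (secMap f U s) := by
  by_cases hy : y ∈ U
  · rw [gat_of_mem hy, gat_of_mem hy, stalkMap_germ]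
    rfl
  · simp [gat, hy]

theorem hom_ext_stalk {A B : Sh k Y} {f g : A ⟶ B}
    (h : ∀ y x, stalkMap f y x = stalkMap g y x) : f = g := by
  apply Sheaf.hom_ext
  refine NatTrans.ext (funext fun U => ModuleCat.hom_ext (LinearMap.ext fun s => ?_))
  refine sec_ext (A := B) (U := U.unop) fun y _ => ?_
  exact (stalkMap_gat f U.unop y s).symm.trans ((h _ _).trans (stalkMap_gat g U.unop y s))

theorem stalkMap_id {A : Sh k Y} (y : Y) (x : stk A y) : stalkMap (𝟙 A) y x = x :=
  congrArg (fun φ => φ.hom x)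
    ((TopCat.Presheaf.stalkFunctor (X := TopCat.of Y) (ModuleCat.{0} k) y).map_id A.presheaf)

/-- Linear maps on stalks that carry sections to sections come from a morphism. -/
theorem exists_hom_of_stalkMaps {A B : Sh k Y} (φ : ∀ y, stk A y →ₗ[k] stk B y)
    (h : ∀ (U : Opens Y) (s : sec A U), ∀ y ∈ U, ∃ V : Opens Y, y ∈ V ∧ ∃ t : sec B V,
      ∀ᶠ y' in 𝓝 y, gat B V y' t = φ y' (gat A U y' s)) :
    ∃ f : A ⟶ B, ∀ y, stalkMap f y = φ y := by
  have h' : ∀ (U : Opens Y) (s : sec A U), ∃ t : sec B U, ∀ y ∈ U,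
      gat B U y t = φ y (gat A U y s) := fun U s =>
    exists_sec_of_germs B U (fun y => φ y (gat A U y s)) (h U s)
  choose T hT using h'
  refine ⟨⟨{ app := fun U => ModuleCat.ofHom
               { toFun := T U.unop
                 map_add' := fun s t => sec_ext fun y hy => ?_
                 map_smul' := fun a s => sec_ext fun y hy => ?_ }
             naturality := fun U V i => ?_ }⟩, fun y => ?_⟩
  · rw [hT _ _ y hy, map_add, map_add, map_add, hT _ _ y hy, hT _ _ y hy]
  · rw [hT _ _ y hy, map_smul, map_smul, RingHom.id_apply, map_smul, hT _ _ y hy]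
  · refine ModuleCat.hom_ext (LinearMap.ext fun s => ?_)
    refine sec_ext (A := B) (U := V.unop) fun y hy => ?_
    refine (hT V.unop _ y hy).trans ?_
    refine Eq.trans ?_ (gat_resL (A := B) i.unop.le hy (T U.unop s)).symm
    rw [hT U.unop s y (i.unop.le hy)]
    exact congrArg _ (gat_resL (A := A) i.unop.le hy s)
  · refine LinearMap.ext fun x => ?_
    obtain ⟨U, hU, s, rfl⟩ := exists_gat_eq A x
    exact (stalkMap_gat _ U y s).trans (hT U s y hU)

theorem mono_of_stalkMap_injective {A B : Sh k Y} (f : A ⟶ B)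
    (h : ∀ y, Function.Injective (stalkMap f y)) : Mono f :=
  ⟨fun g g' e => hom_ext_stalk fun y x => h y (by
    rw [← stalkMap_comp, ← stalkMap_comp, e])⟩

theorem stalkMap_injective_of_mono {A B : Sh k Y} (f : A ⟶ B) [Mono f] (y : Y) :
    Function.Injective (stalkMap f y) := by
  have := TopCat.Presheaf.stalk_mono_of_mono f y
  exact (ModuleCat.mono_iff_injective _).1 this

/-- The stalkwise inverses carry sections to sections: a representative of the preimage of one germ
maps to the given section on a whole neighbourhood, and there injectivity identifies its germs with
the preimages. -/
theorem isIso_of_stalkMap_bijective {A B : Sh k Y} (f : A ⟶ B)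
    (h : ∀ y, Function.Bijective (stalkMap f y)) : IsIso f := by
  have h1 : ∀ y, ∃ e : stk B y →ₗ[k] stk A y, (∀ x, stalkMap f y (e x) = x) ∧
      ∀ x, e (stalkMap f y x) = x := fun y =>
    ⟨(LinearEquiv.ofBijective _ (h y)).symm.toLinearMap,
      (LinearEquiv.ofBijective _ (h y)).apply_symm_apply,
      (LinearEquiv.ofBijective _ (h y)).symm_apply_apply⟩
  choose e he he' using h1
  obtain ⟨g, hg⟩ := exists_hom_of_stalkMaps e (fun U s y hy => by
    obtain ⟨V, hV, t, ht⟩ := exists_gat_eq A (e y (gat B U y s))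
    refine ⟨V, hV, t, ?_⟩
    have h2 : gat B V y (secMap f V t) = gat B U y s := by
      rw [← stalkMap_gat, ht, he]
    filter_upwards [eventually_gat_eq hV hy h2] with y' hy'
    rw [← hy', ← stalkMap_gat, he'])
  refine ⟨g, hom_ext_stalk fun y x => ?_, hom_ext_stalk fun y x => ?_⟩
  · rw [stalkMap_comp, stalkMap_id, hg, he']
  · rw [stalkMap_comp, stalkMap_id, hg, he]

/-- A morphism whose image is stalkwise contained in a subsheaf factors through it. -/
theorem exists_lift_of_stalkRange_le {A B C : Sh k Y} (i : B ⟶ C) [Mono i] (f : A ⟶ C)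
    (h : ∀ y, stalkRange f y ≤ stalkRange i y) : ∃ g : A ⟶ B, g ≫ i = f := by
  have hi := stalkMap_injective_of_mono i
  have h1 : ∀ y, ∃ e : stk A y →ₗ[k] stk B y, ∀ x, stalkMap i y (e x) = stalkMap f y x := by
    intro y
    refine ⟨(LinearEquiv.ofInjective _ (hi y)).symm.toLinearMap ∘ₗ
      (stalkMap f y).codRestrict (LinearMap.range (stalkMap i y)) (fun x => h y ⟨x, rfl⟩),
      fun x => ?_⟩
    exact congrArg Subtype.val ((LinearEquiv.ofInjective _ (hi y)).apply_symm_apply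
      ⟨stalkMap f y x, h y ⟨x, rfl⟩⟩)
  choose e he using h1
  obtain ⟨g, hg⟩ := exists_hom_of_stalkMaps e (fun U s y hy => by
    obtain ⟨V, hV, t, ht⟩ := exists_gat_eq B (e y (gat A U y s))
    refine ⟨V, hV, t, ?_⟩
    have h2 : gat C V y (secMap i V t) = gat C U y (secMap f U s) := by
      rw [← stalkMap_gat, ht, he, stalkMap_gat]
    filter_upwards [eventually_gat_eq hV hy h2] with y' hy'
    apply hi
    rw [he, stalkMap_gat, hy', stalkMap_gat])
  exact ⟨g, hom_ext_stalk fun y x => by rw [stalkMap_comp, hg, he]⟩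

/-- The condition is on a whole neighbourhood, so the stalk of the subsheaf may be smaller than `P
y`. This is why the prescribed stalks need a proof. -/
theorem mem_stalkRange_subSheafIncl {A : Sh k Y} {P : ∀ y, Submodule k (stk A y)} {y : Y}
    {x : stk A y} : x ∈ stalkRange (subSheafIncl A P) y ↔
      ∃ U : Opens Y, y ∈ U ∧ ∃ s : sec A U, gat A U y s = x ∧ ∀ y' ∈ U, gat A U y' s ∈ P y' := by
  constructor
  · rintro ⟨z, rfl⟩
    obtain ⟨U, hU, s, rfl⟩ := exists_gat_eq (subSheaf A P) z
    refine ⟨U, hU, s.1, (stalkMap_gat (subSheafIncl A P) U y s).symm, fun y' hy' => ?_⟩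
    rw [gat_of_mem hy']
    exact mem_secIn.1 s.2 y' hy'
  · rintro ⟨U, hU, s, rfl, hs⟩
    have hs' : s ∈ secIn A P U := mem_secIn.2 fun y' hy' => by
      rw [← gat_of_mem hy']; exact hs y' hy'
    exact ⟨gat (subSheaf A P) U y ⟨s, hs'⟩, stalkMap_gat (subSheafIncl A P) U y ⟨s, hs'⟩⟩

theorem mono_subSheafIncl (A : Sh k Y) (P : ∀ y, Submodule k (stk A y)) :
    Mono (subSheafIncl A P) := by
  refine ⟨fun g g' e => ?_⟩
  apply Sheaf.hom_ext
  refine NatTrans.ext (funext fun U => ModuleCat.hom_ext (LinearMap.ext fun s => Subtype.ext ?_))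
  exact congrArg (fun φ => (φ.hom.app U).hom s) e

end Germs

/-! ### Quotients of inverse images, as sheaves of functions -/

section Quot

variable {k : Type} [Field k] {T X : Type} [TopologicalSpace T] [TopologicalSpace X]

/-- A linear map out of a stalk is given by linear maps on sections compatible with
restriction. -/
theorem exists_stalk_desc {A : Sh k T} {y : T} {M : Type} [AddCommGroup M] [Module k M]
    (ψ : ∀ U : Opens T, y ∈ U → sec A U →ₗ[k] M)
    (h : ∀ (U V : Opens T) (hV : y ∈ V) (i : V ≤ U) (s : sec A U),
      ψ V hV (resL A i s) = ψ U (i hV) s) :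
    ∃ φ : stk A y →ₗ[k] M, ∀ (U : Opens T) (hU : y ∈ U) (s : sec A U),
      φ (gat A U y s) = ψ U hU s := by
  have key : ∀ (U V : Opens T) (hU : y ∈ U) (hV : y ∈ V) (s : sec A U) (t : sec A V),
      gat A U y s = gat A V y t → ψ U hU s = ψ V hV t := by
    intro U V hU hV s t e
    rw [gat_of_mem hU, gat_of_mem hV] at e
    obtain ⟨W, hW, iU, iV, e⟩ := TopCat.Presheaf.germ_eq A.presheaf y hU hV s t e
    rw [← h U W hW iU.le s, ← h V W hW iV.le t]
    exact congrArg _ e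
  choose U hU s hs using fun x : stk A y => exists_gat_eq A x
  have hval : ∀ (x : stk A y) (V : Opens T) (hV : y ∈ V) (t : sec A V), gat A V y t = x →
      ψ (U x) (hU x) (s x) = ψ V hV t := fun x V hV t e =>
    key _ _ _ _ _ _ ((hs x).trans e.symm)
  refine ⟨⟨⟨fun x => ψ (U x) (hU x) (s x), fun x x' => ?_⟩, fun a x => ?_⟩, fun V hV t => ?_⟩
  · have h1 : y ∈ U x ⊓ U x' := ⟨hU x, hU x'⟩
    rw [hval (x + x') _ h1 (resL A inf_le_left (s x) + resL A inf_le_right (s x')) (by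
      rw [map_add, gat_resL _ h1, gat_resL _ h1, hs, hs]), map_add, h _ _ h1, h _ _ h1]
  · exact (hval (a • x) _ (hU x) (a • s x) (by rw [map_smul, hs])).trans (map_smul _ _ _)
  · exact hval _ V hV t rfl

variable (f : TopCat.of T ⟶ TopCat.of X) (F : Sh k X)
  (D : ∀ w : T, Submodule k (stk F (f.hom w)))

theorem eventually_map_mem {N : Opens X} {w : T} (h : f.hom w ∈ N) :
    ∀ᶠ w' in 𝓝 w, f.hom w' ∈ N :=
  (N.isOpen.preimage f.hom.continuous).mem_nhds h

/-- The class modulo `D w` of the germ at `f w` of a section. -/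
def qgat (N : Opens X) (w : T) : sec F N →ₗ[k] stk F (f.hom w) ⧸ D w :=
  (D w).mkQ ∘ₗ gat F N (f.hom w)

/-- Functions `w ↦ F_{f w} ⧸ D w` on `V` that are locally induced by sections of `F`. -/
def quotSec (V : Opens T) : Submodule k (∀ w : V, stk F (f.hom w) ⧸ D w) where
  carrier := {s | ∀ w : V, ∃ N : Opens X, f.hom w ∈ N ∧ ∃ t : sec F N,
    ∀ᶠ w' in 𝓝 w, s w' = qgat f F D N w' t}
  zero_mem' := fun w => ⟨⊤, trivial, 0, by simp⟩
  add_mem' := by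
    intro s s' hs hs' w
    obtain ⟨N, hN, t, ht⟩ := hs w
    obtain ⟨N', hN', t', ht'⟩ := hs' w
    have h1 : f.hom w ∈ N ⊓ N' := ⟨hN, hN'⟩
    refine ⟨N ⊓ N', h1, resL F inf_le_left t + resL F inf_le_right t', ?_⟩
    filter_upwards [ht, ht',
      continuous_subtype_val.continuousAt.eventually (eventually_map_mem f h1)] with w' e e' hw'
    simp only [Pi.add_apply, e, e', map_add, qgat, LinearMap.comp_apply, gat_resL _ hw']
  smul_mem' := by
    intro a s hs w
    obtain ⟨N, hN, t, ht⟩ := hs w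
    refine ⟨N, hN, a • t, ?_⟩
    filter_upwards [ht] with w' e
    simp only [Pi.smul_apply, e, map_smul]

theorem eventually_subtype_iff {V : Opens T} (w : V) (P : T → Prop) :
    (∀ᶠ w' : V in 𝓝 w, P w') ↔ ∀ᶠ w' in 𝓝 (w : T), P w' := by
  rw [← V.isOpen.isOpenEmbedding_subtypeVal.map_nhds_eq w]
  rfl

/-- The presheaf of functions `w ↦ F_{f w} ⧸ D w` locally induced by sections of `F`. -/
def quotPresheaf : TopCat.Presheaf (ModuleCat.{0} k) (TopCat.of T) where
  obj V := ModuleCat.of k (quotSec f F D V.unop)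
  map {V W} i := ModuleCat.ofHom
    { toFun := fun s => ⟨fun w => s.1 ⟨w, i.unop.le w.2⟩, fun w => by
        obtain ⟨N, hN, t, ht⟩ := s.2 ⟨w, i.unop.le w.2⟩
        exact ⟨N, hN, t, (continuous_inclusion i.unop.le).continuousAt.eventually ht⟩⟩
      map_add' := fun _ _ => rfl
      map_smul' := fun _ _ => rfl }
  map_id _ := rfl
  map_comp _ _ := rfl

theorem quotPresheaf_isSheaf : (quotPresheaf f F D).IsSheaf := by
  rw [TopCat.Presheaf.isSheaf_iff_isSheaf_comp (forget (ModuleCat.{0} k))]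
  refine TopCat.Presheaf.isSheaf_of_isSheafUniqueGluing_types _ fun {ι} U sf hsf => ?_
  have hmem : ∀ w : (iSup U : Opens T), ∃ i, w.1 ∈ U i := fun w => Opens.mem_iSup.1 w.2
  choose j hj using hmem
  have hcompat : ∀ i i' (w : T) (h : w ∈ U i) (h' : w ∈ U i'),
      (sf i).1 ⟨w, h⟩ = (sf i').1 ⟨w, h'⟩ := fun i i' w h h' =>
    congrFun (congrArg Subtype.val (hsf i i')) ⟨w, ⟨h, h'⟩⟩
  refine ⟨⟨fun w => (sf (j w)).1 ⟨w, hj w⟩, fun w => ?_⟩, fun i => ?_, fun t ht => ?_⟩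
  · obtain ⟨N, hN, t, ht⟩ := (sf (j w)).2 ⟨w, hj w⟩
    refine ⟨N, hN, t, ?_⟩
    have h1 : ∀ᶠ w' in 𝓝 w.1, ∀ hw' : w' ∈ U (j w), (sf (j w)).1 ⟨w', hw'⟩ = qgat f F D N w' t := by
      rw [← (U (j w)).isOpen.isOpenEmbedding_subtypeVal.map_nhds_eq ⟨w.1, hj w⟩]
      exact Filter.eventually_map.2 (ht.mono fun a ha _ => ha)
    filter_upwards [continuous_subtype_val.continuousAt.eventually h1,
      continuous_subtype_val.continuousAt.eventually (eventually_mem_opens (hj w))] with w' e e'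
    rw [hcompat _ (j w) w' (hj w') e']
    exact e e'
  · exact Subtype.ext (funext fun w => hcompat _ _ _ _ _)
  · refine Subtype.ext (funext fun w => ?_)
    exact congrFun (congrArg Subtype.val (ht (j w))) ⟨w, hj w⟩

/-- The sheaf of functions `w ↦ F_{f w} ⧸ D w` locally induced by sections of `F`. -/
def quotSheaf : Sh k T := ⟨quotPresheaf f F D, quotPresheaf_isSheaf f F D⟩

/-- The section of `quotSheaf` induced by a section of `F`. -/
def toQuot {N : Opens X} {V : Opens T} (h : ∀ w ∈ V, f.hom w ∈ N) :
    sec F N →ₗ[k] sec (quotSheaf f F D) V :=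
  LinearMap.codRestrict (quotSec f F D V) (LinearMap.pi fun w => qgat f F D N w)
    (fun t w => ⟨N, h w w.2, t, Eventually.of_forall fun _ => rfl⟩)

/-- A section of `quotSheaf`, as a function. -/
def quotVal {U : Opens T} : sec (quotSheaf f F D) U →ₗ[k] ∀ w : U, stk F (f.hom w) ⧸ D w :=
  (quotSec f F D U).subtype

theorem exists_quotStalk (w : T) : ∃ φ : stk (quotSheaf f F D) w →ₗ[k] stk F (f.hom w) ⧸ D w,
    ∀ (U : Opens T) (hU : w ∈ U) (s : sec (quotSheaf f F D) U),
      φ (gat _ U w s) = quotVal f F D s ⟨w, hU⟩ := by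
  have := exists_stalk_desc (A := quotSheaf f F D) (y := w) (M := stk F (f.hom w) ⧸ D w)
    (fun U hU => { toFun := fun s => quotVal f F D s ⟨w, hU⟩
                   map_add' := fun _ _ => rfl
                   map_smul' := fun _ _ => rfl })
    (fun _ _ _ _ _ => rfl)
  exact this

/-- The value at `w` of a germ of `quotSheaf`. -/
def quotStalk (w : T) : stk (quotSheaf f F D) w →ₗ[k] stk F (f.hom w) ⧸ D w :=
  (exists_quotStalk f F D w).choose

theorem quotStalk_gat {w : T} {U : Opens T} (hU : w ∈ U) (s : sec (quotSheaf f F D) U) :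
    quotStalk f F D w (gat _ U w s) = quotVal f F D s ⟨w, hU⟩ :=
  (exists_quotStalk f F D w).choose_spec U hU s

theorem quotStalk_toQuot {N : Opens X} {V : Opens T} (h : ∀ w ∈ V, f.hom w ∈ N) {w : T}
    (hw : w ∈ V) (t : sec F N) :
    quotStalk f F D w (gat _ V w (toQuot f F D h t)) = qgat f F D N w t := by
  rw [quotStalk_gat f F D hw]
  rfl

/-- Every section of `quotSheaf` is locally induced by a section of `F`. -/
theorem eventually_quotStalk {V : Opens T} (s : sec (quotSheaf f F D) V) {w : T} (hw : w ∈ V) :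
    ∃ N : Opens X, f.hom w ∈ N ∧ ∃ t : sec F N,
      ∀ᶠ w' in 𝓝 w, quotStalk f F D w' (gat _ V w' s) = qgat f F D N w' t := by
  obtain ⟨N, hN, t, ht⟩ := (show quotSec f F D V from s).2 ⟨w, hw⟩
  refine ⟨N, hN, t, (eventually_subtype_iff (V := V) ⟨w, hw⟩ _).1 ?_⟩
  filter_upwards [ht] with w' e
  rw [quotStalk_gat f F D w'.2]
  exact e

/-- The hypothesis says that the D w form an open subset of the étale space of the inverse image: a
section with value in D at one point stays in D nearby. A germ with value zero is then zero. -/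
theorem quotStalk_injective (hD : ∀ (w : T) (N : Opens X) (t : sec F N), f.hom w ∈ N →
    gat F N (f.hom w) t ∈ D w → ∀ᶠ w' in 𝓝 w, gat F N (f.hom w') t ∈ D w') (w : T) :
    Function.Injective (quotStalk f F D w) := by
  rw [injective_iff_map_eq_zero]
  intro x hx
  obtain ⟨V, hV, s, rfl⟩ := exists_gat_eq _ x
  obtain ⟨N, hN, t, ht⟩ := eventually_quotStalk f F D s hV
  have h1 : gat F N (f.hom w) t ∈ D w := by
    have := ht.self_of_nhds
    rw [hx] at this
    exact (Submodule.Quotient.mk_eq_zero _).1 this.symm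
  have h2 : ∀ᶠ w' in 𝓝 w, quotStalk f F D w' (gat _ V w' s) = 0 := by
    filter_upwards [ht, hD w N t hN h1] with w' e e'
    rw [e]
    exact (Submodule.Quotient.mk_eq_zero _).2 e'
  obtain ⟨W, hW, hWo, hwW⟩ := eventually_nhds_iff.1 h2
  have hw' : w ∈ V ⊓ (⟨W, hWo⟩ : Opens T) := ⟨hV, hwW⟩
  rw [← gat_resL inf_le_left hw' s]
  have : resL (quotSheaf f F D) (inf_le_left : V ⊓ (⟨W, hWo⟩ : Opens T) ≤ V) s = 0 := by
    refine Subtype.ext (funext fun a => ?_)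
    have h3 := hW a.1 a.2.2
    rw [quotStalk_gat f F D a.2.1] at h3
    exact h3
  rw [this, map_zero]

end Quot

/-! ### Stalks and sections of inverse images -/

section Pullback

variable {k : Type} [Field k] {T X : Type} [TopologicalSpace T] [TopologicalSpace X]
  (f : TopCat.of T ⟶ TopCat.of X) (F : Sh k X)

/-- The inverse image sheaf. -/
abbrev pb : Sh k T := (TopCat.Sheaf.pullback (ModuleCat.{0} k) f).obj F

/-- The direct image sheaf. -/
abbrev pf (A : Sh k T) : Sh k X := (TopCat.Sheaf.pushforward (ModuleCat.{0} k) f).obj A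

/-- The preimage of an open set. -/
abbrev pre (N : Opens X) : Opens T := (Opens.map f).obj N

/-- The adjunction unit `F ⟶ f_* f^* F`. -/
abbrev pbUnit : F ⟶ pf f (pb f F) :=
  (TopCat.Sheaf.pullbackPushforwardAdjunction (ModuleCat.{0} k) f).unit.app F

theorem pb_hom_ext {B : Sh k T} {g h : pb f F ⟶ B}
    (e : pbUnit f F ≫ (TopCat.Sheaf.pushforward _ f).map g =
      pbUnit f F ≫ (TopCat.Sheaf.pushforward _ f).map h) : g = h := by
  apply ((TopCat.Sheaf.pullbackPushforwardAdjunction (ModuleCat.{0} k) f).homEquiv F _).injective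
  rw [Adjunction.homEquiv_unit, Adjunction.homEquiv_unit]
  exact e

theorem exists_pb_desc {B : Sh k T} (g : F ⟶ pf f B) :
    ∃ h : pb f F ⟶ B, pbUnit f F ≫ (TopCat.Sheaf.pushforward _ f).map h = g := by
  refine ⟨((TopCat.Sheaf.pullbackPushforwardAdjunction (ModuleCat.{0} k) f).homEquiv F _).symm g,
    ?_⟩
  have := ((TopCat.Sheaf.pullbackPushforwardAdjunction (ModuleCat.{0} k) f).homEquiv F
    _).apply_symm_apply g
  rwa [Adjunction.homEquiv_unit] at this

/-- The inverse image of a section. -/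
def pbSec (N : Opens X) : sec F N →ₗ[k] sec (pb f F) (pre f N) :=
  secMap (pbUnit f F) N

/-- The map `(f_* A)_{f w} → A_w`. -/
def pfStalk (A : Sh k T) (w : T) : stk (pf f A) (f.hom w) →ₗ[k] stk A w :=
  (TopCat.Presheaf.stalkPushforward (ModuleCat.{0} k) f A.presheaf w).hom

theorem pfStalk_gat (A : Sh k T) {N : Opens X} {w : T} (h : f.hom w ∈ N)
    (s : sec A (pre f N)) :
    pfStalk f A w (gat (pf f A) N (f.hom w) s) = gat A (pre f N) w s := by
  rw [gat_of_mem h, gat_of_mem (show w ∈ pre f N from h)]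
  have := TopCat.Presheaf.stalkPushforward_germ (ModuleCat.{0} k) f A.presheaf N w h
  exact congrArg (fun φ => φ.hom s) this

/-- The map `F_{f w} → (f^* F)_w`. -/
def pv (w : T) : stk F (f.hom w) →ₗ[k] stk (pb f F) w :=
  pfStalk f _ w ∘ₗ stalkMap (pbUnit f F) (f.hom w)

theorem pv_gat {N : Opens X} {w : T} (h : f.hom w ∈ N) (t : sec F N) :
    pv f F w (gat F N (f.hom w) t) = gat (pb f F) (pre f N) w (pbSec f F N t) := by
  rw [pv, LinearMap.comp_apply, stalkMap_gat]
  exact pfStalk_gat f _ h _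

/-- The unit of the adjunction factors through the subsheaf of f^* F whose germs come from stalks of
F. By the universal property the identity of f^* F then factors through this subsheaf as well, so it
is everything. -/
theorem pv_surjective (w : T) : Function.Surjective (pv f F w) := by
  let P : ∀ w, Submodule k (stk (pb f F) w) := fun w => LinearMap.range (pv f F w)
  have hmem : ∀ (N : Opens X) (t : sec F N), pbSec f F N t ∈ secIn (pb f F) P (pre f N) := by
    intro N t
    refine mem_secIn.2 fun y hy => ?_
    rw [← gat_of_mem hy, ← pv_gat f F hy]
    exact ⟨_, rfl⟩
  let g : F ⟶ pf f (subSheaf (pb f F) P) :=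
    ⟨{ app := fun N => ModuleCat.ofHom
         ((pbSec f F N.unop).codRestrict (secIn (pb f F) P (pre f N.unop)) (hmem N.unop))
       naturality := fun N N' i => by
        refine ModuleCat.hom_ext (LinearMap.ext fun s => Subtype.ext ?_)
        exact congrArg (fun φ => φ.hom s) ((pbUnit f F).hom.naturality i) }⟩
  obtain ⟨h, hh⟩ := exists_pb_desc f F g
  have key : h ≫ subSheafIncl (pb f F) P = 𝟙 _ := by
    apply pb_hom_ext
    rw [Functor.map_comp, ← Category.assoc, hh, CategoryTheory.Functor.map_id]
    rfl
  intro x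
  have h1 : x ∈ stalkRange (subSheafIncl (pb f F) P) w :=
    ⟨stalkMap h w x, by rw [← stalkMap_comp, key, stalkMap_id]⟩
  obtain ⟨U, hU, s, rfl, hs⟩ := mem_stalkRange_subSheafIncl.1 h1
  exact hs w hU

/-- The sheaf of functions w ↦ F_{f w} locally induced by sections, which is `quotSheaf` with D = 0,
receives a map from f^* F by adjunction. Evaluation at w then gives a left inverse on stalks. -/
theorem pv_injective (w : T) : Function.Injective (pv f F w) := by
  let g : F ⟶ pf f (quotSheaf f F fun _ => ⊥) :=
    ⟨{ app := fun N => ModuleCat.ofHom (toQuot f F (fun _ => ⊥) (V := pre f N.unop)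
         (fun _ h => h))
       naturality := fun N N' i => by
        refine ModuleCat.hom_ext (LinearMap.ext fun s => Subtype.ext (funext fun w => ?_))
        exact congrArg _ (gat_resL (A := F) i.unop.le w.2 s) }⟩
  obtain ⟨h, hh⟩ := exists_pb_desc f F g
  have key : ∀ x : stk F (f.hom w), quotStalk f F (fun _ => ⊥) w
      (stalkMap h w (pv f F w x)) = Submodule.Quotient.mk x := by
    intro x
    obtain ⟨N, hN, t, rfl⟩ := exists_gat_eq F x
    rw [pv_gat f F hN, stalkMap_gat]
    have e : secMap h (pre f N) (pbSec f F N t) =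
        toQuot f F (fun _ => ⊥) (V := pre f N) (fun _ h => h) t :=
      congrArg (fun φ => (φ.hom.app (op N)).hom t) hh
    rw [e, quotStalk_toQuot f F _ (fun _ h => h) (show w ∈ pre f N from hN)]
    rfl
  intro x y e
  have e2 := (key x).symm.trans ((congrArg (fun z => quotStalk f F (fun _ => ⊥) w
    (stalkMap h w z)) e).trans (key y))
  have e3 := (Submodule.Quotient.eq _).1 e2
  exact sub_eq_zero.1 ((Submodule.mem_bot k).1 e3)

/-- The isomorphism `F_{f w} ≃ (f^* F)_w`. -/
def pvEquiv (w : T) : stk F (f.hom w) ≃ₗ[k] stk (pb f F) w :=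
  LinearEquiv.ofBijective (pv f F w) ⟨pv_injective f F w, pv_surjective f F w⟩

/-- The value at `w` of a section of `f^* F`, an element of `F_{f w}`. -/
def pbVal (V : Opens T) (w : T) : sec (pb f F) V →ₗ[k] stk F (f.hom w) :=
  (pvEquiv f F w).symm.toLinearMap ∘ₗ gat (pb f F) V w

theorem pv_pbVal (V : Opens T) (w : T) (s : sec (pb f F) V) :
    pv f F w (pbVal f F V w s) = gat (pb f F) V w s :=
  (pvEquiv f F w).apply_symm_apply _

theorem pbVal_eq_iff {V : Opens T} {w : T} {s : sec (pb f F) V} {x : stk F (f.hom w)} :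
    pbVal f F V w s = x ↔ gat (pb f F) V w s = pv f F w x := by
  rw [← pv_pbVal, (pv_injective f F w).eq_iff]

theorem pbVal_pbSec {N : Opens X} {w : T} (h : f.hom w ∈ N) (t : sec F N) :
    pbVal f F (pre f N) w (pbSec f F N t) = gat F N (f.hom w) t :=
  (pbVal_eq_iff f F).2 (pv_gat f F h t).symm

theorem pbVal_resL {V W : Opens T} (h : W ≤ V) {w : T} (hw : w ∈ W) (s : sec (pb f F) V) :
    pbVal f F W w (resL _ h s) = pbVal f F V w s := by
  rw [pbVal_eq_iff, gat_resL _ hw, pv_pbVal]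

theorem eventually_pbVal {V : Opens T} (s : sec (pb f F) V) {w : T} (hw : w ∈ V) :
    ∃ N : Opens X, f.hom w ∈ N ∧ ∃ t : sec F N,
      ∀ᶠ w' in 𝓝 w, pbVal f F V w' s = gat F N (f.hom w') t := by
  obtain ⟨N, hN, t, ht⟩ := exists_gat_eq F (pbVal f F V w s)
  refine ⟨N, hN, t, ?_⟩
  have h1 : gat (pb f F) V w s = gat (pb f F) (pre f N) w (pbSec f F N t) := by
    rw [← pv_gat f F hN, ht, pv_pbVal]
  filter_upwards [eventually_gat_eq hw (show w ∈ pre f N from hN) h1,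
    eventually_map_mem f hN] with w' e hw'
  rw [pbVal_eq_iff, e, pv_gat f F hw']

theorem pb_sec_ext {V : Opens T} {s t : sec (pb f F) V}
    (h : ∀ w ∈ V, pbVal f F V w s = pbVal f F V w t) : s = t :=
  sec_ext fun w hw => by rw [← pv_pbVal, h w hw, pv_pbVal]

theorem exists_pb_sec (V : Opens T) (g : ∀ w, stk F (f.hom w))
    (hg : ∀ w ∈ V, ∃ N : Opens X, f.hom w ∈ N ∧ ∃ t : sec F N,
      ∀ᶠ w' in 𝓝 w, g w' = gat F N (f.hom w') t) :
    ∃ s : sec (pb f F) V, ∀ w ∈ V, pbVal f F V w s = g w := by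
  obtain ⟨s, hs⟩ := exists_sec_of_germs (pb f F) V (fun w => pv f F w (g w)) (fun w hw => by
    obtain ⟨N, hN, t, ht⟩ := hg w hw
    refine ⟨pre f N, hN, pbSec f F N t, ?_⟩
    filter_upwards [ht, eventually_map_mem f hN] with w' e hw'
    rw [e, pv_gat f F hw'])
  exact ⟨s, fun w hw => (pbVal_eq_iff f F).2 (hs w hw)⟩

theorem pbVal_map {F F' : Sh k X} (φ : F ⟶ F') (V : Opens T) (w : T) (s : sec (pb f F) V) :
    pbVal f F' V w (secMap ((TopCat.Sheaf.pullback _ f).map φ) V s) =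
      stalkMap φ (f.hom w) (pbVal f F V w s) := by
  rw [pbVal_eq_iff, ← stalkMap_gat, ← pv_pbVal]
  obtain ⟨N, hN, t, ht⟩ := exists_gat_eq F (pbVal f F V w s)
  rw [← ht, pv_gat f F hN, stalkMap_gat, stalkMap_gat, pv_gat f F' hN]
  have e := (TopCat.Sheaf.pullbackPushforwardAdjunction (ModuleCat.{0} k) f).unit.naturality φ
  have e' := congrArg (fun ψ => (ψ.hom.app (op N)).hom t) e
  exact congrArg _ e'.symm

theorem stalkMap_pv {F F' : Sh k X} (φ : F ⟶ F') (w : T) (x : stk F (f.hom w)) :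
    stalkMap ((TopCat.Sheaf.pullback _ f).map φ) w (pv f F w x) =
      pv f F' w (stalkMap φ (f.hom w) x) := by
  obtain ⟨N, hN, t, rfl⟩ := exists_gat_eq F x
  rw [pv_gat f F hN, stalkMap_gat, stalkMap_gat, pv_gat f F' hN]
  have e := (TopCat.Sheaf.pullbackPushforwardAdjunction (ModuleCat.{0} k) f).unit.naturality φ
  have e' := congrArg (fun ψ => (ψ.hom.app (op N)).hom t) e
  exact congrArg _ e'.symm

/-- A morphism `f^* F ⟶ g_* (f ∘ g)^* F` compatible with the units preserves values. -/
theorem pbVal_baseChange {T' : Type} [TopologicalSpace T'] (g : TopCat.of T' ⟶ TopCat.of T)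
    (b : pb f F ⟶ pf g (pb (g ≫ f) F))
    (hb : pbUnit f F ≫ (TopCat.Sheaf.pushforward _ f).map b = pbUnit (g ≫ f) F)
    (V : Opens T) {w : T'} (hw : g.hom w ∈ V) (s : sec (pb f F) V) :
    pbVal (g ≫ f) F (pre g V) w (secMap b V s) = pbVal f F V (g.hom w) s := by
  refine (pbVal_eq_iff (g ≫ f) F).2 ?_
  obtain ⟨N, hN, t, ht⟩ := exists_gat_eq F (pbVal f F V (g.hom w) s)
  rw [← ht]
  have e1 : gat (pb (g ≫ f) F) (pre g V) w (secMap b V s) =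
      pfStalk g _ w (stalkMap b (g.hom w) (gat (pb f F) V (g.hom w) s)) := by
    rw [stalkMap_gat]
    exact (pfStalk_gat g _ hw _).symm
  have e2 : stalkMap b (g.hom w) (gat (pb f F) V (g.hom w) s) =
      gat _ (pre f N) (g.hom w) (secMap b (pre f N) (pbSec f F N t)) := by
    rw [← pv_pbVal, ← ht, pv_gat f F hN, stalkMap_gat]
  rw [e1, e2]
  refine (pfStalk_gat g _ (N := pre f N) (w := w) hN _).trans ?_
  refine Eq.trans ?_ (pv_gat (g ≫ f) F (N := N) (w := w) hN t).symm
  exact congrArg (gat (pb (g ≫ f) F) (pre (g ≫ f) N) w)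
    (congrArg (fun ψ => secMap ψ N t) hb)

end Pullback

/-! ### Sections of `R⁰q_* p^* F` as families of germs of `F` -/

/-- A family of germs `s w ∈ F_{f w}` is, on the subset `A`, locally given by sections of `F`. -/
def LocSec {k : Type} [Field k] {T X : Type} [TopologicalSpace T] [TopologicalSpace X]
    (F : Sh k X) (f : T → X) (A : Set T) (s : ∀ w, stk F (f w)) : Prop :=
  ∀ w ∈ A, ∃ N : Opens X, f w ∈ N ∧ ∃ t : sec F N, ∀ᶠ w' in 𝓝[A] w, s w' = gat F N (f w') t

section PullPush

variable {k : Type} [Field k] {X Y : Type} [TopologicalSpace X] [TopologicalSpace Y]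

/-- The part of `Z` over `V`. -/
def part (Z : Set (X × Y)) (V : Opens Y) : Set (X × Y) := {w | w ∈ Z ∧ w.2 ∈ V}

variable (Z : Set (X × Y)) (F : Sh k X)

/-- The sections of `R⁰q_* p^* F` over `V` are those of `p^* F` over the part of `Z` over `V`. -/
abbrev pp : Sh k Y := (pullPush k Z).obj F

/-- A section of `R⁰q_* p^* F`, as a section of `p^* F`. -/
def unpp (V : Opens Y) : sec (pp Z F) V →ₗ[k] sec (pb (projFst Z) F) (pre (projSnd Z) V) :=
  LinearMap.id

open Classical in
/-- The value at `w` of a section of `R⁰q_* p^* F`, an element of the stalk of `F` at `w.1`. -/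
def ppVal (V : Opens Y) (w : X × Y) : sec (pp Z F) V →ₗ[k] stk F w.1 :=
  if h : w ∈ Z then pbVal (projFst Z) F (pre (projSnd Z) V) ⟨w, h⟩ ∘ₗ unpp Z F V else 0

variable {Z F}

theorem ppVal_of_mem {V : Opens Y} {w : X × Y} (h : w ∈ Z) (s : sec (pp Z F) V) :
    ppVal Z F V w s = pbVal (projFst Z) F (pre (projSnd Z) V) ⟨w, h⟩ (unpp Z F V s) := by
  rw [ppVal, dif_pos h]
  rfl

theorem eventually_part_iff {V : Opens Y} {w : X × Y} (h : w ∈ Z) (hV : w.2 ∈ V)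
    {P : X × Y → Prop} :
    (∀ᶠ w' in 𝓝[part Z V] w, P w') ↔ ∀ᶠ w' : Z in 𝓝 (⟨w, h⟩ : Z), P w' := by
  have h1 : 𝓝[part Z V] w = 𝓝[Z] w := by
    refine (nhdsWithin_inter_of_mem' (s := Z) (t := Prod.snd ⁻¹' (V : Set Y)) ?_)
    exact mem_nhdsWithin_of_mem_nhds ((V.isOpen.preimage continuous_snd).mem_nhds hV)
  rw [h1, nhdsWithin_eq_map_subtype_coe h]
  rfl

theorem locSec_ppVal {V : Opens Y} (s : sec (pp Z F) V) :
    LocSec F Prod.fst (part Z V) (fun w => ppVal Z F V w s) := by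
  rintro w ⟨h, hV⟩
  obtain ⟨N, hN, t, ht⟩ := eventually_pbVal (projFst Z) F (unpp Z F V s)
    (w := ⟨w, h⟩) hV
  refine ⟨N, hN, t, (eventually_part_iff h hV).2 ?_⟩
  filter_upwards [ht] with w' e
  rw [ppVal_of_mem w'.2]
  exact e

theorem pp_ext {V : Opens Y} {s t : sec (pp Z F) V}
    (h : ∀ w ∈ part Z V, ppVal Z F V w s = ppVal Z F V w t) : s = t := by
  refine pb_sec_ext (projFst Z) F (V := pre (projSnd Z) V) fun w hw => ?_
  have := h w.1 ⟨w.2, hw⟩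
  rwa [ppVal_of_mem w.2, ppVal_of_mem w.2] at this

/-- Together with `locSec_ppVal` and `pp_ext` this identifies sections over V with families of germs
of F, locally given by sections, on the part of Z over V. The set Z is arbitrary, so open and closed
half-planes are covered at once. -/
theorem exists_pp {V : Opens Y} {g : ∀ w : X × Y, stk F w.1}
    (hg : LocSec F Prod.fst (part Z V) g) :
    ∃ s : sec (pp Z F) V, ∀ w ∈ part Z V, ppVal Z F V w s = g w := by
  obtain ⟨s, hs⟩ := exists_pb_sec (projFst Z) F (pre (projSnd Z) V) (fun w => g w.1)
    (fun w hw => by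
      obtain ⟨N, hN, t, ht⟩ := hg w.1 ⟨w.2, hw⟩
      exact ⟨N, hN, t, (eventually_part_iff w.2 hw).1 ht⟩)
  refine ⟨s, fun w hw => ?_⟩
  exact (ppVal_of_mem (F := F) (V := V) hw.1 s).trans (hs ⟨w, hw.1⟩ hw.2)

theorem ppVal_resL {V W : Opens Y} (h : W ≤ V) {w : X × Y} (hw : w.2 ∈ W) (s : sec (pp Z F) V) :
    ppVal Z F W w (resL _ h s) = ppVal Z F V w s := by
  by_cases hZ : w ∈ Z
  · rw [ppVal_of_mem hZ, ppVal_of_mem hZ]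
    exact pbVal_resL (projFst Z) F (V := pre (projSnd Z) V) (W := pre (projSnd Z) W)
      (fun a ha => h ha) (w := ⟨w, hZ⟩) hw (unpp Z F V s)
  · simp [ppVal, hZ]

theorem ppVal_map {F F' : Sh k X} (φ : F ⟶ F') (V : Opens Y) (w : X × Y) (s : sec (pp Z F) V) :
    ppVal Z F' V w (secMap ((pullPush k Z).map φ) V s) = stalkMap φ w.1 (ppVal Z F V w s) := by
  by_cases hZ : w ∈ Z
  · rw [ppVal_of_mem hZ, ppVal_of_mem hZ]
    exact pbVal_map (projFst Z) φ (pre (projSnd Z) V) ⟨w, hZ⟩ (unpp Z F V s)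
  · simp [ppVal, hZ]

theorem ppVal_res {Z' : Set (X × Y)} (h : Z' ⊆ Z) {V : Opens Y} {w : X × Y} (hw : w ∈ part Z' V)
    (s : sec (pp Z F) V) :
    ppVal Z' F V w (secMap ((pullPushRes h).app F) V s) = ppVal Z F V w s := by
  rw [ppVal_of_mem hw.1, ppVal_of_mem (h hw.1)]
  exact pbVal_baseChange (projFst Z) F (inclMap h) (baseRes h F) (unit_baseRes h F)
    (pre (projSnd Z) V) (w := ⟨w, hw.1⟩) hw.2 (unpp Z F V s)

/-- Equal germs have equal values nearby. -/
theorem ppVal_eq_of_gat_eq {V W : Opens Y} {s : sec (pp Z F) V} {t : sec (pp Z F) W} {y : Y}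
    (hV : y ∈ V) (hW : y ∈ W) (h : gat _ V y s = gat _ W y t) :
    ∀ᶠ y' in 𝓝 y, ∀ x, ppVal Z F V (x, y') s = ppVal Z F W (x, y') t := by
  rw [gat_of_mem hV, gat_of_mem hW] at h
  obtain ⟨U, hU, iV, iW, e⟩ := TopCat.Presheaf.germ_eq (pp Z F).presheaf y hV hW s t h
  have e' : resL (pp Z F) iV.le s = resL (pp Z F) iW.le t := e
  filter_upwards [eventually_mem_opens hU] with y' hy' x
  rw [← ppVal_resL iV.le (w := (x, y')) hy', e', ppVal_resL iW.le (w := (x, y')) hy']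

/-- The projection to Y is not proper, so agreement on the fibre over y is not enough; it is
required on all fibres over a neighbourhood. -/
theorem gat_eq_of_ppVal_eq {V W : Opens Y} {s : sec (pp Z F) V} {t : sec (pp Z F) W} {y : Y}
    (hV : y ∈ V) (hW : y ∈ W)
    (h : ∀ᶠ y' in 𝓝 y, ∀ x, (x, y') ∈ Z → ppVal Z F V (x, y') s = ppVal Z F W (x, y') t) :
    gat _ V y s = gat _ W y t := by
  obtain ⟨O, hO, hOo, hyO⟩ := eventually_nhds_iff.1 h
  let U : Opens Y := V ⊓ W ⊓ ⟨O, hOo⟩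
  have hU : y ∈ U := ⟨⟨hV, hW⟩, hyO⟩
  have hUV : U ≤ V := inf_le_left.trans inf_le_left
  have hUW : U ≤ W := inf_le_left.trans inf_le_right
  rw [← gat_resL hUV hU s, ← gat_resL hUW hU t]
  congr 1
  refine pp_ext fun w hw => ?_
  rw [ppVal_resL hUV hw.2, ppVal_resL hUW hw.2]
  exact hO w.2 hw.2.2 w.1 hw.1

/-- The section of `R⁰q_* p^* F` given by a section of `F`. -/
def pullSec {N : Opens X} {V : Opens Y} (h : ∀ w ∈ part Z V, w.1 ∈ N) :
    sec F N →ₗ[k] sec (pp Z F) V :=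
  resL (pb (projFst Z) F) (V := pre (projSnd Z) V) (U := pre (projFst Z) N)
    (fun w hw => h w.1 ⟨w.2, hw⟩) ∘ₗ pbSec (projFst Z) F N

theorem ppVal_pullSec {N : Opens X} {V : Opens Y} (h : ∀ w ∈ part Z V, w.1 ∈ N) {w : X × Y}
    (hw : w ∈ part Z V) (t : sec F N) : ppVal Z F V w (pullSec h t) = gat F N w.1 t := by
  rw [ppVal_of_mem hw.1]
  refine (pbVal_resL (projFst Z) F (V := pre (projFst Z) N) (W := pre (projSnd Z) V)
    (fun w hw => h w.1 ⟨w.2, hw⟩) (w := ⟨w, hw.1⟩) hw.2 _).trans ?_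
  exact pbVal_pbSec (projFst Z) F (w := ⟨w, hw.1⟩) (h w hw) t

end PullPush

/-! ### Base change -/

section BaseChange

variable {k : Type} [Field k] {X Y Y' : Type} [TopologicalSpace X] [TopologicalSpace Y]
  [TopologicalSpace Y'] {Z : Set (X × Y)} {Z' : Set (X × Y')} (g : TopCat.of Y' ⟶ TopCat.of Y)
  (hg : ∀ w ∈ Z', (w.1, g.hom w.2) ∈ Z)

/-- The map `(x, y') ↦ (x, g y')`. -/
def baseMap : TopCat.of Z' ⟶ TopCat.of Z :=
  TopCat.ofHom ⟨fun w => ⟨(w.1.1, g.hom w.1.2), hg w.1 w.2⟩, by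
    refine Continuous.subtype_mk (Continuous.prodMk ?_ ?_) _
    · exact continuous_fst.comp continuous_subtype_val
    · exact g.hom.continuous.comp (continuous_snd.comp continuous_subtype_val)⟩

theorem exists_ppBase (hg : ∀ w ∈ Z', (w.1, g.hom w.2) ∈ Z) (F : Sh k X) : ∃ b : pp Z F ⟶ pf g (pp Z' F),
    ∀ (V : Opens Y) (s : sec (pp Z F) V) (w : X × Y'), w ∈ part Z' (pre g V) →
      ppVal Z' F (pre g V) w (secMap b V s) = ppVal Z F V (w.1, g.hom w.2) s := by
  obtain ⟨b, hb⟩ := exists_pb_desc (projFst Z) F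
    (B := pf (baseMap g hg) (pb (baseMap g hg ≫ projFst Z) F))
    (pbUnit (baseMap g hg ≫ projFst Z) F)
  refine ⟨(TopCat.Sheaf.pushforward (ModuleCat.{0} k) (projSnd Z)).map b, fun V s w hw => ?_⟩
  rw [ppVal_of_mem (hg w hw.1)]
  refine (ppVal_of_mem (F := F) (V := pre g V) hw.1 _).trans ?_
  exact pbVal_baseChange (projFst Z) F (baseMap g hg) b hb
    (pre (projSnd Z) V) (w := ⟨w, hw.1⟩) hw.2 (unpp Z F V s)

/-- The base change map. -/
def ppBaseApp (F : Sh k X) : pp Z F ⟶ pf g (pp Z' F) := (exists_ppBase g hg F).choose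

theorem ppVal_ppBaseApp (F : Sh k X) {V : Opens Y} (s : sec (pp Z F) V) {w : X × Y'}
    (hw : w ∈ part Z' (pre g V)) :
    ppVal Z' F (pre g V) w (secMap (ppBaseApp g hg F) V s) = ppVal Z F V (w.1, g.hom w.2) s :=
  (exists_ppBase g hg F).choose_spec V s w hw

theorem sh_hom_ext {A B : Sh k Y} {a b : A ⟶ B}
    (h : ∀ (V : Opens Y) (s : sec A V), secMap a V s = secMap b V s) : a = b := by
  apply Sheaf.hom_ext
  exact NatTrans.ext (funext fun U => ModuleCat.hom_ext (LinearMap.ext fun s => h U.unop s))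

end BaseChange

/-! ### The restriction map `R⁰q_{1*} p_1^* ⟶ colim_r R⁰n_{r*} m_r^*` -/

section Restriction

variable {k : Type} [Field k] {X Y : Type} [TopologicalSpace X] [TopologicalSpace Y]

theorem LocSec.mono {T : Type} [TopologicalSpace T] {F : Sh k X} {f : T → X} {A B : Set T}
    {s : ∀ w, stk F (f w)} (h : LocSec F f A s) (hBA : B ⊆ A) : LocSec F f B s := by
  intro w hw
  obtain ⟨N, hN, t, ht⟩ := h w (hBA hw)
  exact ⟨N, hN, t, ht.filter_mono (nhdsWithin_mono w hBA)⟩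

/-- Restriction along an inclusion that is an equality near the fibre is bijective on stalks. -/
theorem stalkMap_pullPushRes_bijective {Z Z' : Set (X × Y)} (h : Z' ⊆ Z) (F : Sh k X) {y : Y}
    (hy : ∀ᶠ y' in 𝓝 y, ∀ x, (x, y') ∈ Z → (x, y') ∈ Z') :
    Function.Bijective (stalkMap ((pullPushRes (k := k) h).app F) y) := by
  obtain ⟨O, hO, hOo, hyO⟩ := eventually_nhds_iff.1 hy
  constructor
  · rw [injective_iff_map_eq_zero]
    intro x hx
    obtain ⟨V, hV, s, rfl⟩ := exists_gat_eq (pp Z F) x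
    rw [stalkMap_gat, ← map_zero (gat (pp Z' F) V y)] at hx
    rw [← map_zero (gat (pp Z F) V y)]
    refine gat_eq_of_ppVal_eq hV hV ?_
    filter_upwards [ppVal_eq_of_gat_eq hV hV hx, hy, eventually_mem_opens hV] with y' e h1 h2 x hx
    have e' := e x
    rw [ppVal_res h (w := (x, y')) ⟨h1 x hx, h2⟩, map_zero] at e'
    rw [e', map_zero]
  · intro x
    obtain ⟨V, hV, s, rfl⟩ := exists_gat_eq (pp Z' F) x
    let W : Opens Y := V ⊓ ⟨O, hOo⟩
    have hsub : part Z W ⊆ part Z' V := fun w hw => ⟨hO w.2 hw.2.2 w.1 hw.1, hw.2.1⟩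
    obtain ⟨t, ht⟩ := exists_pp ((locSec_ppVal s).mono hsub)
    refine ⟨gat (pp Z F) W y t, ?_⟩
    have hyW : y ∈ W := ⟨hV, hyO⟩
    rw [stalkMap_gat]
    refine gat_eq_of_ppVal_eq hyW hV ?_
    filter_upwards [eventually_mem_opens hyW] with y' h1 x hx
    rw [ppVal_res h (w := (x, y')) ⟨hx, h1⟩, ht _ ⟨h hx, h1⟩]

end Restriction

/-! ### Existence and uniqueness of the restriction map ι -/

section Iota

variable {k : Type} [Field k]

/-- The map of `IsRestriction` from `X_r` to `⋃_z 𝓗_z × {z}`. -/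
abbrev resH (k : Type) [Field k] (r : ℝ) : pullPush k (incH ∪ incC r) ⟶ directG k :=
  pullPushRes Set.subset_union_left

/-- The map of `IsRestriction` from `X_r` to the colimit. -/
abbrev resL' (k : Type) [Field k] (r : ℝ) : pullPush k (incH ∪ incC r) ⟶ directL k :=
  pullPushRes Set.subset_union_right ≫ toColim k incC antitone_incC r

theorem toColim_comp {X Y : Type} [TopologicalSpace X] [TopologicalSpace Y]
    (Z : ℝ → Set (X × Y)) (hZ : Antitone Z) {r r' : ℝ} (h : r ≤ r') :
    pullPushRes (hZ h) ≫ toColim k Z hZ r' = toColim k Z hZ r := by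
  ext1
  funext F
  exact Limits.colimit.w ((pullPushDiagram k Z hZ).flip.obj F) (homOfLE h)

theorem union_incC_subset {r r' : ℝ} (h : r ≤ r') : incH ∪ incC r' ⊆ incH ∪ incC r :=
  Set.union_subset_union_right _ (antitone_incC h)

theorem pullPushRes_resH {r r' : ℝ} (h : r ≤ r') :
    pullPushRes (union_incC_subset h) ≫ resH k r' = resH k r := pullPushRes_comp _ _

theorem pullPushRes_resL' {r r' : ℝ} (h : r ≤ r') :
    pullPushRes (union_incC_subset h) ≫ resL' k r' = resL' k r := by
  rw [← Category.assoc, pullPushRes_comp]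
  refine Eq.trans ?_ (congrArg (pullPushRes Set.subset_union_right ≫ ·)
    (toColim_comp incC antitone_incC h))
  rw [← Category.assoc, pullPushRes_comp]

theorem eventually_log_lt {z : Cstar} {r : ℝ} (h : Real.log ‖(z : ℂ)‖ < r) :
    ∀ᶠ z' : Cstar in 𝓝 z, Real.log ‖(z' : ℂ)‖ < r := by
  have : ContinuousAt (fun z' : Cstar => Real.log ‖(z' : ℂ)‖) z :=
    ContinuousAt.log (continuous_subtype_val.norm.continuousAt) (norm_ne_zero_iff.2 z.2)
  exact this.eventually_lt_const h

/-- For z' near z, log |z'| < r, so the half-plane with bound r is contained in that of z' and adds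
nothing to the fibre of X_r. -/
theorem resH_bijective (F : Sh k ℂ) {z : Cstar} {r : ℝ} (h : Real.log ‖(z : ℂ)‖ < r) :
    Function.Bijective (stalkMap ((resH k r).app F) z) := by
  refine stalkMap_pullPushRes_bijective _ F ?_
  filter_upwards [eventually_log_lt h] with z' hz' x hx
  rcases hx with hx | hx
  · exact hx
  · exact lt_trans hz' hx

theorem exists_iotaStalk (F : Sh k ℂ) (z : Cstar) :
    ∃ φ : stk ((directG k).obj F) z →ₗ[k] stk ((directL k).obj F) z, ∀ (r : ℝ)
      (x : stk (pp (incH ∪ incC r) F) z),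
      φ (stalkMap ((resH k r).app F) z x) = stalkMap ((resL' k r).app F) z x := by
  -- Any index above log |z| makes the restriction from X_r invertible at z. This choice defines φ;
  -- a general r is compared with it through max r r₀.
  let r₀ := Real.log ‖(z : ℂ)‖ + 1
  let e := LinearEquiv.ofBijective _ (resH_bijective F (lt_add_one (Real.log ‖(z : ℂ)‖)))
  let φ := stalkMap ((resL' k r₀).app F) z ∘ₗ e.symm.toLinearMap
  have h0 : ∀ x, φ (stalkMap ((resH k r₀).app F) z x) = stalkMap ((resL' k r₀).app F) z x :=
    fun x => congrArg (stalkMap ((resL' k r₀).app F) z) (e.symm_apply_apply x)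
  have hmono : ∀ {r r' : ℝ} (h : r ≤ r') (x : stk (pp (incH ∪ incC r) F) z),
      stalkMap ((resH k r').app F) z
        (stalkMap ((pullPushRes (k := k) (union_incC_subset h)).app F) z x) =
        stalkMap ((resH k r).app F) z x ∧
      stalkMap ((resL' k r').app F) z
        (stalkMap ((pullPushRes (k := k) (union_incC_subset h)).app F) z x) =
        stalkMap ((resL' k r).app F) z x := by
    intro r r' h x
    rw [← stalkMap_comp, ← stalkMap_comp, ← NatTrans.comp_app, ← NatTrans.comp_app,
      pullPushRes_resH h, pullPushRes_resL' h]
    exact ⟨rfl, rfl⟩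
  refine ⟨φ, fun r x => ?_⟩
  have h1 : ∀ x, φ (stalkMap ((resH k (max r r₀)).app F) z x) =
      stalkMap ((resL' k (max r r₀)).app F) z x := by
    intro x
    obtain ⟨y, hy⟩ := (resH_bijective F (lt_add_one (Real.log ‖(z : ℂ)‖))).2
      (stalkMap ((resH k (max r r₀)).app F) z x)
    have h2 := (hmono (le_max_right r r₀) y).1
    have h3 := (resH_bijective F (z := z) (r := max r r₀)
      (lt_of_lt_of_le (lt_add_one _) (le_max_right _ _))).1 (h2.trans hy)
    rw [← hy, h0, ← h3]
    exact (hmono (le_max_right r r₀) y).2.symm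
  rw [← (hmono (le_max_left r r₀) x).1, h1, (hmono (le_max_left r r₀) x).2]

/-- The stalk maps carry sections to sections because a section of the source lifts, near z, to a
section over X_r, whose image in the colimit is a section with the required germs. Naturality is
checked on the same lifts. -/
theorem exists_iota (k : Type) [Field k] : ∃ ι : directG k ⟶ directL k, IsRestriction ι := by
  choose φ hφ using fun F : Sh k ℂ => exists_iotaStalk F
  have h1 : ∀ F : Sh k ℂ, ∃ f : (directG k).obj F ⟶ (directL k).obj F,
      ∀ z, stalkMap f z = φ F z := by
    refine fun F => exists_hom_of_stalkMaps (φ F) fun U s z hz => ?_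
    obtain ⟨x, hx⟩ := (resH_bijective F (lt_add_one (Real.log ‖(z : ℂ)‖))).2 (gat _ U z s)
    obtain ⟨V, hV, t, rfl⟩ := exists_gat_eq (pp (incH ∪ incC _) F) x
    refine ⟨V, hV, secMap ((resL' k _).app F) V t, ?_⟩
    rw [stalkMap_gat] at hx
    filter_upwards [eventually_gat_eq hV hz hx] with z' hz'
    rw [← hz', ← stalkMap_gat, ← stalkMap_gat, hφ]
  choose f hf using h1
  refine ⟨⟨f, fun F F' a => hom_ext_stalk fun z x => ?_⟩, fun r => ?_⟩
  · obtain ⟨y, rfl⟩ := (resH_bijective F (lt_add_one (Real.log ‖(z : ℂ)‖))).2 x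
    have e1 := (resH k (Real.log ‖(z : ℂ)‖ + 1)).naturality a
    have e2 := (resL' k (Real.log ‖(z : ℂ)‖ + 1)).naturality a
    rw [stalkMap_comp, stalkMap_comp, hf, hf, hφ, ← stalkMap_comp, ← stalkMap_comp, ← e1, ← e2,
      stalkMap_comp, hφ, stalkMap_comp]
  · ext1
    funext F
    refine hom_ext_stalk fun z x => ?_
    rw [NatTrans.comp_app, stalkMap_comp]
    exact (congrFun (congrArg DFunLike.coe (hf F z)) _).trans (hφ F z r x)

theorem iota_unique {ι ι' : directG k ⟶ directL k} (h : IsRestriction ι) (h' : IsRestriction ι') :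
    ι' = ι := by
  ext1
  funext F
  refine hom_ext_stalk fun z x => ?_
  obtain ⟨y, rfl⟩ := (resH_bijective F (lt_add_one (Real.log ‖(z : ℂ)‖))).2 x
  have e : resH k (Real.log ‖(z : ℂ)‖ + 1) ≫ ι' = resH k (Real.log ‖(z : ℂ)‖ + 1) ≫ ι :=
    (h' _).trans (h _).symm
  rw [← stalkMap_comp, ← stalkMap_comp, ← NatTrans.comp_app, ← NatTrans.comp_app, e]

end Iota

/-! ### Vanishing of cohomology and gluing -/

section Cohomology

open Abelian Limits

variable {X : Type} [TopologicalSpace X]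

/-- Abelian sheaves on `X`. -/
abbrev AbSh (X : Type) [TopologicalSpace X] :=
  Sheaf (Opens.grothendieckTopology X) AddCommGrpCat.{0}

/-- The presheaf `ℤ[U]`. -/
abbrev freePre (U : Opens X) : (Opens X)ᵒᵖ ⥤ AddCommGrpCat.{0} :=
  yoneda.obj U ⋙ AddCommGrpCat.free

/-- The abelian sheaf generated by `U`. -/
abbrev freeSh (U : Opens X) : AbSh X :=
  (presheafToSheaf (Opens.grothendieckTopology X) AddCommGrpCat.{0}).obj (freePre U)

/-- Functoriality of `ℤ[U]`. -/
abbrev freeMap {U V : Opens X} (i : U ⟶ V) : freeSh U ⟶ freeSh V :=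
  (presheafToSheaf (Opens.grothendieckTopology X) AddCommGrpCat.{0}).map
    (Functor.whiskerRight (yoneda.map i) _)

variable {G : AbSh X}

/-- The section that corresponds to a morphism `ℤ[U] ⟶ G`. -/
def secOf {U : Opens X} (φ : freeSh U ⟶ G) : G.obj.obj (op U) :=
  ((toSheafify (Opens.grothendieckTopology X) (freePre U) ≫ φ.hom).app (op U)).hom
    (FreeAbelianGroup.of (𝟙 U))

theorem secOf_freeMap {U V : Opens X} (i : U ⟶ V) (φ : freeSh V ⟶ G) :
    secOf (freeMap i ≫ φ) = (G.obj.map i.op).hom (secOf φ) := by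
  have h1 := (toSheafify_naturality (J := Opens.grothendieckTopology X)
    (Functor.whiskerRight (yoneda.map i) AddCommGrpCat.free : freePre U ⟶ freePre V))
  have h2 := (toSheafify (Opens.grothendieckTopology X) (freePre V) ≫ φ.hom).naturality i.op
  have h3 := congrArg (fun a => a.hom (FreeAbelianGroup.of (𝟙 V))) h2
  refine Eq.trans ?_ h3
  have h4 := congrArg (fun a => ((a ≫ φ.hom).app (op U)).hom (FreeAbelianGroup.of (𝟙 U))) h1
  refine Eq.trans rfl (h4.symm.trans ?_)
  have h5 : ((Functor.whiskerRight (yoneda.map i) AddCommGrpCat.free).app (op U)).hom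
      (FreeAbelianGroup.of (𝟙 U)) =
      ((freePre V).map i.op).hom (FreeAbelianGroup.of (𝟙 V)) := by
    refine (FreeAbelianGroup.map_of_apply _).trans
      (Eq.trans ?_ (FreeAbelianGroup.map_of_apply _).symm)
    exact congrArg FreeAbelianGroup.of (Subsingleton.elim (α := U ⟶ V) _ _)
  exact congrArg (((toSheafify (Opens.grothendieckTopology X) (freePre V) ≫ φ.hom).app
    (op U)).hom) h5

/-- Yoneda, the freeness of ℤ[U] and the universal property of sheafification. -/
theorem secOf_surjective {U : Opens X} (s : G.obj.obj (op U)) : ∃ φ : freeSh U ⟶ G, secOf φ = s := by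
  let a : freePre U ⟶ G.obj :=
    { app := fun W => AddCommGrpCat.ofHom
        (FreeAbelianGroup.lift fun i : W.unop ⟶ U => (G.obj.map i.op).hom s)
      naturality := fun W W' j => by
        refine AddCommGrpCat.hom_ext (FreeAbelianGroup.lift_ext _ _ fun x => ?_)
        refine Eq.trans (congrArg (FreeAbelianGroup.lift
          fun i : W'.unop ⟶ U => (G.obj.map i.op).hom s) (FreeAbelianGroup.map_of_apply _)) ?_
        refine (FreeAbelianGroup.lift_apply_of _ _).trans ?_
        refine Eq.trans ?_ (congrArg (G.obj.map j).hom (FreeAbelianGroup.lift_apply_of _ _)).symm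
        exact congrArg (fun b => b.hom s) (G.obj.map_comp x.op j) }
  refine ⟨⟨sheafifyLift _ a G.property⟩, ?_⟩
  rw [secOf]
  erw [toSheafify_sheafifyLift]
  refine (FreeAbelianGroup.lift_apply_of _ _).trans ?_
  simp

theorem biprod_lift_neg_comp {C : Type*} [Category C] [Preadditive C] {P A B G : C}
    [Limits.HasBinaryBiproduct A B] (a : P ⟶ A) (b : P ⟶ B) (ψ : A ⊞ B ⟶ G) :
    Limits.biprod.lift a (-b) ≫ ψ =
      a ≫ Limits.biprod.inl ≫ ψ + -(b ≫ Limits.biprod.inr ≫ ψ) := by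
  rw [Limits.biprod.lift_eq, Preadditive.add_comp]
  simp only [Preadditive.neg_comp, Category.assoc]

/-- Mayer–Vietoris: apply Hom(-, G) to the short exact sequence of ℤ[U ∩ V], ℤ[U] ⊕ ℤ[V], ℤ[U ∪ V].
The obstruction to extending a map from the first term to the middle term lies in the vanishing
Ext¹. -/
theorem exists_sub_of_subsingleton [HasExt.{0} (AbSh X)] {U V : Opens X}
    (h : Subsingleton (Ext (freeSh (U ⊔ V)) G 1)) (s : G.obj.obj (op (U ⊓ V))) :
    ∃ (a : G.obj.obj (op U)) (b : G.obj.obj (op V)),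
      (G.obj.map (homOfLE (inf_le_left : U ⊓ V ≤ U)).op).hom a -
        (G.obj.map (homOfLE (inf_le_right : U ⊓ V ≤ V)).op).hom b = s := by
  obtain ⟨φ, rfl⟩ := secOf_surjective s
  let S := Opens.mayerVietorisSquare U V
  obtain ⟨x₂, hx₂⟩ := Ext.contravariant_sequence_exact₁ S.shortComplex_shortExact G
    (Ext.mk₀ (show S.shortComplex.X₁ ⟶ G from φ)) (n₁ := 1) rfl (h.elim _ _)
  obtain ⟨ψ, rfl⟩ := (Ext.mk₀_bijective _ _).2 x₂
  rw [Ext.mk₀_comp_mk₀] at hx₂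
  have e := (Ext.mk₀_bijective _ _).1 hx₂
  -- The first map of the sequence has a minus sign in its second component, which produces the
  -- difference a - b.
  have e' : φ = freeMap S.f₁₂ ≫ Limits.biprod.inl ≫ ψ +
      -(freeMap S.f₁₃ ≫ Limits.biprod.inr ≫ ψ) := by
    exact e.symm.trans (biprod_lift_neg_comp _ _ _)
  refine ⟨secOf (Limits.biprod.inl ≫ ψ), secOf (Limits.biprod.inr ≫ ψ), ?_⟩
  rw [e']
  exact (sub_eq_add_neg _ _).trans (congrArg₂ (· + ·)
    (secOf_freeMap S.f₁₂ (Limits.biprod.inl ≫ ψ)).symm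
    (congrArg Neg.neg (secOf_freeMap S.f₁₃ (Limits.biprod.inr ≫ ψ)).symm))

/-- Sheaf cohomology is Ext from the constant sheaf ℤ, while Mayer–Vietoris speaks of ℤ[U ∪ V]. For
the whole space they agree: each open set has exactly one inclusion into X, so ℤ[X] is the constant
presheaf ℤ. -/
theorem constantSheaf_iso_freeSh_top :
    Nonempty ((constantSheaf (Opens.grothendieckTopology X) AddCommGrpCat.{0}).obj
      (AddCommGrpCat.of (ULift ℤ)) ≅ freeSh (⊤ : Opens X)) := by
  have inst : ∀ U : (Opens X)ᵒᵖ, Unique ((yoneda.obj (⊤ : Opens X)).obj U) := fun U =>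
    ⟨⟨homOfLE le_top⟩, fun _ => Subsingleton.elim (α := U.unop ⟶ ⊤) _ _⟩
  let e : ∀ U : (Opens X)ᵒᵖ, ULift ℤ ≃+ FreeAbelianGroup ((yoneda.obj (⊤ : Opens X)).obj U) :=
    fun U => AddEquiv.ulift.trans (FreeAbelianGroup.uniqueEquiv _).symm
  have he : ∀ U n, e U n = n.down • FreeAbelianGroup.of default := fun _ _ => rfl
  refine ⟨(presheafToSheaf _ _).mapIso
    (NatIso.ofComponents (fun U => (e U).toAddCommGrpIso) fun {U V} i => ?_)⟩
  refine AddCommGrpCat.hom_ext (AddMonoidHom.ext fun n => ?_)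
  refine (he V n).trans ?_
  refine Eq.trans ?_ (congrArg ((freePre (⊤ : Opens X)).map i).hom (he U n)).symm
  refine Eq.trans ?_ (map_zsmul ((freePre (⊤ : Opens X)).map i).hom n.down _).symm
  refine congrArg (n.down • ·) (Eq.trans ?_ (FreeAbelianGroup.map_of_apply _).symm)
  exact congrArg FreeAbelianGroup.of (Subsingleton.elim (α := V.unop ⟶ ⊤) _ _)

variable {k : Type} [Field k]

theorem sec_top_eq_zero {F : Sh k ℂ} (hF : IsAcyclic F) (s : sec F ⊤) : s = 0 := by
  have h0 := hF 0
  have e := Sheaf.H.equiv₀ ((sheafCompose _ (forget₂ (ModuleCat.{0} k) AddCommGrpCat.{0})).obj F)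
    (T := (⊤ : Opens ℂ)) Limits.isTerminalTop
  exact e.symm.injective (h0.elim _ _)

theorem exists_sub_of_isAcyclic {F : Sh k ℂ} (hF : IsAcyclic F) {U V : Opens ℂ}
    (hUV : U ⊔ V = ⊤) (s : sec F (U ⊓ V)) :
    ∃ (a : sec F U) (b : sec F V), resL F inf_le_left a - resL F inf_le_right b = s := by
  have h1 : Subsingleton (Ext (freeSh (U ⊔ V))
      ((sheafCompose _ (forget₂ (ModuleCat.{0} k) AddCommGrpCat.{0})).obj F) 1) := by
    rw [hUV]
    obtain ⟨e⟩ := constantSheaf_iso_freeSh_top (X := ℂ)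
    have h := hF 1
    refine ⟨fun x y => ?_⟩
    have hx : ∀ x : Ext (freeSh (⊤ : Opens ℂ))
        ((sheafCompose _ (forget₂ (ModuleCat.{0} k) AddCommGrpCat.{0})).obj F) 1, x = 0 := by
      intro x
      have h2 : (Ext.mk₀ e.inv).comp ((Ext.mk₀ e.hom).comp x (zero_add 1)) (zero_add 1) = x := by
        rw [← Ext.comp_assoc (Ext.mk₀ e.inv) (Ext.mk₀ e.hom) x (zero_add 0) (zero_add 1) (by simp),
          Ext.mk₀_comp_mk₀, e.inv_hom_id, Ext.mk₀_id_comp]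
      rw [← h2, show (Ext.mk₀ e.hom).comp x (zero_add 1) = 0 from h.elim _ _, Ext.comp_zero]
    rw [hx x, hx y]
  exact exists_sub_of_subsingleton h1 s

end Cohomology

/-! ### The identity principle -/

section Identity

variable {k : Type} [Field k] {X : Type} [TopologicalSpace X]

/-- The zero locus of every section is closed in its domain. -/
def IdentityPrinciple (F : Sh k X) : Prop :=
  ∀ (N : Opens X) (t : sec F N), ∀ x ∈ N, (∃ᶠ y in 𝓝 x, gat F N y t = 0) → gat F N x t = 0

theorem IdentityPrinciple.gat_eq {F : Sh k X} (hF : IdentityPrinciple F) {N N' : Opens X}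
    {t : sec F N} {t' : sec F N'} {x : X} (hN : x ∈ N) (hN' : x ∈ N')
    (h : ∃ᶠ y in 𝓝 x, gat F N y t = gat F N' y t') : gat F N x t = gat F N' x t' := by
  have hx : x ∈ N ⊓ N' := ⟨hN, hN'⟩
  have e : ∀ y ∈ N ⊓ N', gat F (N ⊓ N') y (resL F inf_le_left t - resL F inf_le_right t') =
      gat F N y t - gat F N' y t' := fun y hy => by
    rw [map_sub, gat_resL _ hy, gat_resL _ hy]
  have := hF (N ⊓ N') (resL F inf_le_left t - resL F inf_le_right t') x hx (by
    refine (h.and_eventually (eventually_mem_opens hx)).mono ?_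
    rintro y ⟨h1, h2⟩
    rw [e y h2, h1, sub_self])
  rwa [e x hx, sub_eq_zero] at this

/-- Two sections over a connected set that agree at a point are equal. -/
theorem LocSec.eqOn_of_isPreconnected {F : Sh k X} (hF : IdentityPrinciple F) {T : Type}
    [TopologicalSpace T] {f : T → X} (hf : Continuous f) {A : Set T} (hA : IsPreconnected A)
    {s s' : ∀ w, stk F (f w)} (hs : LocSec F f A s) (hs' : LocSec F f A s') {a : T} (ha : a ∈ A)
    (h : s a = s' a) : ∀ w ∈ A, s w = s' w := by
  have : PreconnectedSpace A := isPreconnected_iff_preconnectedSpace.1 hA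
  let E : Set A := {w | s w = s' w}
  have key : ∀ w : A, ∃ N : Opens X, f w ∈ N ∧ ∃ N' : Opens X, f w ∈ N' ∧
      ∃ (t : sec F N) (t' : sec F N'), ∀ᶠ w' : A in 𝓝 w,
        s w' = gat F N (f w') t ∧ s' w' = gat F N' (f w') t' := by
    intro w
    obtain ⟨N, hN, t, ht⟩ := hs w w.2
    obtain ⟨N', hN', t', ht'⟩ := hs' w w.2
    refine ⟨N, hN, N', hN', t, t', ?_⟩
    have := ht.and ht'
    rw [nhdsWithin_eq_map_subtype_coe w.2] at this
    exact this
  have hE : IsClopen E := by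
    constructor
    · rw [← isOpen_compl_iff, isOpen_iff_mem_nhds]
      intro w hw
      obtain ⟨N, hN, N', hN', t, t', ht⟩ := key w
      by_contra hc
      have h1 : ∃ᶠ w' : A in 𝓝 w, s w' = s' w' := by
        intro h2
        exact hc h2
      have h2 : ∃ᶠ w' : A in 𝓝 w, gat F N (f w') t = gat F N' (f w') t' := by
        refine (h1.and_eventually ht).mono ?_
        rintro w' ⟨e, e1, e2⟩
        rw [← e1, ← e2, e]
      have h3 := hF.gat_eq hN hN' (t := t) (t' := t')
        (((hf.comp continuous_subtype_val).continuousAt (x := w)).frequently h2)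
      refine hw ?_
      have h4 := ht.self_of_nhds
      exact h4.1.trans (h3.trans h4.2.symm)
    · rw [isOpen_iff_mem_nhds]
      intro w hw
      obtain ⟨N, hN, N', hN', t, t', ht⟩ := key w
      have h4 := ht.self_of_nhds
      have h5 : gat F N (f w) t = gat F N' (f w) t' := h4.1.symm.trans (Eq.trans hw h4.2)
      have h6 := ((hf.comp continuous_subtype_val).continuousAt (x := w)).eventually
        (eventually_gat_eq hN hN' h5)
      filter_upwards [h6, ht] with w' e1 e2
      exact e2.1.trans (e1.trans e2.2.symm)
  have huniv : E = Set.univ := hE.eq_univ ⟨⟨a, ha⟩, h⟩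
  intro w hw
  have : (⟨w, hw⟩ : A) ∈ E := huniv ▸ Set.mem_univ _
  exact this

theorem locSec_gat (F : Sh k X) {N : Opens X} (t : sec F N) :
    LocSec F id (N : Set X) (fun x => gat F N x t) :=
  fun _ hx => ⟨N, hx, t, Eventually.of_forall fun _ => rfl⟩

theorem gat_eq_of_isPreconnected {F : Sh k X} (hF : IdentityPrinciple F) {N N' : Opens X}
    {t : sec F N} {t' : sec F N'} {A : Set X} (hA : IsPreconnected A) (hN : A ⊆ N) (hN' : A ⊆ N')
    {a : X} (ha : a ∈ A) (h : gat F N a t = gat F N' a t') :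
    ∀ x ∈ A, gat F N x t = gat F N' x t' :=
  LocSec.eqOn_of_isPreconnected hF continuous_id hA ((locSec_gat F t).mono hN)
    ((locSec_gat F t').mono hN') ha h

/-- Near x the section is given by a fixed vector of the fibre; if its germ vanishes at one nearby
point, the vector is zero. -/
theorem gat_eq_zero_of_isConstantOn {F : Sh k X} {U N : Opens X} (hU : IsConstantOn F U)
    (t : sec F N) {x : X} (hxU : x ∈ U) (hxN : x ∈ N) (h : ∃ᶠ y in 𝓝 x, gat F N y t = 0) :
    gat F N x t = 0 := by
  obtain ⟨V, -, τ, hτ⟩ := hU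
  obtain ⟨v, hv⟩ := (hτ x hxU).2 (gat F N x t)
  have hv' : gat F U x (τ v) = gat F N x t := by rw [gat_of_mem hxU]; exact hv
  obtain ⟨y, h1, h2, h3⟩ := (h.and_eventually
    ((eventually_gat_eq hxU hxN hv').and (eventually_mem_opens hxU))).exists
  have h4 : germ F U y h3 (τ v) = 0 := by rw [← gat_of_mem h3, h2, h1]
  have h5 : v = 0 := (hτ y h3).1 (by rw [map_zero]; exact h4)
  rw [← hv', h5, map_zero, map_zero]

/-- If the zero locus of sections is closed at all points of `A`, a section over a neighbourhood
of `A` that vanishes at one point of the connected set `A` vanishes on `A`. -/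
theorem gat_eq_zero_of_isPreconnected {F : Sh k X} {N : Opens X} (t : sec F N) {A : Set X}
    (hA : IsPreconnected A) (hN : A ⊆ N)
    (hc : ∀ x ∈ A, ∃ U : Opens X, x ∈ U ∧ IsConstantOn F U) {a : X} (ha : a ∈ A)
    (h : gat F N a t = 0) : ∀ x ∈ A, gat F N x t = 0 := by
  have : PreconnectedSpace A := isPreconnected_iff_preconnectedSpace.1 hA
  let E : Set A := {w | gat F N w t = 0}
  have hE : IsClopen E := by
    constructor
    · rw [← isOpen_compl_iff, isOpen_iff_mem_nhds]
      intro w hw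
      obtain ⟨U, hxU, hU⟩ := hc w w.2
      by_contra hcon
      have h1 : ∃ᶠ w' : A in 𝓝 w, gat F N w' t = 0 := fun h2 => hcon h2
      exact hw (gat_eq_zero_of_isConstantOn hU t hxU (hN w.2)
        (continuous_subtype_val.continuousAt.frequently h1))
    · rw [isOpen_iff_mem_nhds]
      intro w hw
      exact continuous_subtype_val.continuousAt.eventually (eventually_gat_eq_zero (hN w.2) hw)
  have huniv : E = Set.univ := hE.eq_univ ⟨⟨a, ha⟩, h⟩
  intro w hw
  have : (⟨w, hw⟩ : A) ∈ E := huniv ▸ Set.mem_univ _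
  exact this

end Identity

/-! ### The identity principle in the plane and continuation of sections -/

section Plane

variable {k : Type} [Field k]

/-- The punctured ball is the image of the half-plane Re w < log δ under w ↦ c + exp w. -/
theorem isPreconnected_ball_diff_singleton (c : ℂ) (δ : ℝ) :
    IsPreconnected (Metric.ball c δ \ {c}) := by
  rcases le_or_gt δ 0 with h | h
  · rw [Metric.ball_eq_empty.2 h, Set.empty_sdiff]
    exact isPreconnected_empty
  have hconv : Convex ℝ {w : ℂ | w.re < Real.log δ} := convex_halfSpace_re_lt _
  have himg : Metric.ball c δ \ {c} = (fun w => c + Complex.exp w) '' {w : ℂ | w.re < Real.log δ} := by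
    ext z
    constructor
    · rintro ⟨hz, hzc⟩
      have h0 : z - c ≠ 0 := sub_ne_zero.2 hzc
      refine ⟨Complex.log (z - c), ?_, ?_⟩
      · change (Complex.log (z - c)).re < Real.log δ
        rw [Complex.log_re]
        exact Real.log_lt_log (norm_pos_iff.2 h0) (by rwa [Metric.mem_ball, dist_eq_norm] at hz)
      · change c + Complex.exp (Complex.log (z - c)) = z
        rw [Complex.exp_log h0, add_sub_cancel]
    · rintro ⟨w, hw, rfl⟩
      refine ⟨?_, ?_⟩
      · rw [Metric.mem_ball, dist_eq_norm, add_sub_cancel_left, Complex.norm_exp]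
        exact (Real.lt_log_iff_exp_lt h).1 hw
      · simp
  rw [himg]
  exact hconv.isPreconnected.image _ (by fun_prop)

/-- An open ball. -/
def ballO (c : ℂ) (δ : ℝ) : Opens ℂ := ⟨Metric.ball c δ, Metric.isOpen_ball⟩

theorem mem_ballO {c x : ℂ} {δ : ℝ} : x ∈ ballO c δ ↔ ‖x - c‖ < δ := by
  rw [← dist_eq_norm]; exact Iff.rfl

theorem exists_ballO_subset {U : Set ℂ} {x : ℂ} (h : U ∈ 𝓝 x) :
    ∃ δ > 0, (ballO x δ : Set ℂ) ⊆ U := Metric.mem_nhds_iff.1 h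

/-- Acyclic constructible sheaves satisfy the identity principle: a section with support in a
singularity would extend by zero to a global section. -/
theorem identityPrinciple {F : Sh k ℂ} {S : Finset ℂ} (hS : IsConstructible S F)
    (hF : IsAcyclic F) : IdentityPrinciple F := by
  intro N t x hxN hfr
  by_cases hx : x ∈ S
  swap
  · obtain ⟨U, hxU, hU⟩ := hS.1 x hx
    exact gat_eq_zero_of_isConstantOn hU t hxU hxN hfr
  by_contra hne
  have h1 : ((N : Set ℂ) ∩ ((S.erase x : Finset ℂ) : Set ℂ)ᶜ) ∈ 𝓝 x :=
    inter_mem (N.isOpen.mem_nhds hxN)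
      ((S.erase x).finite_toSet.isClosed.isOpen_compl.mem_nhds (by simp))
  obtain ⟨δ, hδ, hsub⟩ := exists_ballO_subset h1
  have hxB : x ∈ ballO x δ := by simpa [mem_ballO] using hδ
  obtain ⟨y, hy0, hyB⟩ := (hfr.and_eventually (eventually_mem_opens hxB)).exists
  have hyx : y ≠ x := by
    rintro rfl
    exact hne hy0
  have hz : ∀ z ∈ Metric.ball x δ \ {x}, gat F N z t = 0 := by
    refine gat_eq_zero_of_isPreconnected t (isPreconnected_ball_diff_singleton x δ)
      (fun z hz => (hsub hz.1).1) (fun z hz => ?_) (a := y) ⟨hyB, hyx⟩ hy0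
    refine hS.1 z fun hzS => (hsub hz.1).2 ?_
    exact Finset.mem_coe.2 (Finset.mem_erase.2 ⟨hz.2, hzS⟩)
  classical
  obtain ⟨s, hs⟩ := exists_sec_of_germs F ⊤ (fun z => if z = x then gat F N z t else 0)
    (fun z _ => by
      by_cases hzx : z = x
      · subst hzx
        refine ⟨N, hxN, t, ?_⟩
        filter_upwards [eventually_mem_opens hxB] with y' hy'
        split_ifs with h
        · rfl
        · exact hz y' ⟨hy', h⟩
      · refine ⟨⊤, trivial, 0, ?_⟩
        filter_upwards [isOpen_ne.mem_nhds hzx] with y' hy'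
        rw [if_neg hy', map_zero])
  have := hs x trivial
  rw [sec_top_eq_zero hF s, map_zero, if_pos rfl] at this
  exact hne this.symm

/-! ### Constancy on simply connected open sets -/

/-- On a ball inside an open set where F is constant, sections correspond to germs at each point:
the constant sections give all germs, and the identity principle gives uniqueness. So the étale
space is trivial over the ball. -/
theorem isCoveringMapOn_base {F : Sh k ℂ} (hF : IdentityPrinciple F) {K : Set ℂ}
    (hK : ∀ x ∈ K, ∃ U : Opens ℂ, x ∈ U ∧ IsConstantOn F U) :
    IsCoveringMapOn (TopCat.Presheaf.EtaleSpace.base (F := F.presheaf)) K := by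
  intro x hx
  obtain ⟨U₀, hxU₀, hU₀⟩ := hK x hx
  obtain ⟨V, -, τ, hτ⟩ := hU₀
  obtain ⟨δ, hδ, hsub⟩ := exists_ballO_subset (U₀.isOpen.mem_nhds hxU₀)
  have hxB : x ∈ ballO x δ := by simpa [mem_ballO] using hδ
  have hbij : ∀ y (hy : y ∈ ballO x δ), Function.Bijective (F.presheaf.germ (ballO x δ) y hy) := by
    intro y hy
    constructor
    · intro s s' e
      refine sec_ext (A := F) fun z hz => ?_
      refine gat_eq_of_isPreconnected hF (A := Metric.ball x δ) (convex_ball x δ).isPreconnected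
        (fun _ h => h) (fun _ h => h) (a := y) hy ?_ z hz
      rw [gat_of_mem hy]
      exact e
    · intro g
      obtain ⟨v, hv⟩ := (hτ y (hsub hy)).2 g
      refine ⟨resL F hsub (τ v), ?_⟩
      have := gat_resL (A := F) hsub hy (τ v)
      rw [gat_of_mem hy, gat_of_mem (hsub hy)] at this
      exact this.trans hv
  refine .to_isEvenlyCovered_preimage (I := WithDiscreteTopology (ToType (F.presheaf.stalk x))) ?_
  refine ⟨inferInstance, (ballO x δ : Set ℂ), hxB, (ballO x δ).isOpen,
    (ballO x δ).isOpen.preimage (TopCat.Presheaf.EtaleSpace.continuous_base F.presheaf),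
    TopCat.Presheaf.EtaleSpace.homeomorph (ballO x δ) hbij x hxB, fun _ => rfl⟩

theorem exists_sec_of_simplyConnected {F : Sh k ℂ} (hF : IdentityPrinciple F) (K : Opens ℂ)
    [SimplyConnectedSpace K] (hK : ∀ x ∈ K, ∃ U : Opens ℂ, x ∈ U ∧ IsConstantOn F U) {x : ℂ}
    (hx : x ∈ K) (g : stk F x) : ∃ v : sec F K, gat F K x v = g := by
  have cov := (isCoveringMapOn_base hF (K := (K : Set ℂ)) hK).isCoveringMap_restrictPreimage
  have : LocallyPathConnectedSpace K := K.isOpen.locallyPathConnectedSpace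
  -- A lift of the identity of K to the étale space through the germ g is a continuous section,
  -- hence a section of F.
  obtain ⟨σ, ⟨hσ, hσ'⟩, -⟩ := cov.existsUnique_continuousMap_lifts (ContinuousMap.id K)
    (a₀ := ⟨x, hx⟩) (e₀ := ⟨⟨x, g⟩, hx⟩) rfl
  have h1 : ∀ y : K, ∃ γ : stk F y, (σ y).1 = ⟨y, γ⟩ := by
    intro y
    have h2 : (σ y).1.base = y := congrArg Subtype.val (congrFun hσ' y)
    generalize (σ y).1 = e at h2
    obtain ⟨b, γ⟩ := e
    subst h2
    exact ⟨γ, rfl⟩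
  choose γ hγ using h1
  classical
  let g' : ∀ y : ℂ, stk F y := fun y => if h : y ∈ K then γ ⟨y, h⟩ else 0
  have hg' : ∀ y (h : y ∈ K), g' y = γ ⟨y, h⟩ := fun y h => dif_pos h
  obtain ⟨v, hv⟩ := exists_sec_of_germs F K g'
    (fun y hy => by
      have hc : Tendsto (fun a : K => (σ a).1) (𝓝 ⟨y, hy⟩) (𝓝 (σ ⟨y, hy⟩).1) :=
        (continuous_subtype_val.comp σ.continuous).continuousAt
      obtain ⟨U, hU, s, hs⟩ := TopCat.Presheaf.EtaleSpace.exists_section_of_tendsto hc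
      rw [hγ] at hU
      refine ⟨U, hU, s, ?_⟩
      have h3 : ∀ᶠ a : K in 𝓝 ⟨y, hy⟩, gat F U a s = g' a := by
        filter_upwards [hs] with a ha
        rw [hγ a] at ha
        obtain ⟨ha, e⟩ := ha
        rw [hg' a a.2, gat_of_mem (U := U) ha]
        exact e.symm
      exact (eventually_subtype_iff (V := K) ⟨y, hy⟩ _).1 h3)
  refine ⟨v, ?_⟩
  rw [hv x hx, hg' x hx]
  have := hγ ⟨x, hx⟩
  rw [hσ] at this
  simpa using this.symm

end Plane

/-! ### Planar geometry -/

section Geometry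

/-- `Im (x e^{-iθ})` for `u = e^{iθ}`. -/
def imDir (u : Circle) (x : ℂ) : ℝ := (x * (starRingEnd ℂ) (u : ℂ)).im

theorem reDir_eq (u : Circle) (x : ℂ) : reDir u x = x.re * (u : ℂ).re + x.im * (u : ℂ).im := by
  simp [reDir]

theorem imDir_eq (u : Circle) (x : ℂ) : imDir u x = x.im * (u : ℂ).re - x.re * (u : ℂ).im := by
  simp [imDir]; ring

theorem circle_sq (u : Circle) : (u : ℂ).re ^ 2 + (u : ℂ).im ^ 2 = 1 := by
  have h := Circle.normSq_coe u
  rw [Complex.normSq_apply] at h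
  linarith [h]

@[simp] theorem reDir_add (u : Circle) (x y : ℂ) : reDir u (x + y) = reDir u x + reDir u y := by
  simp [reDir_eq]; ring

@[simp] theorem imDir_add (u : Circle) (x y : ℂ) : imDir u (x + y) = imDir u x + imDir u y := by
  simp [imDir_eq]; ring

@[simp] theorem imDir_sub (u : Circle) (x y : ℂ) : imDir u (x - y) = imDir u x - imDir u y := by
  simp [imDir_eq]; ring

@[simp] theorem reDir_smul (u : Circle) (t : ℝ) (x : ℂ) : reDir u (t • x) = t * reDir u x := by
  simp [reDir_eq]; ring

@[simp] theorem imDir_smul (u : Circle) (t : ℝ) (x : ℂ) : imDir u (t • x) = t * imDir u x := by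
  simp [imDir_eq]; ring

@[simp] theorem reDir_self (u : Circle) : reDir u u = 1 := by
  rw [reDir_eq]; nlinarith [circle_sq u]

@[simp] theorem imDir_self (u : Circle) : imDir u u = 0 := by
  rw [imDir_eq]; ring

theorem reDir_I_mul (u : Circle) (x : ℂ) : reDir u (Complex.I * x) = -imDir u x := by
  simp [reDir_eq, imDir_eq]; ring

theorem imDir_I_mul (u : Circle) (x : ℂ) : imDir u (Complex.I * x) = reDir u x := by
  simp [reDir_eq, imDir_eq]

theorem abs_imDir_le_norm (u : Circle) (x : ℂ) : |imDir u x| ≤ ‖x‖ := by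
  refine (Complex.abs_im_le_norm _).trans (le_of_eq ?_)
  rw [norm_mul, RCLike.norm_conj, Circle.norm_coe, mul_one]

theorem eq_of_reDir_imDir {u : Circle} {x y : ℂ} (h : reDir u x = reDir u y)
    (h' : imDir u x = imDir u y) : x = y := by
  have h1 : x * (starRingEnd ℂ) (u : ℂ) = y * (starRingEnd ℂ) (u : ℂ) := Complex.ext h h'
  exact mul_right_cancel₀ (by simp) h1

/-- Decomposition of `reDir u` in the frame given by `φ`. -/
theorem reDir_decomp (u φ : Circle) (x : ℂ) :
    reDir u x = reDir φ x * reDir u φ + imDir φ x * -imDir u φ := by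
  have h := circle_sq φ
  simp only [reDir_eq, imDir_eq]
  linear_combination (-(x.re * (u : ℂ).re) - x.im * (u : ℂ).im) * h

theorem continuous_reDir (u : Circle) : Continuous (reDir u) := by unfold reDir; fun_prop

theorem continuous_imDir (u : Circle) : Continuous (imDir u) := by unfold imDir; fun_prop

theorem continuous_reDir_left (x : ℂ) : Continuous fun u => reDir u x := by unfold reDir; fun_prop

theorem convex_halfPlane (u : Circle) (r : ℝ) : Convex ℝ (halfPlane u r) := by
  intro x hx y hy a b ha hb hab
  simp only [halfPlane, Set.mem_ofPred_eq, reDir_add, reDir_smul] at *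
  rcases eq_or_lt_of_le ha with rfl | ha
  · have : b = 1 := by linarith
    subst this; linarith
  · obtain rfl : b = 1 - a := by linarith
    nlinarith [mul_lt_mul_of_pos_left hx ha, mul_le_mul_of_nonneg_left hy.le hb]

theorem isPreconnected_of_segments {A H : Set ℂ} (hH : IsPreconnected H) (hHA : H ⊆ A)
    (h : ∀ x ∈ A, ∃ y ∈ H, segment ℝ x y ⊆ A) : IsPreconnected A := by
  rcases A.eq_empty_or_nonempty with rfl | ⟨a, ha⟩
  · exact isPreconnected_empty
  obtain ⟨p, hp, -⟩ := h a ha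
  refine isPreconnected_of_forall p fun x hx => ?_
  obtain ⟨y, hy, hxy⟩ := h x hx
  exact ⟨H ∪ segment ℝ x y, Set.union_subset hHA hxy, Or.inl hp, Or.inr (left_mem_segment ℝ x y),
    hH.union y hy (right_mem_segment ℝ x y) (convex_segment x y).isPreconnected⟩

theorem segment_add_smul_subset {A : Set ℂ} {φ : Circle} {x : ℂ} {T : ℝ} (hT : 0 ≤ T)
    (h : ∀ t : ℝ, 0 ≤ t → x + t • (φ : ℂ) ∈ A) : segment ℝ x (x + T • (φ : ℂ)) ⊆ A := by
  rintro _ ⟨a, b, ha, hb, hab, rfl⟩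
  have : a • x + b • (x + T • (φ : ℂ)) = x + (b * T) • (φ : ℂ) := by
    rw [smul_add, ← add_assoc, ← add_smul, hab, one_smul, smul_smul]
  rw [this]
  exact h _ (mul_nonneg hb hT)

/-! ### Cuts and strips -/

/-- The complement of the cuts `{c - t φ : t ≥ 0}`, `c ∈ S`. -/
def cutCompl (S : Finset ℂ) (φ : Circle) : Opens ℂ :=
  ⟨{x | ∀ c ∈ S, imDir φ x = imDir φ c → reDir φ c < reDir φ x}, by
    have : {x | ∀ c ∈ S, imDir φ x = imDir φ c → reDir φ c < reDir φ x} =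
        (⋃ c ∈ S, {x | imDir φ x = imDir φ c} ∩ {x | reDir φ x ≤ reDir φ c})ᶜ := by
      ext x; simp
    rw [this, isOpen_compl_iff]
    refine S.finite_toSet.isClosed_biUnion fun c _ => IsClosed.inter ?_ ?_
    · exact isClosed_eq (continuous_imDir φ) continuous_const
    · exact isClosed_le (continuous_reDir φ) continuous_const⟩

theorem mem_cutCompl {S : Finset ℂ} {φ : Circle} {x : ℂ} :
    x ∈ cutCompl S φ ↔ ∀ c ∈ S, imDir φ x = imDir φ c → reDir φ c < reDir φ x := Iff.rfl

theorem add_smul_mem_cutCompl {S : Finset ℂ} {φ : Circle} {x : ℂ} (hx : x ∈ cutCompl S φ) {t : ℝ}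
    (ht : 0 ≤ t) : x + t • (φ : ℂ) ∈ cutCompl S φ := by
  intro c hc h
  simp only [imDir_add, imDir_smul, imDir_self, mul_zero, add_zero] at h
  have := hx c hc h
  simp only [reDir_add, reDir_smul, reDir_self, mul_one]
  linarith

theorem not_mem_of_mem_cutCompl {S : Finset ℂ} {φ : Circle} {x : ℂ} (hx : x ∈ cutCompl S φ) :
    x ∉ S := fun h => lt_irrefl _ (hx x h rfl)

/-- A half-plane that contains no point of `S` does not meet the cuts. -/
theorem mem_cutCompl_of_forall {S : Finset ℂ} {φ u : Circle} (hu : 0 < reDir u φ) {x : ℂ}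
    (h : ∀ c ∈ S, reDir u c < reDir u x) : x ∈ cutCompl S φ := by
  intro c hc e
  have h1 := h c hc
  rw [reDir_decomp u φ c, reDir_decomp u φ x, e] at h1
  by_contra h2
  nlinarith

/-- The strip of width `2ε` around the line through `c` in the direction `φ`. -/
def strip (φ : Circle) (ε : ℝ) (c : ℂ) : Opens ℂ :=
  ⟨{x | |imDir φ x - imDir φ c| < ε},
    isOpen_lt ((continuous_imDir φ).sub continuous_const).abs continuous_const⟩

theorem mem_strip {φ : Circle} {ε : ℝ} {c x : ℂ} :
    x ∈ strip φ ε c ↔ |imDir φ x - imDir φ c| < ε := Iff.rfl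

/-- The lines through the points of `S` in the direction `φ` have distance at least `2ε`. -/
structure IsFrame (S : Finset ℂ) (φ : Circle) (ε : ℝ) : Prop where
  pos : 0 < ε
  sep : ∀ c ∈ S, ∀ c' ∈ S, c ≠ c' → 2 * ε ≤ |imDir φ c - imDir φ c'|

variable {S : Finset ℂ} {φ : Circle} {ε : ℝ}

theorem IsFrame.eq_of_mem_strip (h : IsFrame S φ ε) {c c' x : ℂ} (hc : c ∈ S) (hc' : c' ∈ S)
    (hx : x ∈ strip φ ε c) (hx' : x ∈ strip φ ε c') : c = c' := by
  by_contra hne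
  have h1 := h.sep c hc c' hc' hne
  rw [mem_strip, abs_lt] at hx hx'
  have : |imDir φ c - imDir φ c'| < 2 * ε := by rw [abs_lt]; constructor <;> linarith
  linarith

theorem ballO_le_strip (φ : Circle) (ε : ℝ) (c : ℂ) : ballO c ε ≤ strip φ ε c := by
  intro x hx
  rw [mem_strip, ← imDir_sub]
  exact (abs_imDir_le_norm _ _).trans_lt (mem_ballO.1 hx)

/-- In the strip around `c`, only the cut at `c` matters. -/
theorem IsFrame.mem_cutCompl_iff (h : IsFrame S φ ε) {c x : ℂ} (hc : c ∈ S)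
    (hx : x ∈ strip φ ε c) :
    x ∈ cutCompl S φ ↔ (imDir φ x = imDir φ c → reDir φ c < reDir φ x) := by
  refine ⟨fun h' => h' c hc, fun h' c' hc' e => ?_⟩
  have : c = c' := h.eq_of_mem_strip hc hc' hx (by rw [mem_strip, e]; simpa using h.pos)
  subst this
  exact h' e

/-- The removed cuts lie in the strips. This is the open cover to which Mayer–Vietoris is applied.
-/
theorem IsFrame.sup_strip_eq_top (h : IsFrame S φ ε) :
    cutCompl S φ ⊔ S.sup (strip φ ε) = ⊤ := by
  refine eq_top_iff.2 fun x _ => ?_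
  by_cases hx : x ∈ cutCompl S φ
  · exact Or.inl hx
  · rw [mem_cutCompl] at hx
    push Not at hx
    obtain ⟨c, hc, e, -⟩ := hx
    have h2 : strip φ ε c ≤ S.sup (strip φ ε) := Finset.le_sup hc
    exact Or.inr (h2 (by rw [mem_strip, e]; simpa using h.pos))

/-- The slit disc is star-shaped about the point c + (δ/2)φ opposite to the slit: a segment from x
to this point meets the line through the slit before its end only if x itself lies on it, ahead of
c. -/
theorem IsFrame.isPreconnected_cutCompl_inter_ball (h : IsFrame S φ ε) {c : ℂ} (hc : c ∈ S) {δ : ℝ}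
    (hδ : 0 < δ) (hδε : δ ≤ ε) :
    IsPreconnected ((cutCompl S φ : Set ℂ) ∩ Metric.ball c δ) := by
  have hb : ∀ x ∈ Metric.ball c δ, x ∈ strip φ ε c := fun x hx =>
    ballO_le_strip φ ε c (Metric.ball_subset_ball hδε hx)
  have hp : c + (δ / 2) • (φ : ℂ) ∈ Metric.ball c δ := by
    rw [Metric.mem_ball, dist_eq_norm, add_sub_cancel_left, norm_smul, Circle.norm_coe,
      Real.norm_of_nonneg (by linarith)]
    linarith
  have hpK : c + (δ / 2) • (φ : ℂ) ∈ cutCompl S φ := by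
    rw [h.mem_cutCompl_iff hc (hb _ hp)]
    intro _
    simp only [reDir_add, reDir_smul, reDir_self]
    linarith
  refine isPreconnected_of_segments (H := {c + (δ / 2) • (φ : ℂ)}) isPreconnected_singleton
    (Set.singleton_subset_iff.2 ⟨hpK, hp⟩) fun x hx => ⟨_, rfl, ?_⟩
  rintro y ⟨a, b, ha, hb', hab, rfl⟩
  have hyb := (convex_ball c δ) hx.2 hp ha hb' hab
  refine ⟨?_, hyb⟩
  refine (h.mem_cutCompl_iff hc (hb _ hyb)).2 fun e => ?_
  have hx' := (h.mem_cutCompl_iff hc (hb _ hx.2)).1 hx.1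
  simp only [imDir_add, imDir_smul, imDir_self, reDir_add, reDir_smul, reDir_self] at e ⊢
  obtain rfl : b = 1 - a := by linarith
  rcases eq_or_lt_of_le ha with rfl | ha
  · linarith
  · have e1 : imDir φ x = imDir φ c := by
      have : a * (imDir φ x - imDir φ c) = 0 := by linarith
      rcases mul_eq_zero.1 this with h | h <;> linarith
    have := hx' e1
    nlinarith [mul_nonneg hb' hδ.le]

/-- The part of the complement of the cuts in a half-plane-like set is connected. -/
theorem isPreconnected_cutCompl_inter {A H : Set ℂ} (hA : ∀ x ∈ A, ∀ t : ℝ, 0 ≤ t → x + t • (φ : ℂ) ∈ A)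
    (hH : IsPreconnected H) (hHA : H ⊆ A) (hHK : H ⊆ cutCompl S φ)
    (h : ∀ x ∈ A, ∃ t : ℝ, 0 ≤ t ∧ x + t • (φ : ℂ) ∈ H) :
    IsPreconnected ((cutCompl S φ : Set ℂ) ∩ A) := by
  refine isPreconnected_of_segments hH (fun x hx => ⟨hHK hx, hHA hx⟩) fun x hx => ?_
  obtain ⟨t, ht, hxt⟩ := h x hx.2
  exact ⟨_, hxt, segment_add_smul_subset ht fun t ht => ⟨add_smul_mem_cutCompl hx.1 ht, hA x hx.2 t ht⟩⟩

theorem exists_add_smul_mem_halfPlane {u φ : Circle} (hu : 0 < reDir u φ) (x : ℂ) (r : ℝ) :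
    ∃ t : ℝ, 0 ≤ t ∧ x + t • (φ : ℂ) ∈ halfPlane u r := by
  refine ⟨max 0 ((r - reDir u x + 1) / reDir u φ), le_max_left _ _, ?_⟩
  simp only [halfPlane, Set.mem_ofPred_eq, reDir_add, reDir_smul]
  have : (r - reDir u x + 1) / reDir u φ * reDir u φ = r - reDir u x + 1 := by field_simp
  have h2 := mul_le_mul_of_nonneg_right (le_max_right 0 ((r - reDir u x + 1) / reDir u φ)) hu.le
  linarith

theorem halfPlane_subset_cutCompl {u φ : Circle} (hu : 0 < reDir u φ) {r : ℝ}
    (hr : ∀ c ∈ S, reDir u c ≤ r) : halfPlane u r ⊆ cutCompl S φ :=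
  fun _ hx => mem_cutCompl_of_forall hu fun c hc => (hr c hc).trans_lt hx

theorem exists_norm_le (S : Finset ℂ) : ∃ R : ℝ, ∀ c ∈ S, ∀ u : Circle, reDir u c ≤ R := by
  obtain ⟨R, hR⟩ := S.finite_toSet.isBounded.exists_norm_le
  exact ⟨R, fun c hc u => (reDir_le_norm u c).trans (hR c hc)⟩

theorem isPreconnected_cutCompl : IsPreconnected (cutCompl S φ : Set ℂ) := by
  obtain ⟨R, hR⟩ := exists_norm_le S
  have := isPreconnected_cutCompl_inter (S := S) (φ := φ) (A := Set.univ) (H := halfPlane φ R)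
    (fun _ _ _ _ => trivial) (convex_halfPlane φ R).isPreconnected (Set.subset_univ _)
    (halfPlane_subset_cutCompl (by simp) fun c hc => hR c hc φ)
    (fun x _ => exists_add_smul_mem_halfPlane (by simp) x R)
  rwa [Set.inter_univ] at this

theorem homotopic_of_segment {K : Set ℂ} (f g : C(K, K))
    (h : ∀ x : K, ∀ t : unitInterval, (1 - (t : ℝ)) • (f x : ℂ) + (t : ℝ) • (g x : ℂ) ∈ K) :
    f.Homotopic g :=
  ⟨{ toFun := fun p => ⟨(1 - (p.1 : ℝ)) • (f p.2 : ℂ) + (p.1 : ℝ) • (g p.2 : ℂ), h p.2 p.1⟩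
     continuous_toFun := by
      refine Continuous.subtype_mk ?_ _
      fun_prop
     map_zero_left := fun x => Subtype.ext (by simp)
     map_one_left := fun x => Subtype.ext (by simp) }⟩

/-- The cuts run in the direction -φ, so moving along +φ never meets them. Push all points along φ
into a half-plane beyond every singularity, and contract this convex set to a point. -/
instance contractibleSpace_cutCompl : ContractibleSpace (cutCompl S φ) := by
  obtain ⟨R, hR⟩ := exists_norm_le S
  have hsub : halfPlane φ R ⊆ cutCompl S φ :=
    halfPlane_subset_cutCompl (by simp) fun c hc => hR c hc φ
  have hpush : ∀ x : ℂ, x + max 0 (R + 1 - reDir φ x) • (φ : ℂ) ∈ halfPlane φ R := by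
    intro x
    simp only [halfPlane, Set.mem_ofPred_eq, reDir_add, reDir_smul, reDir_self]
    have := le_max_right 0 (R + 1 - reDir φ x)
    linarith
  let p : C(cutCompl S φ, cutCompl S φ) :=
    ⟨fun x => ⟨x + max 0 (R + 1 - reDir φ x) • (φ : ℂ), hsub (hpush x)⟩, by
      refine Continuous.subtype_mk ?_ _
      have := continuous_reDir φ
      fun_prop⟩
  let x₀ : cutCompl S φ := ⟨_, hsub (hpush 0)⟩
  have h1 : (ContinuousMap.id (cutCompl S φ)).Homotopic p := by
    refine homotopic_of_segment (K := (cutCompl S φ : Set ℂ)) _ _ fun x t => ?_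
    refine segment_add_smul_subset (le_max_left 0 _)
      (fun t ht => add_smul_mem_cutCompl x.2 ht) ⟨1 - t, t, ?_, t.2.1, by ring, rfl⟩
    linarith [t.2.2]
  have h2 : p.Homotopic (ContinuousMap.const _ x₀) := by
    refine homotopic_of_segment (K := (cutCompl S φ : Set ℂ)) _ _ fun x t => hsub ?_
    exact convex_halfPlane φ R (hpush x) (hpush 0) (by linarith [t.2.2]) t.2.1 (by ring)
  exact (contractible_iff_id_nullhomotopic _).2 ⟨x₀, h1.trans h2⟩

end Geometry

/-! ### Sections on the complement of the cuts -/

section Gluing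

variable {k : Type} [Field k] {X : Type} [TopologicalSpace X]

theorem exists_glue (F : Sh k X) {ι : Type} (U : ι → Opens X) (a : ∀ i, sec F (U i)) (N : Opens X)
    (hN : ∀ x ∈ N, ∃ i, x ∈ U i)
    (h : ∀ i j, ∀ x ∈ U i, x ∈ U j → gat F (U i) x (a i) = gat F (U j) x (a j)) :
    ∃ w : sec F N, ∀ i, ∀ x ∈ N, x ∈ U i → gat F N x w = gat F (U i) x (a i) := by
  classical
  let g : ∀ x, stk F x := fun x =>
    if hx : ∃ i, x ∈ U i then gat F (U hx.choose) x (a hx.choose) else 0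
  have hg : ∀ i, ∀ x ∈ U i, g x = gat F (U i) x (a i) := fun i x hx => by
    have hx' : ∃ i, x ∈ U i := ⟨i, hx⟩
    simp only [g, dif_pos hx']
    exact h _ _ x hx'.choose_spec hx
  obtain ⟨w, hw⟩ := exists_sec_of_germs F N g fun x hx => by
    obtain ⟨i, hi⟩ := hN x hx
    refine ⟨U i, hi, a i, ?_⟩
    filter_upwards [eventually_mem_opens hi] with y hy
    exact (hg i y hy).symm
  exact ⟨w, fun i x hx hi => (hw x hx).trans (hg i x hi)⟩

theorem exists_glue_two (F : Sh k X) {U V : Opens X} (a : sec F U) (b : sec F V)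
    (h : ∀ x ∈ U, x ∈ V → gat F U x a = gat F V x b) :
    ∃ w : sec F (U ⊔ V), (∀ x ∈ U, gat F (U ⊔ V) x w = gat F U x a) ∧
      ∀ x ∈ V, gat F (U ⊔ V) x w = gat F V x b := by
  classical
  let g : ∀ x, stk F x := fun x => if x ∈ U then gat F U x a else gat F V x b
  have hU : ∀ x ∈ U, g x = gat F U x a := fun x hx => if_pos hx
  have hV : ∀ x ∈ V, g x = gat F V x b := fun x hx => by
    by_cases hx' : x ∈ U
    · exact (hU x hx').trans (h x hx' hx)
    · exact if_neg hx'
  obtain ⟨w, hw⟩ := exists_sec_of_germs F (U ⊔ V) g fun x hx => by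
    rcases hx with hx | hx
    · exact ⟨U, hx, a, (eventually_mem_opens hx).mono fun y hy => (hU y hy).symm⟩
    · exact ⟨V, hx, b, (eventually_mem_opens hx).mono fun y hy => (hV y hy).symm⟩
  exact ⟨w, fun x hx => (hw x (Or.inl hx)).trans (hU x hx),
    fun x hx => (hw x (Or.inr hx)).trans (hV x hx)⟩

end Gluing

/-! ### Sections across the cuts and the use of H⁰ = H¹ = 0 -/

section Cuts

variable {k : Type} [Field k] {F : Sh k ℂ} {S : Finset ℂ} {φ : Circle} {ε : ℝ}

/-- Injective by the identity principle on a connected set, surjective by continuation on a simply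
connected set free of singularities. -/
theorem gat_cutCompl_bijective (hS : IsConstructible S F) (hF : IsAcyclic F) {x : ℂ}
    (hx : x ∈ cutCompl S φ) : Function.Bijective (gat F (cutCompl S φ) x) := by
  have hI := identityPrinciple hS hF
  refine ⟨fun v w h => sec_ext ?_, fun g => ?_⟩
  · exact gat_eq_of_isPreconnected hI isPreconnected_cutCompl subset_rfl subset_rfl hx h
  · exact exists_sec_of_simplyConnected hI _
      (fun y hy => hS.1 y (not_mem_of_mem_cutCompl hy)) hx g

variable (F S φ ε) in
/-- The sections on the complement of the cuts that extend over the cut at `c`. -/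
def extendable (c : ℂ) : Submodule k (sec F (cutCompl S φ)) :=
  LinearMap.range (resL F (le_sup_left : cutCompl S φ ≤ cutCompl S φ ⊔ strip φ ε c))

theorem mem_extendable {c : ℂ} {v : sec F (cutCompl S φ)} :
    v ∈ extendable F S φ ε c ↔ ∃ w : sec F (cutCompl S φ ⊔ strip φ ε c),
      ∀ x ∈ cutCompl S φ, gat F _ x w = gat F _ x v := by
  constructor
  · rintro ⟨w, rfl⟩
    exact ⟨w, fun x hx => (gat_resL _ hx w).symm⟩
  · rintro ⟨w, hw⟩
    exact ⟨w, sec_ext fun x hx => (gat_resL _ hx w).trans (hw x hx)⟩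

theorem mem_extendable_of_strip {c : ℂ} {v : sec F (cutCompl S φ)} (b : sec F (strip φ ε c))
    (h : ∀ x ∈ cutCompl S φ, x ∈ strip φ ε c → gat F _ x v = gat F _ x b) :
    v ∈ extendable F S φ ε c := by
  obtain ⟨w, hw, -⟩ := exists_glue_two F v b h
  exact mem_extendable.2 ⟨w, hw⟩

/-- The strips are pairwise disjoint, so the extensions over the single cuts overlap only inside K,
where all of them equal v. -/
theorem exists_of_mem_extendable (hφ : IsFrame S φ ε) {J : Finset ℂ} (hJ : J ⊆ S)
    {v : sec F (cutCompl S φ)} (hv : ∀ c ∈ J, v ∈ extendable F S φ ε c) :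
    ∃ w : sec F (cutCompl S φ ⊔ J.sup (strip φ ε)),
      ∀ x ∈ cutCompl S φ, gat F _ x w = gat F _ x v := by
  -- The index `none` contributes K itself, so that K is covered even if J is empty.
  let U : Option J → Opens ℂ := fun i => i.elim (cutCompl S φ) fun c => cutCompl S φ ⊔ strip φ ε c
  have hU : ∀ i : Option J, ∃ a : sec F (U i), ∀ x ∈ cutCompl S φ, gat F _ x a = gat F _ x v := by
    rintro (_ | c)
    · exact ⟨v, fun _ _ => rfl⟩
    · exact mem_extendable.1 (hv c c.2)
  choose a ha using hU
  obtain ⟨w, hw⟩ := exists_glue F U a (cutCompl S φ ⊔ J.sup (strip φ ε)) (by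
    rintro x (hx | hx)
    · exact ⟨none, hx⟩
    · rw [SetLike.mem_coe, Finset.sup_eq_iSup] at hx
      simp only [Opens.mem_iSup] at hx
      obtain ⟨c, hc, hx⟩ := hx
      exact ⟨some ⟨c, hc⟩, Or.inr hx⟩) (by
    intro i j x hi hj
    by_cases hx : x ∈ cutCompl S φ
    · rw [ha i x hx, ha j x hx]
    · rcases i with _ | c
      · exact absurd hi hx
      rcases j with _ | c'
      · exact absurd hj hx
      have h1 : x ∈ strip φ ε c := hi.resolve_left hx
      have h2 : x ∈ strip φ ε c' := hj.resolve_left hx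
      obtain rfl : c = c' := Subtype.ext (hφ.eq_of_mem_strip (hJ c.2) (hJ c'.2) h1 h2)
      rfl)
  exact ⟨w, fun x hx => (hw none x (Or.inl hx) hx).trans (ha none x hx)⟩

/-- This is H⁰ = 0: a section that extends across every cut extends to the whole plane. -/
theorem eq_zero_of_mem_extendable (hF : IsAcyclic F) (hφ : IsFrame S φ ε)
    {v : sec F (cutCompl S φ)} (hv : ∀ c ∈ S, v ∈ extendable F S φ ε c) : v = 0 := by
  obtain ⟨w, hw⟩ := exists_of_mem_extendable hφ subset_rfl hv
  have hN := hφ.sup_strip_eq_top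
  have hw0 : w = 0 := by
    have h : ∀ (N : Opens ℂ), N = ⊤ → ∀ w : sec F N, w = 0 := by
      rintro _ rfl w
      exact sec_top_eq_zero hF w
    exact h _ hN w
  refine sec_ext fun x hx => ?_
  rw [← hw x hx, hw0, map_zero, map_zero]

/-- This is H¹ = 0. The v c, each on its own strip, form a section on K ∩ (union of strips), which
is a difference a - b with a on K and b on the strips. Then a - v c equals b on the strip of c and
therefore extends. -/
theorem exists_sub_mem_extendable (hF : IsAcyclic F) (hφ : IsFrame S φ ε)
    (v : S → sec F (cutCompl S φ)) :
    ∃ v₀ : sec F (cutCompl S φ), ∀ c : S, v₀ - v c ∈ extendable F S φ ε c := by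
  obtain ⟨σ, hσ⟩ := exists_glue F (fun c : S => cutCompl S φ ⊓ strip φ ε c)
    (fun c => resL F inf_le_left (v c)) (cutCompl S φ ⊓ S.sup (strip φ ε)) (by
      rintro x ⟨hx, hx'⟩
      rw [SetLike.mem_coe, Finset.sup_eq_iSup] at hx'
      simp only [Opens.mem_iSup] at hx'
      obtain ⟨c, hc, hx'⟩ := hx'
      exact ⟨⟨c, hc⟩, hx, hx'⟩) (by
      intro c c' x hc hc'
      obtain rfl : c = c' := Subtype.ext (hφ.eq_of_mem_strip c.2 c'.2 hc.2 hc'.2)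
      rfl)
  obtain ⟨a, b, hab⟩ := exists_sub_of_isAcyclic hF hφ.sup_strip_eq_top σ
  refine ⟨a, fun c => ?_⟩
  have hle : strip φ ε (c : ℂ) ≤ S.sup (strip φ ε) := Finset.le_sup c.2
  refine mem_extendable_of_strip (resL F hle b) fun x hx hx' => ?_
  have hx2 : x ∈ cutCompl S φ ⊓ S.sup (strip φ ε) := ⟨hx, hle hx'⟩
  have e1 := hσ c x hx2 ⟨hx, hx'⟩
  have hxc : x ∈ cutCompl S φ ⊓ strip φ ε (c : ℂ) := ⟨hx, hx'⟩
  have e2 : gat F _ x (resL F inf_le_left (v c) : sec F (cutCompl S φ ⊓ strip φ ε (c : ℂ))) =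
    gat F _ x (v c) := gat_resL _ hxc _
  rw [e2, ← hab, map_sub, gat_resL _ hx2, gat_resL _ hx2] at e1
  rw [gat_resL _ hx', map_sub, ← e1]
  abel

/-- A point near `c`. -/
theorem add_mem_ballO {c : ℂ} {δ a b : ℝ} (h : |a| + |b| < δ) :
    c + (a • (φ : ℂ) + b • (Complex.I * φ)) ∈ ballO c δ := by
  rw [mem_ballO, add_sub_cancel_left]
  refine (norm_add_le _ _).trans_lt ?_
  simpa [norm_smul, Circle.norm_coe] using h

/-- The half-strip behind `c`. -/
def halfStrip (φ : Circle) (ε : ℝ) (c : ℂ) : Opens ℂ :=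
  ⟨{x | |imDir φ x - imDir φ c| < ε} ∩ {x | reDir φ x < reDir φ c},
    (strip φ ε c).isOpen.inter (isOpen_lt (continuous_reDir φ) continuous_const)⟩

theorem convex_halfStrip (φ : Circle) (ε : ℝ) (c : ℂ) : Convex ℝ (halfStrip φ ε c : Set ℂ) := by
  rintro x ⟨hx, hx'⟩ y ⟨hy, hy'⟩ a b ha hb hab
  obtain rfl : b = 1 - a := by linarith
  simp only [Set.mem_ofPred_eq, abs_lt] at *
  have key : ∀ {p q r : ℝ}, p < r → q < r → a * p + (1 - a) * q < r := by
    intro p q r hp hq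
    rcases eq_or_lt_of_le ha with rfl | ha
    · linarith
    · nlinarith [mul_lt_mul_of_pos_left hp ha, mul_le_mul_of_nonneg_left hq.le hb]
  refine ⟨?_, ?_⟩
  · simp only [Set.mem_ofPred_eq, abs_lt, imDir_add, imDir_smul]
    have h1 := key hx.2 hy.2
    have h2 := key (neg_lt.1 hx.1) (neg_lt.1 hy.1)
    constructor <;> linarith
  · simp only [Set.mem_ofPred_eq, reDir_add, reDir_smul]
    exact key hx' hy'

theorem convex_lt_imDir (φ : Circle) (σ r : ℝ) : Convex ℝ {x | r < σ * imDir φ x} := by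
  rintro x hx y hy a b ha hb hab
  obtain rfl : b = 1 - a := by linarith
  simp only [Set.mem_ofPred_eq, imDir_add, imDir_smul] at *
  rcases eq_or_lt_of_le ha with rfl | ha
  · linarith
  · nlinarith [mul_lt_mul_of_pos_left hx ha, mul_le_mul_of_nonneg_left hy.le hb]

/-- Extension over the cut is a condition at its end point c only. Agreement with b at one point
spreads over the slit disc. Behind c, b continues to a section w on the half-strip, which is convex
and contains no singularity, and w agrees with v on both sides of the cut. Gluing v, b and w gives
the extension. -/
theorem mem_extendable_of_ball (hS : IsConstructible S F) (hF : IsAcyclic F) (hφ : IsFrame S φ ε)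
    {c : ℂ} (hc : c ∈ S) {δ : ℝ} (hδ : 0 < δ) (hδε : δ ≤ ε) {v : sec F (cutCompl S φ)}
    (b : sec F (ballO c δ)) {x : ℂ} (hx : x ∈ ballO c δ) (hxK : x ∈ cutCompl S φ)
    (h : gat F _ x v = gat F _ x b) : v ∈ extendable F S φ ε c := by
  have hI := identityPrinciple hS hF
  have hvb : ∀ y ∈ cutCompl S φ, y ∈ ballO c δ → gat F _ y v = gat F _ y b := fun y hy hy' =>
    gat_eq_of_isPreconnected hI (hφ.isPreconnected_cutCompl_inter_ball hc hδ hδε)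
      Set.inter_subset_left Set.inter_subset_right ⟨hxK, hx⟩ h y ⟨hy, hy'⟩
  have hQS : ∀ y ∈ halfStrip φ ε c, y ∉ S := fun y hy hyS => by
    obtain rfl : c = y := hφ.eq_of_mem_strip hc hyS hy.1 (by
      rw [mem_strip, sub_self, abs_zero]; exact hφ.pos)
    exact lt_irrefl (reDir φ c) hy.2
  -- Test points in the ball behind c: σ = 0 lies on the cut and serves as base point for w, while σ
  -- = ±1 lie on its two sides. The offsets δ/3 add up to at most 2δ/3 < δ.
  have hp : ∀ σ : ℝ, |σ| ≤ 1 →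
      c + ((-(δ / 3)) • (φ : ℂ) + (σ * (δ / 3)) • (Complex.I * φ)) ∈ ballO c δ ∧
      c + ((-(δ / 3)) • (φ : ℂ) + (σ * (δ / 3)) • (Complex.I * φ)) ∈ halfStrip φ ε c := by
    intro σ hσ
    have h3 : |σ * (δ / 3)| ≤ δ / 3 := by
      rw [abs_mul, abs_of_pos (by linarith : 0 < δ / 3)]
      nlinarith
    refine ⟨add_mem_ballO ?_, ?_, ?_⟩
    · rw [abs_neg, abs_of_pos (by linarith : 0 < δ / 3)]
      linarith
    · simp only [Set.mem_ofPred_eq, imDir_add, imDir_smul, imDir_self, imDir_I_mul, reDir_self]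
      refine lt_of_le_of_lt (le_of_eq ?_) (lt_of_le_of_lt h3 (by linarith : δ / 3 < ε))
      congr 1; ring
    · simp only [Set.mem_ofPred_eq, reDir_add, reDir_smul, imDir_self, reDir_I_mul, reDir_self]
      linarith
  have : ContractibleSpace (halfStrip φ ε c) :=
    (convex_halfStrip φ ε c).contractibleSpace ⟨_, (hp 0 (by simp)).2⟩
  obtain ⟨w, hw⟩ := exists_sec_of_simplyConnected hI (halfStrip φ ε c)
    (fun y hy => hS.1 y (hQS y hy)) (hp 0 (by simp)).2 (gat F _ _ b)
  have hwb : ∀ y ∈ ballO c δ, y ∈ halfStrip φ ε c → gat F _ y b = gat F _ y w := fun y hy hy' =>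
    gat_eq_of_isPreconnected hI
      ((convex_ball c δ).inter (convex_halfStrip φ ε c)).isPreconnected
      Set.inter_subset_left Set.inter_subset_right ⟨(hp 0 (by simp)).1, (hp 0 (by simp)).2⟩
      hw.symm y ⟨hy, hy'⟩
  -- Each side of the half-strip is convex and misses the cuts, so equality of v and w at the test
  -- point propagates to all of it.
  have hside : ∀ σ : ℝ, |σ| = 1 → ∀ y ∈ halfStrip φ ε c, σ * imDir φ c < σ * imDir φ y →
      gat F _ y v = gat F _ y w := by
    intro σ hσ y hy hy'
    have hsub : (halfStrip φ ε c : Set ℂ) ∩ {x | σ * imDir φ c < σ * imDir φ x} ⊆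
        cutCompl S φ := by
      rintro z ⟨hz, hz'⟩
      refine (hφ.mem_cutCompl_iff hc hz.1).2 fun e => ?_
      simp only [Set.mem_ofPred_eq, e, lt_irrefl] at hz'
    have hq : c + ((-(δ / 3)) • (φ : ℂ) + (σ * (δ / 3)) • (Complex.I * φ)) ∈
        (halfStrip φ ε c : Set ℂ) ∩ {x | σ * imDir φ c < σ * imDir φ x} := by
      refine ⟨(hp σ hσ.le).2, ?_⟩
      simp only [Set.mem_ofPred_eq, imDir_add, imDir_smul, imDir_self, imDir_I_mul, reDir_self]
      have : σ * σ = 1 := by rw [← abs_mul_abs_self, hσ, one_mul]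
      nlinarith
    refine gat_eq_of_isPreconnected hI
      ((convex_halfStrip φ ε c).inter (convex_lt_imDir φ σ _)).isPreconnected hsub
      Set.inter_subset_left hq ?_ y ⟨hy, hy'⟩
    exact (hvb _ (hsub hq) (hp σ hσ.le).1).trans (hwb _ (hp σ hσ.le).1 (hp σ hσ.le).2)
  have hvw : ∀ y ∈ cutCompl S φ, y ∈ halfStrip φ ε c → gat F _ y v = gat F _ y w := by
    intro y hy hy'
    rcases lt_trichotomy (imDir φ y) (imDir φ c) with hlt | heq | hlt
    · exact hside (-1) (by simp) y hy' (by linarith)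
    · exact absurd (hy c hc heq) (not_lt.2 hy'.2.le)
    · exact hside 1 (by simp) y hy' (by linarith)
  obtain ⟨b', hb', hb''⟩ := exists_glue_two F b w hwb
  obtain ⟨v', hv', -⟩ := exists_glue_two F v b' fun y hy hy' => by
    rcases hy' with hy' | hy'
    · exact (hvb y hy hy').trans (hb' y hy').symm
    · exact (hvw y hy hy').trans (hb'' y hy').symm
  have hle : cutCompl S φ ⊔ strip φ ε c ≤
      cutCompl S φ ⊔ (ballO c δ ⊔ halfStrip φ ε c) := by
    refine sup_le le_sup_left fun y hy => ?_
    by_cases hyK : y ∈ cutCompl S φ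
    · exact Or.inl hyK
    refine Or.inr ?_
    rw [hφ.mem_cutCompl_iff hc hy] at hyK
    push Not at hyK
    rcases eq_or_lt_of_le hyK.2 with e | e
    · obtain rfl := eq_of_reDir_imDir e hyK.1
      exact Or.inl (mem_ballO.2 (by simpa using hδ))
    · exact Or.inr ⟨hy, e⟩
  refine mem_extendable.2 ⟨resL F hle v', fun y hy => ?_⟩
  exact (gat_resL hle (Or.inl hy : y ∈ cutCompl S φ ⊔ strip φ ε c) v').trans (hv' y hy)

theorem exists_ball_of_mem_extendable {c : ℂ} {v : sec F (cutCompl S φ)}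
    (hv : v ∈ extendable F S φ ε c) :
    ∃ b : sec F (ballO c ε), ∀ x ∈ cutCompl S φ, x ∈ ballO c ε → gat F _ x b = gat F _ x v := by
  obtain ⟨w, hw⟩ := mem_extendable.1 hv
  have hle : ballO c ε ≤ cutCompl S φ ⊔ strip φ ε c := (ballO_le_strip φ ε c).trans le_sup_right
  exact ⟨resL F hle w, fun x hx hx' => (gat_resL hle hx' w).trans (hw x hx)⟩

end Cuts

/-! ### The sheaf `colim_r R⁰q_{r*} p_r^* F` -/

theorem stalkMap_bijective_of_isIso {k : Type} [Field k] {Y : Type} [TopologicalSpace Y]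
    {A B : Sh k Y} (f : A ⟶ B) [IsIso f] (y : Y) : Function.Bijective (stalkMap f y) := by
  refine Function.bijective_iff_has_inverse.2 ⟨stalkMap (inv f) y, fun x => ?_, fun x => ?_⟩
  · rw [← stalkMap_comp, IsIso.hom_inv_id, stalkMap_id]
  · rw [← stalkMap_comp, IsIso.inv_hom_id, stalkMap_id]

theorem LocSec.eventually_eq {k : Type} [Field k] {T X : Type} [TopologicalSpace T]
    [TopologicalSpace X] {F : Sh k X} {f : T → X} (hf : Continuous f) {A : Set T}
    {s s' : ∀ w, stk F (f w)} (hs : LocSec F f A s) (hs' : LocSec F f A s') {w : T} (hw : w ∈ A)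
    (h : s w = s' w) : ∀ᶠ w' in 𝓝[A] w, s w' = s' w' := by
  obtain ⟨N, hN, t, ht⟩ := hs w hw
  obtain ⟨N', hN', t', ht'⟩ := hs' w hw
  have e : gat F N (f w) t = gat F N' (f w) t' := by
    rw [← ht.self_of_nhdsWithin hw, ← ht'.self_of_nhdsWithin hw, h]
  have := (hf.tendsto w).mono_left (nhdsWithin_le_nhds (s := A))
  filter_upwards [ht, ht', this.eventually (eventually_gat_eq hN hN' e)] with w' h1 h2 h3
  rw [h1, h2, h3]

section Far

/-- `⋃_y 𝓗_{d(y),r} × {y} ⊆ ℂ × Y`. -/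
def incD {Y : Type} (d : Y → Circle) (r : ℝ) : Set (ℂ × Y) := {w | w.1 ∈ halfPlane (d w.2) r}

theorem mem_incD {Y : Type} {d : Y → Circle} {r : ℝ} {x : ℂ} {y : Y} :
    (x, y) ∈ incD d r ↔ r < reDir (d y) x := Iff.rfl

theorem antitone_incD {Y : Type} (d : Y → Circle) : Antitone (incD d) := fun _ _ h _ hw => lt_of_le_of_lt h hw

variable {k : Type} [Field k] {Y : Type} [TopologicalSpace Y]

variable (d : Y → Circle) (F : Sh k ℂ)

/-- The sheaf `colim_r R⁰q_{r*} p_r^* F`. -/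
abbrev farSheaf : Sh k Y := (colimPullPush k (incD d) (antitone_incD d)).obj F

/-- The map to the colimit. -/
def toFar (r : ℝ) : pp (incD d r) F ⟶ farSheaf d F := (toColim k (incD d) (antitone_incD d) r).app F

variable {d F}

theorem stalkMap_toFar_of_le {r r' : ℝ} (h : r ≤ r') (y : Y) (x : stk (pp (incD d r) F) y) :
    stalkMap (toFar d F r') y
      (stalkMap ((pullPushRes (k := k) (antitone_incD d h)).app F) y x) =
      stalkMap (toFar d F r) y x := by
  have := congrArg (fun f => f.app F) (toColim_comp (k := k) (incD d) (antitone_incD d) h)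
  rw [← stalkMap_comp]
  exact congrArg (fun f => stalkMap f y x) this

/-- Germs with the same values on far half-planes have the same image. -/
theorem stalkMap_toFar_eq {r r' : ℝ} (h : r ≤ r') {y : Y} {V V' : Opens Y} (hy : y ∈ V)
    (hy' : y ∈ V') {s : sec (pp (incD d r) F) V} {s' : sec (pp (incD d r') F) V'}
    (e : ∀ᶠ y' in 𝓝 y, ∀ x, (x, y') ∈ incD d r' →
      ppVal (incD d r) F V (x, y') s = ppVal (incD d r') F V' (x, y') s') :
    stalkMap (toFar d F r) y (gat _ V y s) = stalkMap (toFar d F r') y (gat _ V' y s') := by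
  rw [← stalkMap_toFar_of_le h, stalkMap_gat]
  congr 1
  refine gat_eq_of_ppVal_eq hy hy' ?_
  filter_upwards [e, eventually_mem_opens hy] with y' e hy x hx
  rw [ppVal_res (antitone_incD d h) ⟨hx, hy⟩, e x hx]

variable {S : Finset ℂ} {φ : Circle} {R : ℝ} {V : Opens Y}

theorem mem_cutCompl_of_mem_incD (hR : ∀ c ∈ S, ∀ u : Circle, reDir u c ≤ R)
    (hV : ∀ y ∈ V, 0 < reDir (d y) φ) {r : ℝ} (hr : R ≤ r) :
    ∀ w ∈ part (incD d r) V, w.1 ∈ cutCompl S φ := fun w hw =>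
  halfPlane_subset_cutCompl (hV w.2 hw.2) (fun c hc => (hR c hc _).trans hr) hw.1

/-- Two families of germs on `Z` that agree at a point of the fibre over `y` agree over a
neighbourhood of `y`, if the fibres are connected and the point moves continuously. -/
theorem eventually_eq_on_fibres {Z : Set (ℂ × Y)} (hI : IdentityPrinciple F)
    {s s' : ∀ w : ℂ × Y, stk F w.1} (hs : LocSec F Prod.fst (part Z V) s)
    (hs' : LocSec F Prod.fst (part Z V) s')
    (hZ : ∀ y ∈ V, IsPreconnected {x | (x, y) ∈ Z}) {p : Y → ℂ} (hp : Continuous p)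
    (hpZ : ∀ y ∈ V, (p y, y) ∈ Z) {y : Y} (hy : y ∈ V) (h : s (p y, y) = s' (p y, y)) :
    ∀ᶠ y' in 𝓝 y, ∀ x, (x, y') ∈ Z → s (x, y') = s' (x, y') := by
  have h1 := hs.eventually_eq continuous_fst hs' (w := (p y, y)) ⟨hpZ y hy, hy⟩ h
  have h2 : Tendsto (fun y' => (p y', y')) (𝓝 y) (𝓝[part Z V] (p y, y)) := by
    refine tendsto_nhdsWithin_iff.2 ⟨(hp.prodMk continuous_id).tendsto y, ?_⟩
    exact (eventually_mem_opens hy).mono fun y' hy' => ⟨hpZ y' hy', hy'⟩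
  filter_upwards [h2.eventually h1, eventually_mem_opens hy] with y' e hy' x hx
  have hA : IsPreconnected ((fun x => (x, y')) '' {x | (x, y') ∈ Z}) :=
    (hZ y' hy').image _ (Continuous.continuousOn (by fun_prop))
  have hsub : (fun x => (x, y')) '' {x | (x, y') ∈ Z} ⊆ part Z V := by
    rintro _ ⟨x, hx, rfl⟩
    exact ⟨hx, hy'⟩
  exact (hs.mono hsub).eqOn_of_isPreconnected hI continuous_fst hA (hs'.mono hsub)
    ⟨_, hpZ y' hy', rfl⟩ e _ ⟨x, hx, rfl⟩

theorem smul_mem_incD {Y : Type} (d : Y → Circle) (r : ℝ) (y : Y) : ((r + 1) • (d y : ℂ), y) ∈ incD d r := by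
  rw [mem_incD, reDir_smul, reDir_self]
  linarith

/-- The point (r + 1) d(y) moves continuously inside the half-planes. A germ at y is determined by
its value at this point, since the fibres are convex, and every such value is the germ of a section
on K. -/
theorem pullSec_bijective (hS : IsConstructible S F) (hF : IsAcyclic F) (hd : Continuous d)
    {r : ℝ} (hsub : ∀ w ∈ part (incD d r) V, w.1 ∈ cutCompl S φ)
    {y : Y} (hy : y ∈ V) :
    Function.Bijective (gat (pp (incD d r) F) V y ∘ₗ pullSec (k := k) (F := F) hsub) := by
  have hI := identityPrinciple hS hF
  have hp : Continuous fun y => (r + 1) • (d y : ℂ) := by fun_prop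
  have hxK : ∀ {y}, y ∈ V → (r + 1) • (d y : ℂ) ∈ cutCompl S φ := fun {y} hy =>
    hsub (_, y) ⟨smul_mem_incD d r y, hy⟩
  refine ⟨fun v v' h => ?_, fun g => ?_⟩
  · have h1 := (ppVal_eq_of_gat_eq hy hy h).self_of_nhds ((r + 1) • (d y : ℂ))
    rw [ppVal_pullSec hsub ⟨smul_mem_incD d r y, hy⟩,
      ppVal_pullSec hsub ⟨smul_mem_incD d r y, hy⟩] at h1
    exact (gat_cutCompl_bijective hS hF (hxK hy)).1 h1
  · obtain ⟨V', hV', s, rfl⟩ := exists_gat_eq _ g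
    obtain ⟨v, hv⟩ := (gat_cutCompl_bijective hS hF (hxK hy)).2
      (ppVal (incD d r) F V' ((r + 1) • (d y : ℂ), y) s)
    refine ⟨v, gat_eq_of_ppVal_eq hy hV' ?_⟩
    have hm : part (incD d r) (V ⊓ V') ⊆ part (incD d r) V := fun w hw => ⟨hw.1, hw.2.1⟩
    have hm' : part (incD d r) (V ⊓ V') ⊆ part (incD d r) V' := fun w hw => ⟨hw.1, hw.2.2⟩
    refine eventually_eq_on_fibres (V := V ⊓ V') hI ((locSec_ppVal _).mono hm)
      ((locSec_ppVal _).mono hm') (fun y _ => (convex_halfPlane (d y) r).isPreconnected) hp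
      (fun y _ => smul_mem_incD d r y) ⟨hy, hV'⟩ ?_
    rw [ppVal_pullSec hsub ⟨smul_mem_incD d r y, hy⟩]
    exact hv

/-- The points whose direction is at an angle less than `π / 2` to `φ`. -/
def dirChart (hd : Continuous d) (φ : Circle) : Opens Y :=
  ⟨{y | 0 < reDir (d y) φ}, isOpen_lt continuous_const ((continuous_reDir_left _).comp hd)⟩

/-- Once r exceeds all Re(c e^{-iθ}), every stage of the direct system has stalk F(K) and the
transition maps are the identity there; the system is constant from r on. -/
theorem isIso_toFar (hS : IsConstructible S F) (hF : IsAcyclic F) (hd : Continuous d)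
    (hR : ∀ c ∈ S, ∀ u : Circle, reDir u c ≤ R) {r : ℝ} (hr : R ≤ r) : IsIso (toFar d F r) := by
  let D := (pullPushDiagram k (incD d) (antitone_incD d)).flip.obj F
  have hD : D.IsEventuallyConstantFrom r := by
    intro r' f
    refine isIso_of_stalkMap_bijective (A := pp (incD d r) F) (B := pp (incD d r') F) _ fun y => ?_
    let V : Opens Y := dirChart hd (d y)
    have hV : ∀ y' ∈ V, 0 < reDir (d y') (d y) := fun _ h => h
    have hy : y ∈ V := by
      change 0 < reDir (d y) (d y)
      simp
    have hsub := mem_cutCompl_of_mem_incD hR hV hr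
    have hsub' := mem_cutCompl_of_mem_incD hR hV (hr.trans f.le)
    have b := pullSec_bijective hS hF hd hsub hy
    have b' := pullSec_bijective hS hF hd hsub' hy
    have e : ∀ v, stalkMap ((pullPushRes (k := k) (antitone_incD d f.le)).app F) y
        (gat _ V y (pullSec (F := F) hsub v)) = gat _ V y (pullSec (F := F) hsub' v) := by
      intro v
      rw [stalkMap_gat]
      refine congrArg _ (pp_ext fun w hw => ?_)
      rw [ppVal_res (antitone_incD d f.le) hw, ppVal_pullSec hsub' hw,
        ppVal_pullSec hsub ⟨antitone_incD d f.le hw.1, hw.2⟩]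
    constructor
    · intro a a' h
      obtain ⟨v, rfl⟩ := b.2 a
      obtain ⟨v', rfl⟩ := b.2 a'
      exact congrArg _ (b'.1 ((e v).symm.trans (Eq.trans h (e v'))))
    · intro a
      obtain ⟨v, rfl⟩ := b'.2 a
      exact ⟨_, e v⟩
  exact hD.isIso_ι_of_isColimit (Limits.colimit.isColimit D)

end Far

/-! ### Existence of frames -/

section Frames

theorem exists_circle_coe_eq {w : ℂ} (h : ‖w‖ = 1) : ∃ a : Circle, (a : ℂ) = w :=
  ⟨⟨w, mem_sphere_zero_iff_norm.2 h⟩, rfl⟩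

theorem eventually_cos_add_sin_ne_zero {a b : ℝ} (h : a ≠ 0 ∨ b ≠ 0) :
    ∀ᶠ t in 𝓝[>] (0 : ℝ), a * Real.cos t + b * Real.sin t ≠ 0 := by
  by_cases ha : a = 0
  · subst ha
    have hb : b ≠ 0 := h.resolve_left (by simp)
    filter_upwards [Ioo_mem_nhdsGT Real.pi_pos] with t ht
    simpa using ⟨hb, (Real.sin_pos_of_pos_of_lt_pi ht.1 ht.2).ne'⟩
  · have hc : ContinuousAt (fun t => a * Real.cos t + b * Real.sin t) 0 := by fun_prop
    exact nhdsWithin_le_nhds (hc.eventually_ne (by simpa using ha))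

/-- Each difference excludes only finitely many directions; it suffices to look at small positive
angles. Both coordinates must separate S because the direction is afterwards turned by multiples of
a right angle. -/
theorem exists_generic_direction (S : Finset ℂ) : ∃ φ : Circle, ∀ c ∈ S, ∀ c' ∈ S, c ≠ c' →
    imDir φ (c - c') ≠ 0 ∧ reDir φ (c - c') ≠ 0 := by
  have h : ∀ᶠ t in 𝓝[>] (0 : ℝ), ∀ c ∈ S, ∀ c' ∈ S, c ≠ c' →
      imDir (Circle.exp t) (c - c') ≠ 0 ∧ reDir (Circle.exp t) (c - c') ≠ 0 := by
    simp only [← Finset.mem_coe]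
    rw [S.finite_toSet.eventually_all]
    intro c _
    rw [S.finite_toSet.eventually_all]
    intro c' _
    by_cases hcc : c = c'
    · exact Eventually.of_forall fun t h => absurd hcc h
    have hx : (c - c').re ≠ 0 ∨ (c - c').im ≠ 0 := by
      by_contra hx
      push Not at hx
      exact sub_ne_zero.2 hcc (Complex.ext hx.1 hx.2)
    filter_upwards [eventually_cos_add_sin_ne_zero (b := -(c - c').re)
      (hx.symm.imp_right neg_ne_zero.2), eventually_cos_add_sin_ne_zero hx] with t h1 h2 _
    rw [imDir_eq, reDir_eq, Circle.coe_exp, Complex.exp_ofReal_mul_I_re,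
      Complex.exp_ofReal_mul_I_im]
    exact ⟨fun e => h1 (by linarith), h2⟩
  obtain ⟨t, ht⟩ := h.exists
  exact ⟨Circle.exp t, ht⟩

/-- There is a width for which every direction has a frame in the same open half-plane. -/
theorem exists_isFrame (S : Finset ℂ) :
    ∃ ε : ℝ, ∀ u : Circle, ∃ φ : Circle, 0 < reDir u φ ∧ IsFrame S φ ε := by
  obtain ⟨φ₀, h₀⟩ := exists_generic_direction S
  have h : ∀ᶠ ε in 𝓝[>] (0 : ℝ), ∀ c ∈ S, ∀ c' ∈ S, c ≠ c' →
      2 * ε ≤ |imDir φ₀ (c - c')| ∧ 2 * ε ≤ |reDir φ₀ (c - c')| := by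
    simp only [← Finset.mem_coe]
    rw [S.finite_toSet.eventually_all]
    intro c hc
    rw [S.finite_toSet.eventually_all]
    intro c' hc'
    by_cases hcc : c = c'
    · exact Eventually.of_forall fun t h => absurd hcc h
    have h1 := h₀ c hc c' hc' hcc
    filter_upwards [Ioo_mem_nhdsGT (half_pos (abs_pos.2 h1.1)),
      Ioo_mem_nhdsGT (half_pos (abs_pos.2 h1.2))] with ε e1 e2 _
    exact ⟨by linarith [e1.2], by linarith [e2.2]⟩
  obtain ⟨ε, hε, hpos⟩ := (h.and self_mem_nhdsWithin).exists
  refine ⟨ε, fun u => ?_⟩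
  -- The factor w is one of ±1, ±i, and multiplication by it permutes the two coordinates up to
  -- sign. So one ε works for the four directions ±φ₀, ±iφ₀, and one of these lies in the open
  -- half-plane of any given u.
  have key : ∀ w : ℂ, ‖w‖ = 1 → (w.re = 0 ∨ w.im = 0) → ∀ x : ℂ, ∀ a : Circle, (a : ℂ) = w * φ₀ →
      |imDir a x| = |imDir φ₀ x| ∨ |imDir a x| = |reDir φ₀ x| := by
    intro w hw hw0 x a ha
    have h1 : w.re * w.re + w.im * w.im = 1 := by
      rw [← Complex.normSq_apply, Complex.normSq_eq_norm_sq, hw, one_pow]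
    have h2 : imDir a x = w.re * imDir φ₀ x - w.im * reDir φ₀ x := by
      simp only [imDir_eq, reDir_eq, ha, Complex.mul_re, Complex.mul_im]
      ring
    rcases hw0 with h0 | h0
    · right
      have h3 : |w.im| = 1 := by
        rw [h0] at h1
        have : |w.im| * |w.im| = 1 := by rw [abs_mul_abs_self]; linarith
        nlinarith [abs_nonneg w.im]
      rw [h2, h0, zero_mul, zero_sub, abs_neg, abs_mul, h3, one_mul]
    · left
      have h3 : |w.re| = 1 := by
        rw [h0] at h1
        have : |w.re| * |w.re| = 1 := by rw [abs_mul_abs_self]; linarith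
        nlinarith [abs_nonneg w.re]
      rw [h2, h0, zero_mul, sub_zero, abs_mul, h3, one_mul]
  have main : ∀ w : ℂ, ‖w‖ = 1 → (w.re = 0 ∨ w.im = 0) → 0 < reDir u (w * φ₀) →
      ∃ φ : Circle, 0 < reDir u φ ∧ IsFrame S φ ε := by
    intro w hw hw0 hu
    obtain ⟨a, ha⟩ := exists_circle_coe_eq (w := w * φ₀) (by simp [hw, Circle.norm_coe])
    refine ⟨a, by rwa [ha], hpos, fun c hc c' hc' hcc => ?_⟩
    rw [← imDir_sub]
    rcases key w hw hw0 (c - c') a ha with e | e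
    · rw [e]; exact (hε c hc c' hc' hcc).1
    · rw [e]; exact (hε c hc c' hc' hcc).2
  have hdec := reDir_decomp u φ₀ u
  rw [reDir_self] at hdec
  rcases lt_trichotomy (reDir u φ₀) 0 with h1 | h1 | h1
  · refine main (-1) (by simp) (by simp) ?_
    have : reDir u (-1 * φ₀) = -reDir u φ₀ := by simp [reDir_eq]; ring
    linarith
  · rcases lt_trichotomy (imDir u φ₀) 0 with h2 | h2 | h2
    · refine main Complex.I (by simp) (by simp) ?_
      rw [reDir_I_mul]; linarith
    · rw [h1, h2] at hdec; simp at hdec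
    · refine main (-Complex.I) (by simp) (by simp) ?_
      have : reDir u (-Complex.I * φ₀) = imDir u φ₀ := by simp [reDir_eq, imDir_eq]; ring
      linarith
  · exact main 1 (by simp) (by simp) (by simpa using h1)

end Frames

/-! ### Sections of `colim_r R⁰q_{r*} p_r^* F` from sections on the complement of the cuts -/

/-- A bound for `Re (c e^{-iθ})`, `c ∈ S`. -/
def bound (S : Finset ℂ) : ℝ := (exists_norm_le S).choose

theorem reDir_le_bound {S : Finset ℂ} : ∀ c ∈ S, ∀ u : Circle, reDir u c ≤ bound S :=
  (exists_norm_le S).choose_spec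

section FarSec

variable {k : Type} [Field k] {Y : Type} [TopologicalSpace Y] {d : Y → Circle}
  {F : Sh k ℂ} {S : Finset ℂ} {φ : Circle}

theorem dirChart_sub (hd : Continuous d) (φ : Circle) {r : ℝ} (hr : bound S ≤ r) :
    ∀ w ∈ part (incD d r) (dirChart hd φ), w.1 ∈ cutCompl S φ :=
  mem_cutCompl_of_mem_incD reDir_le_bound (fun _ h => h) hr

variable (F S) in
/-- The section of `colim_r R⁰q_{r*} p_r^* F` given by a section of `F` on the complement of the
cuts. -/
def farSec (hd : Continuous d) (φ : Circle) :
    sec F (cutCompl S φ) →ₗ[k] sec (farSheaf d F) (dirChart hd φ) :=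
  secMap (toFar d F (bound S)) _ ∘ₗ pullSec (dirChart_sub hd φ le_rfl)

theorem gat_farSec (hd : Continuous d) {y : Y} (hy : y ∈ dirChart hd φ) {r : ℝ} (hr : bound S ≤ r)
    (v : sec F (cutCompl S φ)) {V : Opens Y} (hV : y ∈ V) (t : sec (pp (incD d r) F) V)
    (h : ∀ᶠ y' in 𝓝 y, ∀ x, (x, y') ∈ incD d r → ppVal _ F V (x, y') t = gat F _ x v) :
    gat _ _ y (farSec F S hd φ v) = stalkMap (toFar d F r) y (gat _ V y t) := by
  refine (stalkMap_gat (toFar d F (bound S)) _ y _).symm.trans (stalkMap_toFar_eq hr hy hV ?_)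
  filter_upwards [h, eventually_mem_opens hy] with y' e hy' x hx
  rw [e x hx]
  exact ppVal_pullSec (dirChart_sub hd φ le_rfl) ⟨antitone_incD d hr hx, hy'⟩ v

/-- The basic trivialisation: on the chart of φ the far sheaf is constant with fibre F(K). -/
theorem farSec_bijective (hS : IsConstructible S F) (hF : IsAcyclic F) (hd : Continuous d) {y : Y}
    (hy : y ∈ dirChart hd φ) : Function.Bijective (gat _ _ y ∘ₗ farSec F S hd φ) := by
  have h1 := pullSec_bijective hS hF hd (dirChart_sub hd φ le_rfl) hy
  have := isIso_toFar hS hF hd reDir_le_bound (le_refl (bound S))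
  have h2 := (stalkMap_bijective_of_isIso (toFar d F (bound S)) y).comp h1
  convert h2 using 1
  funext v
  exact (stalkMap_gat (toFar d F (bound S)) _ y _).symm

theorem ppVal_eq_of_gat_farSec (hS : IsConstructible S F) (hF : IsAcyclic F) (hd : Continuous d)
    {y : Y} (hy : y ∈ dirChart hd φ) {r : ℝ} (hr : bound S ≤ r) {v : sec F (cutCompl S φ)}
    {V : Opens Y} (hV : y ∈ V) {t : sec (pp (incD d r) F) V}
    (h : stalkMap (toFar d F r) y (gat _ V y t) = gat _ _ y (farSec F S hd φ v)) :
    ∀ᶠ y' in 𝓝 y, ∀ x, (x, y') ∈ incD d r → ppVal _ F V (x, y') t = gat F _ x v := by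
  have := isIso_toFar hS hF hd reDir_le_bound hr
  rw [gat_farSec hd hy hr v hy (pullSec (dirChart_sub hd φ hr) v) (by
    filter_upwards [eventually_mem_opens hy] with y' hy' x hx
    exact ppVal_pullSec (dirChart_sub hd φ hr) ⟨hx, hy'⟩ v)] at h
  have h1 := (stalkMap_bijective_of_isIso (toFar d F r) y).1 h
  filter_upwards [ppVal_eq_of_gat_eq hV hy h1, eventually_mem_opens hy] with y' e hy' x hx
  rw [e x]
  exact ppVal_pullSec (dirChart_sub hd φ hr) ⟨hx, hy'⟩ v

theorem self_mem_dirChart (hd : Continuous d) (y : Y) : y ∈ dirChart hd (d y) := by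
  change 0 < reDir (d y) (d y)
  rw [reDir_self]
  exact one_pos

theorem finite_sec_cutCompl (hS : IsConstructible S F) (hF : IsAcyclic F) (φ : Circle) :
    Module.Finite k (sec F (cutCompl S φ)) := by
  have hx : (bound S + 1) • (φ : ℂ) ∈ cutCompl S φ :=
    halfPlane_subset_cutCompl (u := φ) (by simp) (fun c hc => reDir_le_bound c hc φ)
      (smul_mem_incD id (bound S) φ)
  have := hS.2 ((bound S + 1) • (φ : ℂ))
  exact Module.Finite.equiv (LinearEquiv.ofBijective _ (gat_cutCompl_bijective hS hF hx)).symm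

theorem isLocalSystem_farSheaf (hS : IsConstructible S F) (hF : IsAcyclic F) (hd : Continuous d) :
    IsLocalSystem (farSheaf d F) := fun y =>
  ⟨dirChart hd (d y), self_mem_dirChart hd y, sec F (cutCompl S (d y)),
    finite_sec_cutCompl hS hF (d y), farSec F S hd (d y), fun y' hy' => by
      rw [← gat_of_mem hy']
      exact farSec_bijective hS hF hd hy'⟩

end FarSec

/-! ### The subsheaf of sections on half-planes -/

section Threshold

variable {k : Type} [Field k] {Y : Type} [TopologicalSpace Y] {d : Y → Circle}
  {F : Sh k ℂ} {S : Finset ℂ} {φ : Circle} {ε : ℝ} {ρ : Y → ℝ} {Z : Set (ℂ × Y)}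

/-- The fibre of `Z` over `y` is an open or closed half-plane in the direction `d y` bounded by
the line `Re (x e^{-iθ}) = ρ y`. -/
structure IsThreshold (d : Y → Circle) (ρ : Y → ℝ) (Z : Set (ℂ × Y)) : Prop where
  cont : Continuous ρ
  le : ∀ x y, (x, y) ∈ Z → ρ y ≤ reDir (d y) x
  mem : ∀ x y, ρ y < reDir (d y) x → (x, y) ∈ Z
  up : ∀ x x' y, (x, y) ∈ Z → reDir (d y) x ≤ reDir (d y) x' → (x', y) ∈ Z
  freq : ∀ x y, ρ y ≤ reDir (d y) x → ∃ᶠ y' in 𝓝 y, (x, y') ∈ Z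

/-- The map `i` is given by restriction of sections to far half-planes. -/
def IsFarRes (i : pp Z F ⟶ farSheaf d F) : Prop :=
  ∀ (y : Y) (r : ℝ) (V V' : Opens Y) (s : sec (pp Z F) V) (t : sec (pp (incD d r) F) V'),
    y ∈ V → y ∈ V' → (∀ᶠ y' in 𝓝 y, ∀ x, (x, y') ∈ incD d r →
      (x, y') ∈ Z ∧ ppVal Z F V (x, y') s = ppVal _ F V' (x, y') t) →
    stalkMap i y (gat _ V y s) = stalkMap (toFar d F r) y (gat _ V' y t)

theorem IsThreshold.isPreconnected_fibre (hZ : IsThreshold d ρ Z) (S : Finset ℂ) {y : Y}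
    (hy : 0 < reDir (d y) φ) :
    IsPreconnected ((cutCompl S φ : Set ℂ) ∩ {x | (x, y) ∈ Z}) := by
  refine isPreconnected_cutCompl_inter (H := halfPlane (d y) (max (bound S) (ρ y)))
    (fun x hx t ht => hZ.up _ _ _ hx ?_) (convex_halfPlane _ _).isPreconnected
    (fun x hx => hZ.mem _ _ ((le_max_right _ _).trans_lt hx))
    (halfPlane_subset_cutCompl hy fun c hc => (reDir_le_bound c hc _).trans (le_max_left _ _))
    (fun x _ => exists_add_smul_mem_halfPlane hy x _)
  rw [reDir_add, reDir_smul]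
  nlinarith

theorem locSec_fibre {V : Opens Y} (s : sec (pp Z F) V) {y : Y} (hy : y ∈ V) :
    LocSec F id {x | (x, y) ∈ Z} (fun x => ppVal Z F V (x, y) s) := by
  intro x hx
  obtain ⟨N, hN, t, ht⟩ := locSec_ppVal s (x, y) ⟨hx, hy⟩
  refine ⟨N, hN, t, ?_⟩
  have : Tendsto (fun x' => (x', y)) (𝓝[{x | (x, y) ∈ Z}] x) (𝓝[part Z V] (x, y)) := by
    refine tendsto_nhdsWithin_iff.2 ⟨?_, ?_⟩
    · exact (Continuous.tendsto (by fun_prop) x).mono_left nhdsWithin_le_nhds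
    · filter_upwards [self_mem_nhdsWithin] with x' hx'
      exact ⟨hx', hy⟩
  exact this.eventually ht

/-- Since ρ is continuous, a fixed r above ρ y bounds ρ near y, so the half-planes with bound r lie
in Z there and the section restricts to them. -/
theorem IsThreshold.exists_res (hZ : IsThreshold d ρ Z) (S : Finset ℂ) {V : Opens Y} {y : Y}
    (hy : y ∈ V) (s : sec (pp Z F) V) : ∃ r : ℝ, bound S ≤ r ∧ ∃ V' : Opens Y, y ∈ V' ∧
      ∃ t : sec (pp (incD d r) F) V', ∀ᶠ y' in 𝓝 y, ∀ x, (x, y') ∈ incD d r →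
        (x, y') ∈ Z ∧ ppVal Z F V (x, y') s = ppVal _ F V' (x, y') t := by
  set r := max (bound S) (ρ y + 1)
  let V' : Opens Y := V ⊓ ⟨{y' | ρ y' < r}, isOpen_lt hZ.cont continuous_const⟩
  have hV' : y ∈ V' := ⟨hy, show ρ y < r from lt_of_lt_of_le (lt_add_one _) (le_max_right _ _)⟩
  have hsub : part (incD d r) V' ⊆ part Z V := fun w hw =>
    ⟨hZ.mem _ _ (lt_trans hw.2.2 hw.1), hw.2.1⟩
  obtain ⟨t, ht⟩ := exists_pp ((locSec_ppVal s).mono hsub)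
  refine ⟨r, le_max_left _ _, V', hV', t, ?_⟩
  filter_upwards [eventually_mem_opens hV'] with y' hy' x hx
  exact ⟨(hsub ⟨hx, hy'⟩).1, (ht _ ⟨hx, hy'⟩).symm⟩

/-- Equality holds far out by the description of the far sheaf, and it spreads over each fibre minus
the cuts, which is connected because every point can be moved along φ. -/
theorem IsThreshold.ppVal_eq (hS : IsConstructible S F) (hF : IsAcyclic F) (hd : Continuous d)
    (hZ : IsThreshold d ρ Z) {i : pp Z F ⟶ farSheaf d F} (hi : IsFarRes i) {y : Y}
    (hy : y ∈ dirChart hd φ) {V : Opens Y} (hV : y ∈ V) {s : sec (pp Z F) V}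
    {v : sec F (cutCompl S φ)} (h : stalkMap i y (gat _ V y s) = gat _ _ y (farSec F S hd φ v)) :
    ∀ᶠ y' in 𝓝 y, ∀ x, (x, y') ∈ Z → x ∈ cutCompl S φ →
      ppVal Z F V (x, y') s = gat F _ x v := by
  obtain ⟨r, hr, V', hV', t, ht⟩ := hZ.exists_res S hV s
  rw [hi y r V V' s t hV hV' ht] at h
  filter_upwards [ht, ppVal_eq_of_gat_farSec hS hF hd hy hr hV' h, eventually_mem_opens hy,
    eventually_mem_opens hV] with y' h1 h2 hy' hyV x hx hxK
  have hp := smul_mem_incD d r y'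
  have h3 := h1 _ hp
  refine LocSec.eqOn_of_isPreconnected (identityPrinciple hS hF) continuous_id
    (hZ.isPreconnected_fibre S hy') ((locSec_fibre s hyV).mono Set.inter_subset_right)
    ((locSec_gat F v).mono Set.inter_subset_left)
    ⟨dirChart_sub hd φ hr (_, y') ⟨hp, hy'⟩, h3.1⟩ ?_ x ⟨hxK, hx⟩
  exact h3.2.trans (h2 _ hp)

theorem IsThreshold.mono (hS : IsConstructible S F) (hF : IsAcyclic F) (hd : Continuous d)
    (hZ : IsThreshold d ρ Z) {i : pp Z F ⟶ farSheaf d F} (hi : IsFarRes i) : Mono i := by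
  refine mono_of_stalkMap_injective i fun y => (injective_iff_map_eq_zero _).2 fun a ha => ?_
  obtain ⟨V, hV, s, rfl⟩ := exists_gat_eq _ a
  have hy := self_mem_dirChart hd y
  have h1 := hZ.ppVal_eq hS hF hd hi hy hV (v := 0) (by rw [ha, map_zero, map_zero])
  rw [← map_zero (gat (pp Z F) V y)]
  refine gat_eq_of_ppVal_eq hV hV ?_
  filter_upwards [h1, eventually_mem_opens hy, eventually_mem_opens hV] with y' h1 hy' hyV x hx
  have hA := hZ.isPreconnected_fibre (φ := d y) ∅ hy'
  -- With no cuts the connectedness lemma gives the whole fibre, so vanishing far out spreads to the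
  -- singularities as well.
  have huniv : ∀ A : Set ℂ, (cutCompl ∅ (d y) : Set ℂ) ∩ A = A := fun A =>
    Set.inter_eq_right.2 fun x _ c hc => absurd hc (by simp)
  rw [huniv] at hA
  set r := max (bound S) (ρ y')
  have hp : ((r + 1) • (d y' : ℂ), y') ∈ incD d r := smul_mem_incD d r y'
  have hpZ := hZ.mem _ _ ((le_max_right (bound S) (ρ y')).trans_lt hp)
  refine LocSec.eqOn_of_isPreconnected (identityPrinciple hS hF) continuous_id hA
    (locSec_fibre s hyV) (locSec_fibre 0 hyV) hpZ ?_ x hx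
  have := h1 _ hpZ (dirChart_sub hd (d y) (le_max_left _ _) (_, y') ⟨hp, hy'⟩)
  rw [this, map_zero, map_zero]

/-- If v comes from a section over half-planes, this section is defined around each relevant c, and
its germ at c forces v to extend over the cut. Conversely, if v extends over the relevant cuts, the
extended section restricts to all nearby half-planes, as these meet no other cut. -/
theorem IsThreshold.mem_stalkRange_iff (hS : IsConstructible S F) (hF : IsAcyclic F)
    (hd : Continuous d) (hφ : IsFrame S φ ε) (hZ : IsThreshold d ρ Z)
    {i : pp Z F ⟶ farSheaf d F} (hi : IsFarRes i) {y : Y} (hy : y ∈ dirChart hd φ)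
    {v : sec F (cutCompl S φ)} :
    gat _ _ y (farSec F S hd φ v) ∈ stalkRange i y ↔
      ∀ c ∈ S, ρ y ≤ reDir (d y) c → v ∈ extendable F S φ ε c := by
  constructor
  · rintro ⟨a, ha⟩ c hc hyc
    obtain ⟨V, hV, s, rfl⟩ := exists_gat_eq _ a
    -- The point c may lie on the boundary of an open half-plane over y; over suitable y'
    -- arbitrarily near y it belongs to the fibre.
    obtain ⟨y', hcy, h1, hy', hyV⟩ := ((hZ.freq c y hyc).and_eventually
      ((hZ.ppVal_eq hS hF hd hi hy hV ha).and
        ((eventually_mem_opens hy).and (eventually_mem_opens hV)))).exists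
    obtain ⟨N, hN, b, hb⟩ := locSec_fibre s hyV c hcy
    obtain ⟨δ, hδ, hball⟩ := exists_ballO_subset (Filter.inter_mem (N.isOpen.mem_nhds hN)
      (eventually_nhdsWithin_iff.1 hb))
    have hle : ballO c (min δ ε) ≤ N := fun x hx =>
      (hball (Metric.ball_subset_ball (min_le_left _ _) hx)).1
    have hm : 0 < min δ ε := lt_min hδ hφ.pos
    have hx : c + (min δ ε / 2) • (φ : ℂ) ∈ ballO c (min δ ε) := by
      have := add_mem_ballO (φ := φ) (c := c) (δ := min δ ε) (a := min δ ε / 2) (b := 0)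
        (by rw [abs_zero, add_zero, abs_of_pos (half_pos hm)]; exact half_lt_self hm)
      simpa only [zero_smul, add_zero] using this
    have hxK : c + (min δ ε / 2) • (φ : ℂ) ∈ cutCompl S φ := by
      refine (hφ.mem_cutCompl_iff hc (ballO_le_strip φ ε c
        (Metric.ball_subset_ball (min_le_right _ _) hx))).2 fun _ => ?_
      simp only [reDir_add, reDir_smul, reDir_self]
      linarith
    have hxZ : (c + (min δ ε / 2) • (φ : ℂ), y') ∈ Z := by
      refine hZ.up _ _ _ hcy ?_
      have : 0 < reDir (d y') φ := hy'
      rw [reDir_add, reDir_smul]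
      nlinarith [mul_pos hm this]
    refine mem_extendable_of_ball hS hF hφ hc hm (min_le_right _ _) (resL F hle b) hx hxK ?_
    rw [gat_resL hle hx, ← h1 _ hxZ hxK]
    exact (hball (Metric.ball_subset_ball (min_le_left _ _) hx)).2 hxZ
  · intro hv
    classical
    obtain ⟨J, hJ⟩ : ∃ J : Finset ℂ, ∀ c, c ∈ J ↔ c ∈ S ∧ ρ y ≤ reDir (d y) c :=
      ⟨S.filter fun c => ρ y ≤ reDir (d y) c, fun c => Finset.mem_filter⟩
    obtain ⟨w, hw⟩ := exists_of_mem_extendable hφ (fun c hc => ((hJ c).1 hc).1)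
      (fun c hc => hv c ((hJ c).1 hc).1 ((hJ c).1 hc).2)
    -- The remaining singularities lie strictly below the threshold, a condition that persists near
    -- y.
    have h1 : ∀ᶠ y' in 𝓝 y, ∀ c ∈ S, c ∉ J → reDir (d y') c < ρ y' := by
      simp only [← Finset.mem_coe (s := S)]
      rw [S.finite_toSet.eventually_all]
      intro c hc
      by_cases hcJ : c ∈ J
      · exact Eventually.of_forall fun _ h => absurd hcJ h
      have : reDir (d y) c < ρ y := by
        by_contra h
        exact hcJ ((hJ c).2 ⟨hc, not_lt.1 h⟩)
      filter_upwards [((continuous_reDir_left c).comp hd).continuousAt.eventually_lt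
        hZ.cont.continuousAt this] with y' h _
      exact h
    obtain ⟨V₀, hV₀, hVo, hyV₀⟩ := eventually_nhds_iff.1 (h1.and (eventually_mem_opens hy))
    let V : Opens Y := ⟨V₀, hVo⟩
    -- The cut at c runs backwards, so a fibre point x on it has height at most that of c. The
    -- threshold is then at most the height of c, which forces c into J.
    have hsub : ∀ w ∈ part Z V, w.1 ∈ cutCompl S φ ⊔ J.sup (strip φ ε) := by
      rintro ⟨x, y'⟩ ⟨hx, hy'⟩
      by_cases hxK : x ∈ cutCompl S φ
      · exact Or.inl hxK
      rw [mem_cutCompl] at hxK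
      push Not at hxK
      obtain ⟨c, hc, e1, e2⟩ := hxK
      have hpos : 0 < reDir (d y') φ := (hV₀ y' hy').2
      have h3 : reDir (d y') x ≤ reDir (d y') c := by
        rw [reDir_decomp (d y') φ x, reDir_decomp (d y') φ c, e1]
        nlinarith
      have hcJ : c ∈ J := by
        by_contra hcJ
        have := (hV₀ y' hy').1 c hc hcJ
        linarith [hZ.le x y' hx]
      have hle : strip φ ε c ≤ J.sup (strip φ ε) := Finset.le_sup hcJ
      exact Or.inr (hle (by rw [mem_strip, e1, sub_self, abs_zero]; exact hφ.pos))
    refine ⟨gat _ V y (pullSec hsub w), ?_⟩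
    obtain ⟨r, hr, V', hV', t, ht⟩ := hZ.exists_res S (V := V) hyV₀ (pullSec hsub w)
    rw [hi y r V V' _ t hyV₀ hV' ht, gat_farSec hd hy hr v hV' t]
    filter_upwards [ht, eventually_mem_opens hy, eventually_mem_opens (U := V) hyV₀]
      with y' h1 hy' hyV x hx
    rw [← (h1 x hx).2, ppVal_pullSec hsub ⟨(h1 x hx).1, hyV⟩]
    exact hw x (dirChart_sub hd φ hr (x, y') ⟨hx, hy'⟩)

end Threshold

/-! ### The graded pieces -/

section Graded

variable {k : Type} [Field k] {F : Sh k ℂ} {S : Finset ℂ} {φ : Circle} {ε : ℝ}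

theorem pi_mkQ_extendable_bijective (hF : IsAcyclic F) (hφ : IsFrame S φ ε) :
    Function.Bijective (LinearMap.pi fun c : S => (extendable F S φ ε c).mkQ) := by
  refine ⟨(injective_iff_map_eq_zero _).2 fun v hv => ?_, fun x => ?_⟩
  · refine eq_zero_of_mem_extendable hF hφ fun c hc => ?_
    exact (Submodule.Quotient.mk_eq_zero _).1 (congrFun hv ⟨c, hc⟩)
  · choose v hv using fun c : S => (extendable F S φ ε c).mkQ_surjective (x c)
    obtain ⟨v₀, h₀⟩ := exists_sub_mem_extendable hF hφ v
    refine ⟨v₀, funext fun c => ?_⟩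
    rw [← hv c]
    exact (Submodule.Quotient.eq _).2 (h₀ c)

/-- The circle of radius `ε / 2` around `c`. -/
def smallCircle (ε : ℝ) (c : ℂ) : TopCat.of Circle ⟶ TopCat.of ℂ :=
  TopCat.ofHom ⟨fun u => c + (ε / 2) • (u : ℂ), by fun_prop⟩

variable (F) in
/-- The germs at `c + (ε / 2) u` of the sections of `F` on the ball of radius `ε` around `c`. -/
def ballGerms (ε : ℝ) (c : ℂ) (u : Circle) : Submodule k (stk F ((smallCircle ε c).hom u)) :=
  LinearMap.range (gat F (ballO c ε) ((smallCircle ε c).hom u))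

variable (F) in
/-- The sheaf of germs of `F` on a small circle around `c` modulo the sections of `F` near `c`. -/
def grSheaf (ε : ℝ) (c : ℂ) : Sh k Circle := quotSheaf (smallCircle ε c) F (ballGerms F ε c)

theorem smallCircle_mem_ballO (hε : 0 < ε) (c : ℂ) (u : Circle) :
    (smallCircle ε c).hom u ∈ ballO c ε := by
  change c + (ε / 2) • (u : ℂ) ∈ _
  rw [mem_ballO, add_sub_cancel_left, norm_smul, Circle.norm_coe, mul_one,
    Real.norm_of_nonneg (half_pos hε).le]
  exact half_lt_self hε

theorem IsFrame.smallCircle_mem_cutCompl (hφ : IsFrame S φ ε) {c : ℂ} (hc : c ∈ S) :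
    ∀ u ∈ dirChart continuous_id φ, (smallCircle ε c).hom u ∈ cutCompl S φ := by
  intro u hu
  have hu' : 0 < reDir u φ := hu
  refine (hφ.mem_cutCompl_iff hc
    (ballO_le_strip φ ε c (smallCircle_mem_ballO hφ.pos c u))).2 fun _ => ?_
  change reDir φ c < reDir φ (c + (ε / 2) • (u : ℂ))
  have h2 : reDir φ u = reDir u φ := by rw [reDir_eq, reDir_eq]; ring
  rw [reDir_add, reDir_smul, h2]
  have := mul_pos (half_pos hφ.pos) hu'
  linarith

theorem quotStalk_grSheaf_injective (hε : 0 < ε) (c : ℂ) (u : Circle) :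
    Function.Injective (quotStalk (smallCircle ε c) F (ballGerms F ε c) u) := by
  refine quotStalk_injective _ _ _ (fun u N t hN => ?_) u
  rintro ⟨b, hb⟩
  have h1 := eventually_gat_eq (smallCircle_mem_ballO hε c u) hN hb
  filter_upwards [(smallCircle ε c).hom.continuous.continuousAt.eventually h1] with u' h
  exact ⟨b, h⟩

variable (F) in
/-- The section of `grSheaf` given by a section on the complement of the cuts. -/
def grSec (hφ : IsFrame S φ ε) {c : ℂ} (hc : c ∈ S) :
    sec F (cutCompl S φ) →ₗ[k] sec (grSheaf F ε c) (dirChart continuous_id φ) :=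
  toQuot (smallCircle ε c) F (ballGerms F ε c) (hφ.smallCircle_mem_cutCompl hc)

/-- The kernel of F(K) → (gr_c)_u is E_c for every u of the chart: the germ vanishes if and only if
v agrees at one point of the small circle with a section on the ball around c. -/
theorem gat_grSec_eq_zero_iff (hS : IsConstructible S F) (hF : IsAcyclic F) (hφ : IsFrame S φ ε)
    {c : ℂ} (hc : c ∈ S) {u : Circle} (hu : u ∈ dirChart continuous_id φ)
    {v : sec F (cutCompl S φ)} :
    gat _ _ u (grSec F hφ hc v) = 0 ↔ v ∈ extendable F S φ ε c := by
  have h1 : gat _ _ u (grSec F hφ hc v) = 0 ↔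
      gat F _ ((smallCircle ε c).hom u) v ∈ ballGerms F ε c u := by
    have hq := quotStalk_toQuot (smallCircle ε c) F (ballGerms F ε c)
      (hφ.smallCircle_mem_cutCompl hc) hu v
    refine ⟨fun h => ?_, fun h => quotStalk_grSheaf_injective (F := F) hφ.pos c u ?_⟩
    · exact (Submodule.Quotient.mk_eq_zero _).1
        (hq.symm.trans ((congrArg (quotStalk _ _ _ u) h).trans (map_zero _)))
    · exact hq.trans (((Submodule.Quotient.mk_eq_zero _).2 h).trans (map_zero _).symm)
  rw [h1]
  have hK := hφ.smallCircle_mem_cutCompl hc u hu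
  have hB := smallCircle_mem_ballO hφ.pos c u
  constructor
  · rintro ⟨b, hb⟩
    exact mem_extendable_of_ball hS hF hφ hc hφ.pos le_rfl b hB hK hb.symm
  · intro hv
    obtain ⟨b, hb⟩ := exists_ball_of_mem_extendable hv
    exact ⟨b, hb _ hK hB⟩

theorem gat_grSec_surjective (hS : IsConstructible S F) (hF : IsAcyclic F) (hφ : IsFrame S φ ε)
    {c : ℂ} (hc : c ∈ S) {u : Circle} (hu : u ∈ dirChart continuous_id φ) :
    Function.Surjective (gat _ _ u ∘ₗ grSec F hφ hc) := by
  intro a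
  obtain ⟨x, hx⟩ := (ballGerms F ε c u).mkQ_surjective
    (quotStalk (smallCircle ε c) F (ballGerms F ε c) u a)
  obtain ⟨v, rfl⟩ := (gat_cutCompl_bijective hS hF (hφ.smallCircle_mem_cutCompl hc u hu)).2 x
  refine ⟨v, quotStalk_grSheaf_injective (F := F) hφ.pos c u (Eq.trans ?_ hx)⟩
  exact quotStalk_toQuot (smallCircle ε c) F (ballGerms F ε c)
    (hφ.smallCircle_mem_cutCompl hc) hu v

/-- On the chart of φ the sheaf is constant with fibre F(K)/E_c. Its definition does not involve φ,
so these charts belong to one global object. -/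
theorem isLocalSystem_grSheaf (hS : IsConstructible S F) (hF : IsAcyclic F)
    (hε : ∀ u : Circle, ∃ φ : Circle, 0 < reDir u φ ∧ IsFrame S φ ε) {c : ℂ} (hc : c ∈ S) :
    IsLocalSystem (grSheaf F ε c) := by
  intro u
  obtain ⟨φ, hu, hφ⟩ := hε u
  have hker : extendable F S φ ε c ≤ LinearMap.ker (grSec F hφ hc) := fun v hv =>
    sec_ext fun u' hu' => by
      rw [(gat_grSec_eq_zero_iff hS hF hφ hc hu').2 hv, map_zero]
  have hfin := finite_sec_cutCompl hS hF φ
  refine ⟨dirChart continuous_id φ, hu, ModuleCat.of k (sec F (cutCompl S φ) ⧸ extendable F S φ ε c),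
    inferInstanceAs (Module.Finite k (sec F (cutCompl S φ) ⧸ extendable F S φ ε c)),
    (extendable F S φ ε c).liftQ (grSec F hφ hc) hker, fun u' hu' => ?_⟩
  rw [← gat_of_mem hu']
  constructor
  · refine (injective_iff_map_eq_zero _).2 fun q hq => ?_
    obtain ⟨v, rfl⟩ := (extendable F S φ ε c).mkQ_surjective q
    exact (Submodule.Quotient.mk_eq_zero _).2 ((gat_grSec_eq_zero_iff hS hF hφ hc hu').1 hq)
  · intro a
    obtain ⟨v, rfl⟩ := gat_grSec_surjective hS hF hφ hc hu' a
    exact ⟨(extendable F S φ ε c).mkQ v, rfl⟩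

variable (F) in
/-- The germs at `u` in the graded pieces of a section on the complement of the cuts. -/
def grGerms (hφ : IsFrame S φ ε) (u : Circle) :
    sec F (cutCompl S φ) →ₗ[k] ∀ c : S, stk (grSheaf F ε c) u :=
  LinearMap.pi fun c : S => gat _ _ u ∘ₗ grSec F hφ c.2

theorem grGerms_bijective (hS : IsConstructible S F) (hF : IsAcyclic F) (hφ : IsFrame S φ ε)
    {u : Circle} (hu : u ∈ dirChart continuous_id φ) : Function.Bijective (grGerms F hφ u) := by
  refine ⟨(injective_iff_map_eq_zero _).2 fun v hv => ?_, fun x => ?_⟩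
  · refine eq_zero_of_mem_extendable hF hφ fun c hc => ?_
    exact (gat_grSec_eq_zero_iff hS hF hφ hc hu).1 (congrFun hv ⟨c, hc⟩)
  · choose v hv using fun c : S => gat_grSec_surjective hS hF hφ c.2 hu (x c)
    obtain ⟨v₀, h₀⟩ := exists_sub_mem_extendable hF hφ v
    refine ⟨v₀, funext fun c => ?_⟩
    rw [← hv c, ← sub_eq_zero]
    have := (gat_grSec_eq_zero_iff hS hF hφ c.2 hu).2 (h₀ c)
    rw [map_sub, map_sub] at this
    exact this

end Graded

/-! ### Co-Stokes structures and co-Stokes sheaves -/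

section CoStokes

variable {k : Type} [Field k] {F : Sh k ℂ} {S : Finset ℂ}

theorem isThreshold_incSAt (ξ : ℂ) : IsThreshold id (fun u => reDir u ξ) (incSAt ξ) where
  cont := continuous_reDir_left ξ
  le _ _ h := h
  mem _ _ h := le_of_lt h
  up _ _ _ h h' := le_trans h h'
  freq _ y h := by
    refine Filter.frequently_iff.2 fun {U} hU => ⟨y, mem_of_mem_nhds hU, h⟩

theorem isThreshold_incH : IsThreshold dir (fun z => Real.log ‖(z : ℂ)‖) incH where
  cont := continuous_subtype_val.norm.log fun z => norm_ne_zero_iff.2 z.2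
  le _ _ h := le_of_lt h
  mem _ _ h := h
  up _ _ _ h h' := lt_of_lt_of_le h h'
  freq x z h := by
    -- Scaling z by exp(-t) keeps its direction and lowers log |z| by t > 0, so boundary points of
    -- the half-plane of z become interior.
    have hc : Tendsto (fun t : ℝ => (⟨Real.exp (-t) * z, by simp [z.2]⟩ : Cstar)) (𝓝[>] 0)
        (𝓝 z) := by
      refine Tendsto.mono_left ?_ nhdsWithin_le_nhds
      have : Continuous fun t : ℝ => (⟨Real.exp (-t) * z, by simp [z.2]⟩ : Cstar) := by
        refine Continuous.subtype_mk ?_ _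
        fun_prop
      convert this.tendsto 0 using 2
      exact Subtype.ext (by simp)
    refine hc.frequently (Eventually.frequently ?_)
    filter_upwards [self_mem_nhdsWithin] with t ht
    have ht' : 0 < t := ht
    have hn : ‖(Real.exp (-t) * z : ℂ)‖ = Real.exp (-t) * ‖(z : ℂ)‖ := by
      rw [norm_mul, Complex.norm_real, Real.norm_of_nonneg (Real.exp_pos _).le]
    have hdir : dir ⟨Real.exp (-t) * z, by simp [z.2]⟩ = dir z := by
      refine Subtype.ext ?_
      change (Real.exp (-t) * z : ℂ) / (‖(Real.exp (-t) * z : ℂ)‖ : ℂ) = z / (‖(z : ℂ)‖ : ℂ)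
      rw [hn, Complex.ofReal_mul]
      exact mul_div_mul_left _ _ (by simp)
    change Real.log ‖(Real.exp (-t) * z : ℂ)‖ < reDir (dir ⟨Real.exp (-t) * z, _⟩) x
    rw [hdir, hn, Real.log_mul (Real.exp_pos _).ne' (norm_ne_zero_iff.2 z.2), Real.log_exp]
    linarith

theorem isFarRes_incSAt (F : Sh k ℂ) (ξ : ℂ) :
    IsFarRes (d := id) (F := F) (Z := incSAt ξ)
      ((pullPushRes (incS_subset ξ) ≫ toColim k incS antitone_incS ‖ξ‖).app F) := by
  intro u r V V' s t hV hV' h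
  refine (stalkMap_comp ((pullPushRes (k := k) (incS_subset ξ)).app F)
    (toFar id F ‖ξ‖) u _).trans ?_
  rw [stalkMap_gat]
  have hr := stalkMap_toFar_eq (d := id) (F := F) (le_max_left r ‖ξ‖) hV' hV'
    (s' := secMap ((pullPushRes (k := k) (antitone_incD id (le_max_left r ‖ξ‖))).app F) V' t)
    (y := u) (s := t) (by
      filter_upwards [eventually_mem_opens hV'] with u' hu' x hx
      exact (ppVal_res (antitone_incD id (le_max_left r ‖ξ‖)) ⟨hx, hu'⟩ t).symm)
  rw [hr]
  refine stalkMap_toFar_eq (d := id) (F := F) (le_max_right r ‖ξ‖) hV hV' ?_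
  filter_upwards [h, eventually_mem_opens hV, eventually_mem_opens hV'] with u' h hu hu' x hx
  rw [ppVal_res (antitone_incD id (le_max_left r ‖ξ‖)) ⟨hx, hu'⟩ t,
    ← (h x (antitone_incD id (le_max_left r ‖ξ‖) hx)).2]
  exact ppVal_res (incS_subset ξ) ⟨antitone_incD id (le_max_right r ‖ξ‖) hx, hu⟩ s

theorem IsRestriction.stalkMap_resH {ι : directG k ⟶ directL k} (hι : IsRestriction ι) (r : ℝ)
    (z : Cstar) (x : stk (pp (incH ∪ incC r) F) z) :
    stalkMap (ι.app F) z (stalkMap ((resH k r).app F) z x) = stalkMap ((resL' k r).app F) z x := by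
  have h : (resH k r).app F ≫ ι.app F = (resL' k r).app F := NatTrans.congr_app (hι r) F
  rw [← stalkMap_comp, h]

/-- The germ lifts to X_{r'} for r' > log |z|, where ι is restriction to half-planes with bound r';
taking r' ≥ r allows comparison with the given far section. -/
theorem isFarRes_of_isRestriction {ι : directG k ⟶ directL k} (hι : IsRestriction ι)
    (F : Sh k ℂ) : IsFarRes (d := dir) (F := F) (Z := incH) (ι.app F) := by
  intro z r V V' s t hV hV' h
  obtain ⟨r', hr, hlog⟩ : ∃ r', r ≤ r' ∧ Real.log ‖(z : ℂ)‖ < r' :=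
    ⟨max r (Real.log ‖(z : ℂ)‖ + 1), le_max_left _ _,
      lt_of_lt_of_le (lt_add_one _) (le_max_right _ _)⟩
  obtain ⟨a, ha⟩ := (resH_bijective F hlog).2 (gat _ V z s)
  obtain ⟨W, hW, s', rfl⟩ := exists_gat_eq (pp (incH ∪ incC r') F) a
  have e1 : stalkMap (ι.app F) z (stalkMap ((resH k r').app F) z (gat _ W z s')) =
      stalkMap ((resL' k r').app F) z (gat _ W z s') :=
    hι.stalkMap_resH r' z _
  have e2 : stalkMap ((resL' k r').app F) z (gat _ W z s') = stalkMap (toFar dir F r') z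
      (gat _ W z (secMap ((pullPushRes (k := k)
        (Set.subset_union_right : incC r' ⊆ incH ∪ incC r')).app F) W s')) :=
    (stalkMap_comp ((pullPushRes (k := k)
      (Set.subset_union_right : incC r' ⊆ incH ∪ incC r')).app F) (toFar dir F r') z _).trans
      (congrArg (stalkMap (toFar dir F r') z) (stalkMap_gat _ W z s'))
  refine (congrArg (stalkMap (ι.app F) z) ha).symm.trans (e1.trans (e2.trans ?_))
  rw [stalkMap_gat] at ha
  refine (stalkMap_toFar_eq (d := dir) (F := F) hr hV' hW ?_).symm
  filter_upwards [h, eventually_mem_opens hW, ppVal_eq_of_gat_eq hW hV ha,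
    eventually_log_lt hlog] with z' h h3 h4 h5 x hx
  have hxH : (x, z') ∈ incH := lt_trans h5 hx
  have e3 := ppVal_res (F := F) (Set.subset_union_right : incC r' ⊆ incH ∪ incC r')
    (w := (x, z')) ⟨hx, h3⟩ s'
  have e4 := ppVal_res (F := F) (Set.subset_union_left : incH ⊆ incH ∪ incC r')
    (w := (x, z')) ⟨hxH, h3⟩ s'
  exact (h x (antitone_incD dir hr hx)).2.symm.trans
    ((h4 x).symm.trans (e4.trans e3.symm))

theorem isCoStokesStructure_of_isFarRes (hS : IsConstructible S F) (hF : IsAcyclic F)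
    (i : ∀ ξ, pp (incSAt ξ) F ⟶ farSheaf id F) (hi : ∀ ξ, IsFarRes (d := id) (i ξ)) :
    IsCoStokesStructure S ⟨farSheaf id F, fun ξ => pp (incSAt ξ) F, i⟩ := by
  classical
  have hd : Continuous (id : Circle → Circle) := continuous_id
  obtain ⟨ε, hε⟩ := exists_isFrame S
  have hcrit : ∀ {φ : Circle}, IsFrame S φ ε → ∀ {u}, u ∈ dirChart hd φ → ∀ ξ
      (v : sec F (cutCompl S φ)), gat _ _ u (farSec F S hd φ v) ∈ stalkRange (i ξ) u ↔
        ∀ c ∈ S, reDir u ξ ≤ reDir u c → v ∈ extendable F S φ ε c := fun hφ _ hu ξ v =>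
    (isThreshold_incSAt ξ).mem_stalkRange_iff hS hF hd hφ (hi ξ) hu
  refine ⟨isLocalSystem_farSheaf hS hF hd, fun ξ => (isThreshold_incSAt ξ).mono hS hF hd (hi ξ),
    fun u ξ₁ ξ₂ hlt a ha => ?_, fun c => grSheaf F ε c,
    fun c => isLocalSystem_grSheaf hS hF hε c.2, fun u₀ => ?_⟩
  -- A larger ξ imposes the extension condition at fewer singularities.
  · obtain ⟨φ, hu, hφ⟩ := hε u
    obtain ⟨v, rfl⟩ := (farSec_bijective hS hF hd (φ := φ) hu).2 a
    exact (hcrit hφ hu ξ₂ v).2 fun c hc h =>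
      (hcrit hφ hu ξ₁ v).1 ha c hc (hlt.le.trans h)
  · obtain ⟨φ, hu₀, hφ⟩ := hε u₀
    have hb : ∀ {u}, u ∈ dirChart hd φ → Function.Bijective (grGerms F hφ u) := fun hu =>
      grGerms_bijective hS hF hφ hu
    -- Both sides are identified with F(K), the left one by the splitting. Outside the chart the
    -- value 0 plays no role.
    let e : ∀ u : Circle, (∀ c : S, stk (grSheaf F ε c) u) →ₗ[k] stk (farSheaf id F) u := fun u =>
      if hu : u ∈ dirChart hd φ then
        (gat _ _ u ∘ₗ farSec F S hd φ) ∘ₗ (LinearEquiv.ofBijective _ (hb hu)).symm.toLinearMap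
      else 0
    have he : ∀ {u}, u ∈ dirChart hd φ → ∀ v,
        e u (grGerms F hφ u v) = gat _ _ u (farSec F S hd φ v) := by
      intro u hu v
      simp only [e, dif_pos hu]
      exact congrArg (fun v => gat _ _ u (farSec F S hd φ v))
        ((LinearEquiv.ofBijective _ (hb hu)).symm_apply_apply v)
    refine ⟨dirChart hd φ, hu₀, e, fun u hu => ?_, fun W hW s => ?_, fun u hu ξ x => ?_⟩
    · simp only [e, dif_pos hu]
      exact (farSec_bijective hS hF hd hu).comp (LinearEquiv.bijective _)
    · obtain ⟨t, ht⟩ := exists_sec_of_germs (farSheaf id F) W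
        (fun u => e u fun c => gat _ W u (s c)) (fun u hu => by
          obtain ⟨v, hv⟩ := (hb (hW hu)).2 fun c => gat _ W u (s c)
          refine ⟨dirChart hd φ, hW hu, farSec F S hd φ v, ?_⟩
          -- One v in F(K) represents all the s c at u, hence also near u because S is finite; so e
          -- of the tuple is locally the section given by v.
          have h1 : ∀ᶠ u' in 𝓝 u, ∀ c : S,
              gat _ _ u' (grSec F hφ c.2 v) = gat _ W u' (s c) := by
            rw [eventually_all]
            exact fun c => eventually_gat_eq (hW hu) hu (congrFun hv c)
          filter_upwards [h1, eventually_mem_opens hu] with u' h1 hu'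
          rw [← he (hW hu')]
          exact congrArg _ (funext h1))
      refine ⟨t, fun u hu => ?_⟩
      have := ht u hu
      simp only [gat_of_mem hu] at this
      exact this
    · obtain ⟨v, rfl⟩ := (hb hu).2 x
      rw [he hu]
      refine (hcrit hφ hu ξ v).trans ⟨fun h c hc => ?_, fun h c hc hc' => ?_⟩
      · exact (gat_grSec_eq_zero_iff hS hF hφ c.2 hu).2 (h c c.2 (not_lt.1 hc))
      · exact (gat_grSec_eq_zero_iff hS hF hφ hc hu).1 (h ⟨c, hc⟩ (not_lt.2 hc'))

theorem notMem_outside_iff {z : Cstar} {c : ℂ} :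
    z ∉ outside c ↔ Real.log ‖(z : ℂ)‖ ≤ reDir (dir z) c := by
  rw [outside, Set.mem_ofPred_eq, not_lt, Real.log_le_iff_le_exp (norm_pos_iff.2 z.2)]

theorem isCoStokesSheaf_of_isFarRes (hS : IsConstructible S F) (hF : IsAcyclic F)
    (i : pp incH F ⟶ farSheaf dir F) (hi : IsFarRes (d := dir) i) :
    IsCoStokesSheaf S ⟨farSheaf dir F, pp incH F, i⟩ := by
  refine ⟨isThreshold_incH.mono hS hF continuous_dir hi, fun z₀ => ?_⟩
  obtain ⟨ε, hε⟩ := exists_isFrame S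
  obtain ⟨φ, hz₀, hφ⟩ := hε (dir z₀)
  have hfin := finite_sec_cutCompl hS hF φ
  let θ := LinearEquiv.ofBijective _ (pi_mkQ_extendable_bijective (F := F) hF hφ)
  refine ⟨dirChart continuous_dir φ, hz₀,
    fun c => ModuleCat.of k (sec F (cutCompl S φ) ⧸ extendable F S φ ε c),
    fun c => inferInstanceAs (Module.Finite k (sec F (cutCompl S φ) ⧸ extendable F S φ ε c)),
    farSec F S continuous_dir φ ∘ₗ θ.symm.toLinearMap, fun z hz => ?_⟩
  rw [← gat_of_mem hz]
  refine ⟨(farSec_bijective hS hF continuous_dir hz).comp θ.symm.bijective, fun x => ?_⟩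
  obtain ⟨v, rfl⟩ := θ.surjective x
  have h1 : (farSec F S continuous_dir φ ∘ₗ θ.symm.toLinearMap) (θ v) =
      farSec F S continuous_dir φ v := congrArg (farSec F S continuous_dir φ) (θ.symm_apply_apply v)
  refine Iff.trans (iff_of_eq (congrArg (fun a => gat _ _ z a ∈ stalkRange i z) h1)) ?_
  rw [isThreshold_incH.mem_stalkRange_iff hS hF continuous_dir hφ hi hz]
  refine ⟨fun h c hc => ?_, fun h c hc hc' => ?_⟩
  · exact (Submodule.Quotient.mk_eq_zero _).2 (h c c.2 (notMem_outside_iff.1 hc))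
  · exact (Submodule.Quotient.mk_eq_zero _).1 (h ⟨c, hc⟩ (notMem_outside_iff.2 hc'))

end CoStokes

/-! ### The comparison map -/

section Comparison

variable {k : Type} [Field k]

/-- The base change map for `π`. -/
abbrev dirBase (F : Sh k ℂ) (r : ℝ) : pp (incD id r) F ⟶ pf dirMap (pp (incD dir r) F) :=
  ppBaseApp dirMap (fun _ h => h) F

theorem pullPushRes_dirBase (F : Sh k ℂ) {r r' : ℝ} (h : r ≤ r') :
    (pullPushRes (k := k) (antitone_incD id h)).app F ≫ dirBase F r' =
      dirBase F r ≫ (TopCat.Sheaf.pushforward (ModuleCat.{0} k) dirMap).map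
        ((pullPushRes (k := k) (antitone_incD dir h)).app F) := by
  refine sh_hom_ext fun V s => pp_ext (Z := incD dir r') (F := F) (V := pre dirMap V) fun w hw => ?_
  refine (ppVal_ppBaseApp dirMap (fun _ h => h) F
    (secMap ((pullPushRes (k := k) (antitone_incD id h)).app F) V s) hw).trans ?_
  refine (ppVal_res (antitone_incD id h) ⟨hw.1, hw.2⟩ s).trans ?_
  refine Eq.trans ?_ (ppVal_res (antitone_incD dir h) hw (secMap (dirBase F r) V s)).symm
  exact (ppVal_ppBaseApp dirMap (fun _ h => h) F s ⟨antitone_incD dir h hw.1, hw.2⟩).symm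

theorem dirBase_toFar (F : Sh k ℂ) {r r' : ℝ} (h : r ≤ r') :
    (pullPushRes (k := k) (antitone_incD id h)).app F ≫ dirBase F r' ≫
      (TopCat.Sheaf.pushforward (ModuleCat.{0} k) dirMap).map (toFar dir F r') =
      dirBase F r ≫ (TopCat.Sheaf.pushforward (ModuleCat.{0} k) dirMap).map (toFar dir F r) := by
  have h1 : (pullPushRes (k := k) (antitone_incD dir h)).app F ≫ toFar dir F r' = toFar dir F r :=
    NatTrans.congr_app (toColim_comp (k := k) (incD dir) (antitone_incD dir) h) F
  rw [← Category.assoc, pullPushRes_dirBase F h, Category.assoc, ← Functor.map_comp, h1]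

/-- The base change maps at the stages r are compatible with the transition maps, so they factor
through the colimit; the adjunction for π turns the result into a map out of π^*. -/
theorem exists_comparison (F : Sh k ℂ) :
    ∃ f : pb dirMap (farSheaf id F) ⟶ farSheaf dir F, ∀ r, toFar id F r ≫
      (pbUnit dirMap (farSheaf id F) ≫
        (TopCat.Sheaf.pushforward (ModuleCat.{0} k) dirMap).map f) =
      dirBase F r ≫ (TopCat.Sheaf.pushforward (ModuleCat.{0} k) dirMap).map (toFar dir F r) := by
  let D := (pullPushDiagram k (incD (id : Circle → Circle)) (antitone_incD id)).flip.obj F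
  let c : Limits.Cocone D :=
    { pt := pf dirMap (farSheaf dir F)
      ι := { app := fun r => dirBase F r ≫
               (TopCat.Sheaf.pushforward (ModuleCat.{0} k) dirMap).map (toFar dir F r)
             naturality := fun r r' g => (dirBase_toFar F g.le).trans (Category.comp_id _).symm } }
  obtain ⟨f, hf⟩ := exists_pb_desc dirMap (farSheaf id F) (B := farSheaf dir F)
    (Limits.colimit.desc D c)
  refine ⟨f, fun r => ?_⟩
  rw [hf]
  exact Limits.colimit.ι_desc c r

/-- The comparison map `π^* colim_r R⁰q_{r*} p_r^* F ⟶ colim_r R⁰n_{r*} m_r^* F`. -/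
def comparison (F : Sh k ℂ) : pb dirMap (farSheaf id F) ⟶ farSheaf dir F :=
  (exists_comparison F).choose

theorem stalkMap_comparison (F : Sh k ℂ) {r : ℝ} {z : Cstar} {V : Opens Circle} {V' : Opens Cstar}
    (hV : dir z ∈ V) (hV' : z ∈ V') (s : sec (pp (incD id r) F) V) (t : sec (pp (incD dir r) F) V')
    (h : ∀ᶠ z' in 𝓝 z, ∀ x, (x, z') ∈ incD dir r →
      ppVal _ F V (x, dir z') s = ppVal _ F V' (x, z') t) :
    stalkMap (comparison F) z (pv dirMap (farSheaf id F) z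
      (stalkMap (toFar id F r) (dir z) (gat _ V (dir z) s))) =
      stalkMap (toFar dir F r) z (gat _ V' z t) := by
  have e := congrArg (fun f => secMap f V s) ((exists_comparison F).choose_spec r)
  have e1 : stalkMap (comparison F) z (pv dirMap (farSheaf id F) z
      (stalkMap (toFar id F r) (dir z) (gat _ V (dir z) s))) =
      gat _ (pre dirMap V) z (secMap (toFar dir F r) (pre dirMap V)
        (secMap (dirBase F r) V s)) := by
    rw [stalkMap_gat]
    refine (congrArg (stalkMap (comparison F) z)
      (pv_gat dirMap (farSheaf id F) (w := z) hV (secMap (toFar id F r) V s))).trans ?_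
    rw [stalkMap_gat]
    exact congrArg _ e
  rw [e1]
  refine (stalkMap_gat (toFar dir F r) (pre dirMap V) z (secMap (dirBase F r) V s)).symm.trans ?_
  refine congrArg _ (gat_eq_of_ppVal_eq (V := pre dirMap V) hV hV' ?_)
  filter_upwards [h, continuous_dir.continuousAt.eventually (eventually_mem_opens hV)]
    with z' h hz x hx
  exact (ppVal_ppBaseApp dirMap (fun _ h => h) F s ⟨hx, hz⟩).trans (h x hx)

variable {F : Sh k ℂ} {S : Finset ℂ} {φ : Circle}

/-- In the charts of φ on S¹ and on ℂ* the comparison map is the identity of F(K), because base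
change preserves values. -/
theorem comparison_farSec {z : Cstar} (hz : z ∈ dirChart continuous_dir φ)
    (v : sec F (cutCompl S φ)) :
    stalkMap (comparison F) z (pv dirMap (farSheaf id F) z
      (gat _ _ (dir z) (farSec F S continuous_id φ v))) =
      gat _ _ z (farSec F S continuous_dir φ v) := by
  have hz' : dir z ∈ dirChart continuous_id φ := hz
  have e1 := stalkMap_gat (toFar id F (bound S)) _ (dir z)
    (pullSec (F := F) (dirChart_sub continuous_id φ le_rfl) v)
  have e2 := stalkMap_gat (toFar dir F (bound S)) _ z
    (pullSec (F := F) (dirChart_sub continuous_dir φ le_rfl) v)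
  refine (congrArg (fun a => stalkMap (comparison F) z (pv dirMap (farSheaf id F) z a))
    e1.symm).trans (Eq.trans (stalkMap_comparison F hz' hz _ _ ?_) e2)
  filter_upwards [eventually_mem_opens hz] with z' hz x hx
  have hz' : dir z' ∈ dirChart continuous_id φ := hz
  rw [ppVal_pullSec (dirChart_sub continuous_dir φ le_rfl) ⟨hx, hz⟩]
  exact ppVal_pullSec (dirChart_sub continuous_id φ le_rfl) (w := (x, dir z')) ⟨hx, hz'⟩ v

theorem exists_farSec_eq (hS : IsConstructible S F) (hF : IsAcyclic F) {z : Cstar}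
    (hz : z ∈ dirChart continuous_dir φ) (x : stk (pb dirMap (farSheaf id F)) z) :
    ∃ v : sec F (cutCompl S φ), pv dirMap (farSheaf id F) z
      (gat _ _ (dir z) (farSec F S continuous_id φ v)) = x := by
  obtain ⟨a, rfl⟩ := pv_surjective dirMap (farSheaf id F) z x
  obtain ⟨v, hv⟩ := (farSec_bijective hS hF continuous_id (φ := φ) (y := dir z) hz).2 a
  exact ⟨v, congrArg _ hv⟩

theorem isIso_comparison (hS : IsConstructible S F) (hF : IsAcyclic F) :
    IsIso (comparison F) := by
  refine isIso_of_stalkMap_bijective _ fun z => ?_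
  have hz := self_mem_dirChart continuous_dir z
  have hb := farSec_bijective hS hF continuous_dir hz
  constructor
  · intro x y h
    obtain ⟨v, rfl⟩ := exists_farSec_eq hS hF hz x
    obtain ⟨w, rfl⟩ := exists_farSec_eq hS hF hz y
    rw [comparison_farSec hz, comparison_farSec hz] at h
    rw [hb.1 h]
  · intro y
    obtain ⟨v, rfl⟩ := hb.2 y
    exact ⟨_, comparison_farSec hz v⟩

/-- Every germ of the colimit for F comes from the stage `bound S`, where both composites apply a to
the values of one section. -/
theorem comparison_naturality (hS : IsConstructible S F) (hF : IsAcyclic F) {F' : Sh k ℂ}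
    (a : F ⟶ F') :
    (TopCat.Sheaf.pullback _ dirMap).map
        ((colimPullPush k (incD id) (antitone_incD id)).map a) ≫ comparison F' =
      comparison F ≫ (colimPullPush k (incD dir) (antitone_incD dir)).map a := by
  refine hom_ext_stalk fun z x => ?_
  obtain ⟨y, rfl⟩ := pv_surjective dirMap (farSheaf id F) z x
  have := isIso_toFar (d := (id : Circle → Circle)) hS hF continuous_id reDir_le_bound
    (le_refl (bound S))
  obtain ⟨b, rfl⟩ := (stalkMap_bijective_of_isIso (toFar id F (bound S)) (dir z)).2 y
  obtain ⟨V, hV, s, rfl⟩ := exists_gat_eq _ b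
  have hV' : z ∈ pre dirMap V := hV
  have e1 := stalkMap_comparison F hV hV' s (secMap (dirBase F (bound S)) V s) (by
    filter_upwards [eventually_mem_opens hV'] with z' hz x hx
    exact (ppVal_ppBaseApp dirMap (fun _ h => h) F s ⟨hx, hz⟩).symm)
  have n1 : (pullPush k (incD id (bound S))).map a ≫ toFar id F' (bound S) =
      toFar id F (bound S) ≫ (colimPullPush k (incD id) (antitone_incD id)).map a :=
    (toColim k (incD id) (antitone_incD id) (bound S)).naturality a
  have n2 : (pullPush k (incD dir (bound S))).map a ≫ toFar dir F' (bound S) =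
      toFar dir F (bound S) ≫ (colimPullPush k (incD dir) (antitone_incD dir)).map a :=
    (toColim k (incD dir) (antitone_incD dir) (bound S)).naturality a
  have e2 := stalkMap_comparison F' hV hV' (secMap ((pullPush k (incD id (bound S))).map a) V s)
    (secMap ((pullPush k (incD dir (bound S))).map a) (pre dirMap V)
      (secMap (dirBase F (bound S)) V s)) (by
    filter_upwards [eventually_mem_opens hV'] with z' hz x hx
    refine (ppVal_map a V (x, dir z') s).trans (Eq.trans ?_ (ppVal_map (F := F) a (pre dirMap V)
      (x, z') (secMap (dirBase F (bound S)) V s)).symm)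
    exact congrArg (stalkMap a x) (ppVal_ppBaseApp dirMap (fun _ h => h) F s ⟨hx, hz⟩).symm)
  rw [stalkMap_comp, stalkMap_comp]
  refine (congrArg _ (stalkMap_pv dirMap _ z _)).trans ?_
  have e3 : stalkMap ((colimPullPush k (incD id) (antitone_incD id)).map a) (dir z)
      (stalkMap (toFar id F (bound S)) (dir z) (gat _ V (dir z) s)) =
      stalkMap (toFar id F' (bound S)) (dir z)
        (gat _ V (dir z) (secMap ((pullPush k (incD id (bound S))).map a) V s)) := by
    rw [← stalkMap_comp, ← n1, stalkMap_comp, stalkMap_gat]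
  have e4 : stalkMap ((colimPullPush k (incD dir) (antitone_incD dir)).map a) z
      (stalkMap (toFar dir F (bound S)) z
        (gat _ (pre dirMap V) z (secMap (dirBase F (bound S)) V s))) =
      stalkMap (toFar dir F' (bound S)) z
        (gat _ (pre dirMap V) z (secMap ((pullPush k (incD dir (bound S))).map a) (pre dirMap V)
      (secMap (dirBase F (bound S)) V s))) := by
    rw [← stalkMap_comp, ← n2, stalkMap_comp]
    exact congrArg _ (stalkMap_gat _ _ _ _)
  refine (congrArg (fun b => stalkMap (comparison F') z (pv dirMap (farSheaf id F') z b))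
    e3).trans (e2.trans (e4.symm.trans (congrArg _ e1.symm)))

end Comparison

/-! ### The comparison of co-Stokes sheaves -/

section Main

variable {k : Type} [Field k] {F : Sh k ℂ} {S : Finset ℂ} {φ : Circle} {ε : ℝ}

theorem isCoStokesStructure_Psi (hS : IsConstructible S F) (hF : IsAcyclic F) :
    IsCoStokesStructure S ((Psi k).obj F) :=
  isCoStokesStructure_of_isFarRes hS hF _ (isFarRes_incSAt F)

theorem log_norm_eq_of_mem_circ {z : Cstar} {ξ : ℂ} (h : z ∈ circ ξ) :
    Real.log ‖(z : ℂ)‖ = reDir (dir z) ξ := by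
  have h' : ‖(z : ℂ)‖ = Real.exp (reDir (dir z) ξ) := h
  rw [h', Real.log_exp]

theorem exists_mem_circ (z : Cstar) : ∃ ξ : ℂ, z ∈ circ ξ := by
  -- The point ξ = log |z| e^{iθ} satisfies Re(ξ e^{-iθ}) = log |z|. So the intersection that
  -- defines the prescribed subspace is over a nonempty family.
  refine ⟨Real.log ‖(z : ℂ)‖ • (dir z : ℂ), ?_⟩
  change ‖(z : ℂ)‖ = Real.exp _
  rw [reDir_smul, reDir_self, mul_one, Real.exp_log (norm_pos_iff.2 z.2)]

theorem mem_stalkRange_piPull_iff (hS : IsConstructible S F) (hF : IsAcyclic F)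
    (hφ : IsFrame S φ ε) {z : Cstar} (hz : z ∈ dirChart continuous_dir φ) {ξ : ℂ}
    (hξ : z ∈ circ ξ) (v : sec F (cutCompl S φ)) :
    pv dirMap (farSheaf id F) z (gat _ _ (dir z) (farSec F S continuous_id φ v)) ∈
      stalkRange ((piPull k).map (((Psi k).obj F).incl ξ)) z ↔
      ∀ c ∈ S, Real.log ‖(z : ℂ)‖ ≤ reDir (dir z) c → v ∈ extendable F S φ ε c := by
  have hz' : dir z ∈ dirChart continuous_id φ := hz
  rw [log_norm_eq_of_mem_circ hξ]
  refine Iff.trans ?_ ((isThreshold_incSAt ξ).mem_stalkRange_iff hS hF continuous_id hφ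
    (isFarRes_incSAt F ξ) hz')
  constructor
  · rintro ⟨a, ha⟩
    obtain ⟨b, rfl⟩ := pv_surjective dirMap (pp (incSAt ξ) F) z a
    refine ⟨b, pv_injective dirMap (farSheaf id F) z (Eq.trans ?_ ha)⟩
    exact (stalkMap_pv dirMap (((Psi k).obj F).incl ξ) z b).symm
  · rintro ⟨b, hb⟩
    refine ⟨pv dirMap (pp (incSAt ξ) F) z b, ?_⟩
    exact (stalkMap_pv dirMap (((Psi k).obj F).incl ξ) z b).trans (congrArg _ hb)

variable {ι : directG k ⟶ directL k}

/-- The comparison map matches each `L_{<ξ}` with the subsheaf of the direct description. -/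
theorem mem_stalkRange_piPull_iff_comparison (hS : IsConstructible S F) (hF : IsAcyclic F)
    (hι : IsRestriction ι) {z : Cstar} {ξ : ℂ} (hξ : z ∈ circ ξ)
    (x : stk (pb dirMap (farSheaf id F)) z) :
    x ∈ stalkRange ((piPull k).map (((Psi k).obj F).incl ξ)) z ↔
      stalkMap (comparison F) z x ∈ stalkRange (ι.app F) z := by
  obtain ⟨ε, hε⟩ := exists_isFrame S
  obtain ⟨φ, hz, hφ⟩ := hε (dir z)
  obtain ⟨v, rfl⟩ := exists_farSec_eq (φ := φ) hS hF (z := z) hz x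
  refine (mem_stalkRange_piPull_iff hS hF hφ hz hξ v).trans ?_
  rw [comparison_farSec (φ := φ) hz]
  exact (isThreshold_incH.mem_stalkRange_iff hS hF continuous_dir hφ
    (isFarRes_of_isRestriction hι F) hz).symm

theorem mem_prescribed {A : FilteredSheaf k} {z : Cstar} {x : stk ((piPull k).obj A.L) z} :
    x ∈ prescribed A z ↔ ∀ ξ, z ∈ circ ξ → x ∈ stalkRange ((piPull k).map (A.incl ξ)) z := by
  simp only [prescribed, Submodule.mem_iInf]

theorem mem_prescribed_iff (hS : IsConstructible S F) (hF : IsAcyclic F)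
    (hι : IsRestriction ι) {z : Cstar} (x : stk (pb dirMap (farSheaf id F)) z) :
    x ∈ prescribed ((Psi k).obj F) z ↔
      stalkMap (comparison F) z x ∈ stalkRange (ι.app F) z := by
  obtain ⟨ξ, hξ⟩ := exists_mem_circ z
  refine Iff.trans ?_ (mem_stalkRange_piPull_iff_comparison hS hF hι hξ x)
  refine mem_prescribed.trans ⟨fun h => h ξ hξ, fun h ξ' hξ' => ?_⟩
  exact (mem_stalkRange_piPull_iff_comparison hS hF hι hξ' x).2
    ((mem_stalkRange_piPull_iff_comparison hS hF hι hξ x).1 h)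

/-- The prescribed subspaces correspond under the comparison to the stalks of a genuine subsheaf. A
section of that subsheaf, carried back by the inverse comparison, has prescribed germs on a whole
neighbourhood, so σ loses nothing on stalks. -/
theorem mem_stalkRange_sigma_iff (hS : IsConstructible S F) (hF : IsAcyclic F)
    (hι : IsRestriction ι) {z : Cstar} (x : stk (pb dirMap (farSheaf id F)) z) :
    x ∈ stalkRange ((sigma k).obj ((Psi k).obj F)).incl z ↔
      stalkMap (comparison F) z x ∈ stalkRange (ι.app F) z := by
  have hiso := isIso_comparison hS hF
  refine (mem_stalkRange_subSheafIncl (A := pb dirMap (farSheaf id F))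
    (P := prescribed ((Psi k).obj F))).trans ⟨?_, ?_⟩
  · rintro ⟨U, hU, s, rfl, hs⟩
    exact (mem_prescribed_iff hS hF hι _).1 (hs z hU)
  · rintro ⟨a, ha⟩
    obtain ⟨U, hU, s, rfl⟩ := exists_gat_eq ((directG k).obj F) a
    let j : (directG k).obj F ⟶ pb dirMap (farSheaf id F) :=
      ι.app F ≫ (inv (comparison F) : farSheaf dir F ⟶ _)
    have hj : ∀ z b, stalkMap (comparison F) z (stalkMap j z b) = stalkMap (ι.app F) z b := by
      intro z b
      have e : j ≫ comparison F = ι.app F :=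
        (Category.assoc _ _ _).trans ((congrArg (ι.app F ≫ ·) (IsIso.inv_hom_id (I := hiso) _)).trans
          (Category.comp_id _))
      exact (stalkMap_comp j (comparison F) z b).symm.trans (congrArg (fun f => stalkMap f z b) e)
    refine ⟨U, hU, secMap j U s, ?_, fun z' _ => ?_⟩
    · refine (stalkMap_bijective_of_isIso (comparison F) z).1 ?_
      rw [← stalkMap_gat, hj]
      exact ha
    · refine (mem_prescribed_iff hS hF hι _).2 ?_
      rw [← stalkMap_gat, hj]
      exact ⟨_, rfl⟩

theorem hasPrescribedStalks_Psi (hS : IsConstructible S F) (hF : IsAcyclic F)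
    (hι : IsRestriction ι) : HasPrescribedStalks ((Psi k).obj F) := fun _ _ hξ =>
  Submodule.ext fun x => (mem_stalkRange_sigma_iff hS hF hι x).trans
    (mem_stalkRange_piPull_iff_comparison hS hF hι hξ x).symm

theorem isCoStokesSheaf_pairFunctor (hS : IsConstructible S F) (hF : IsAcyclic F)
    (hι : IsRestriction ι) : IsCoStokesSheaf S ((pairFunctor ι).obj F) :=
  isCoStokesSheaf_of_isFarRes hS hF (ι.app F) (isFarRes_of_isRestriction hι F)

/-- Being a co-Stokes sheaf is invariant under isomorphisms that match the subsheaves. -/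
theorem IsCoStokesSheaf.of_isIso {A B : SheafPair k} (hB : IsCoStokesSheaf S B) (hA : Mono A.incl)
    (f : A.L ⟶ B.L) (hf : IsIso f)
    (h : ∀ z x, x ∈ stalkRange A.incl z ↔ stalkMap f z x ∈ stalkRange B.incl z) :
    IsCoStokesSheaf S A := by
  refine ⟨hA, fun z₀ => ?_⟩
  obtain ⟨U, hU, gr, hgr, t, ht⟩ := hB.2 z₀
  refine ⟨U, hU, gr, hgr, secMap (inv f) U ∘ₗ t, fun z hz => ?_⟩
  have e : ∀ x, germ A.L U z hz (secMap (inv f) U (t x)) =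
      stalkMap (inv f) z (germ B.L U z hz (t x)) := fun x => by
    rw [← gat_of_mem hz, ← gat_of_mem hz, stalkMap_gat]
  refine ⟨?_, fun x => ?_⟩
  · have := (stalkMap_bijective_of_isIso (inv f) z).comp (ht z hz).1
    convert this using 1
    exact funext e
  · refine Iff.trans ?_ ((ht z hz).2 x)
    refine (h z _).trans ?_
    have e2 : stalkMap f z (germ A.L U z hz (secMap (inv f) U (t x))) = germ B.L U z hz (t x) := by
      rw [e, ← stalkMap_comp, IsIso.inv_hom_id, stalkMap_id]
    exact iff_of_eq (congrArg (· ∈ stalkRange B.incl z) e2)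

theorem isCoStokesSheaf_sigma_Psi (hS : IsConstructible S F) (hF : IsAcyclic F)
    (hι : IsRestriction ι) : IsCoStokesSheaf S ((sigma k).obj ((Psi k).obj F)) := by
  have hiso := isIso_comparison hS hF
  exact (isCoStokesSheaf_pairFunctor hS hF hι).of_isIso (A := (sigma k).obj ((Psi k).obj F))
    (mono_subSheafIncl _ _) (comparison F) hiso fun z x => mem_stalkRange_sigma_iff hS hF hι x

/-- Morphisms of pairs are determined by the component on L and only require that G be carried to
G', which for subsheaves can be tested on stalks. -/
theorem exists_sheafPair_iso {A B : SheafPair k} [Mono A.incl] [Mono B.incl]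
    (f : A.L ⟶ B.L) (hf : IsIso f)
    (h : ∀ z x, x ∈ stalkRange A.incl z ↔ stalkMap f z x ∈ stalkRange B.incl z) :
    ∃ e : A ≅ B, e.hom.hom = f := by
  have h1 : ∃ g : A.G ⟶ B.G, g ≫ B.incl = A.incl ≫ f := by
    refine exists_lift_of_stalkRange_le _ _ fun z => ?_
    rintro _ ⟨a, rfl⟩
    rw [stalkMap_comp]
    exact (h z _).1 ⟨a, rfl⟩
  have h2 : ∃ g : B.G ⟶ A.G, g ≫ A.incl = B.incl ≫ inv f := by
    refine exists_lift_of_stalkRange_le _ _ fun z => ?_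
    rintro _ ⟨a, rfl⟩
    refine (h z _).2 ⟨a, ?_⟩
    rw [← stalkMap_comp, Category.assoc, IsIso.inv_hom_id, Category.comp_id]
  exact ⟨{ hom := ⟨f, h1⟩
           inv := ⟨inv f, h2⟩
           hom_inv_id := SheafPair.Hom.ext (IsIso.hom_inv_id f)
           inv_hom_id := SheafPair.Hom.ext (IsIso.inv_hom_id f) }, rfl⟩

theorem exists_iso_pair (hS : IsConstructible S F) (hF : IsAcyclic F) (hι : IsRestriction ι) :
    ∃ e : (sigma k).obj ((Psi k).obj F) ≅ (pairFunctor ι).obj F, e.hom.hom = comparison F := by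
  have hiso := isIso_comparison hS hF
  have : Mono ((pairFunctor ι).obj F).incl := (isCoStokesSheaf_pairFunctor hS hF hι).1
  have : Mono ((sigma k).obj ((Psi k).obj F)).incl := mono_subSheafIncl _ _
  exact exists_sheafPair_iso (A := (sigma k).obj ((Psi k).obj F)) (B := (pairFunctor ι).obj F)
    (comparison F) hiso fun z x => mem_stalkRange_sigma_iff hS hF hι x

theorem nonempty_iso_pairFunctor (hι : IsRestriction ι) :
    Nonempty ((Constr₀ k).ι ⋙ Psi k ⋙ sigma k ≅ (Constr₀ k).ι ⋙ pairFunctor ι) := by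
  have h : ∀ F : (Constr₀ k).FullSubcategory,
      ∃ e : (sigma k).obj ((Psi k).obj F.obj) ≅ (pairFunctor ι).obj F.obj,
        e.hom.hom = comparison F.obj := fun F => by
    obtain ⟨⟨S, hS⟩, hF⟩ := F.property
    exact exists_iso_pair hS hF hι
  choose e he using h
  -- Naturality of pairs is equality of the components on L, which are the comparison maps and do
  -- not depend on the choice of S.
  refine ⟨NatIso.ofComponents (fun F => e F) fun {F F'} a => SheafPair.Hom.ext ?_⟩
  obtain ⟨⟨S, hS⟩, hF⟩ := F.property
  have := comparison_naturality hS hF a.hom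
  rw [← he F, ← he F'] at this
  exact this

end Main

end TopLaplace

end

theorem mainTheorem11 (k : Type) [Field k] :
    ∃ ι : directG k ⟶ directL k,
      IsRestriction ι ∧ (∀ ι' : directG k ⟶ directL k, IsRestriction ι' → ι' = ι) ∧
      (∀ F : Sh k ℂ, Constr₀ k F → ∀ S : Finset ℂ, IsConstructible S F →
        IsCoStokesStructure S ((Psi k).obj F) ∧
        HasPrescribedStalks ((Psi k).obj F) ∧
        IsCoStokesSheaf S ((sigma k).obj ((Psi k).obj F)) ∧
        IsCoStokesSheaf S ((pairFunctor ι).obj F)) ∧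
      Nonempty ((Constr₀ k).ι ⋙ Psi k ⋙ sigma k ≅ (Constr₀ k).ι ⋙ pairFunctor ι) := by
  obtain ⟨ι, hι⟩ := exists_iota k
  exact ⟨ι, hι, fun _ h => iota_unique hι h, fun F hF S hS =>
    ⟨isCoStokesStructure_Psi hS hF.2, hasPrescribedStalks_Psi hS hF.2 hι,
      isCoStokesSheaf_sigma_Psi hS hF.2 hι, isCoStokesSheaf_pairFunctor hS hF.2 hι⟩,
    nonempty_iso_pairFunctor hι⟩
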